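/- Let $K/F$ be a Galois extension of fields of characteristic different from $2$ whose Galois group $G=\operatorname{Gal}(K/F)$ is isomorphic, as a topological group, to $\hat{\mathbb Z}$; fix such an isomorphism. For an open subgroup $H\le G$ let $A(H)$ be the Burnside ring of $H$ (formal differences of isomorphism classes of finite continuous $H$-sets). The rings $A(H)$, with restriction, transfer $X\mapsto H\times_L X$, norm $X\mapsto \operatorname{Map}_L(H,X)$ (extended polynomially to formal differences) and conjugation, form the Burnside Tambara functor $\underline A$ of $G$, with $\underline A(G/H)=A(H)$. A Tambara ideal $\mathcal I$ of $\underline A$ is a family of ideals $\mathcal I(G/H)\subseteq A(H)$ closed under restriction, transfer and conjugation and such that the norm from $L$ to $H$ maps $\mathcal I(G/L)$ into $\mathcal I(G/H)+N_L^H(0)$. The Tambara ideal generated by a set of elements is the intersection of all Tambara ideals containing it; an ideal is strongly principal if it is generated by one element of $A(H)$ for one open subgroup $H$, and finitely generated if it is generated by finitely many elements. The trace ideal $\mathrm{TI}_{K/F}$ is the kernel of the Dress map: $\mathrm{TI}_{K/F}(G/H)$ is the kernel of the homomorphism $\mathcal D_H\colon A(H)\to GW(K^H)$ that sends $[H/L]$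 to the trace form $x\mapsto \operatorname{tr}_{K^L/K^H}(x^2)$ on $K^L$, where $GW$ is the Grothendieck–Witt ring. For positive integers $M,k$ let $t_{M,k}\in A(M\hat{\mathbb Z})$ be the class of the transitive set $M\hat{\mathbb Z}/kM\hat{\mathbb Z}$. Then: 1. The trace ideal $\mathrm{TI}_{K/F}$ is a Tambara ideal, and it is generated by the elements $t_{2^n,4}-t_{2^n,2}-2\in A(2^n\hat{\mathbb Z})$ for all $n\ge 0$ together with the elements $t_{p^n,p}-p\in A(p^n\hat{\mathbb Z})$ for all odd primes $p$ and all $n\ge 0$. 2. It is the union of an ascending chain of strongly principal ideals. Explicitly, for $n\ge 4$ put $m=n!$ and let $\mathcal I_n$ be the Tambara ideal generated by the single element $t_{m,4}-t_{m,2}-2+\sum_{p<n,\ p\text{ odd prime}}(t_{m,p}-p)\in A(m\hat{\mathbb Z})$. Then $\mathcal I_4\subseteq\mathcal I_5\subseteq\cdots$, and $\mathrm{TI}_{K/F}(G/H)=\bigcup_{n\ge4}\mathcal I_n(G/H)$ for every open subgroup $H\le G$. 3. $\mathrm{TI}_{K/F}$ is not finitely generated as a Tambara ideal. -/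

import Mathlib

universe u v

set_option linter.unusedSectionVars false

noncomputable section

namespace TraceIdeal

/-! ## The Grothendieck ring of a commutative semiring -/

/-- The Grothendieck ring of a commutative semiring: formal differences of its elements. -/
abbrev GrothendieckRing (R : Type u) [CommSemiring R] : Type u := Algebra.GrothendieckAddGroup R

namespace GrothendieckRing

variable {R : Type u} [CommSemiring R]

/-- The class of an element. -/
def of : R →+ GrothendieckRing R := Algebra.GrothendieckAddGroup.of

/-- The additive extension of an additive map to formal differences. -/
def lift {A : Type v} [AddCommGroup A] (f : R →+ A) : GrothendieckRing R →+ A :=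
  Algebra.GrothendieckAddGroup.lift f

@[simp] theorem lift_of {A : Type v} [AddCommGroup A] (f : R →+ A) (a : R) :
    lift f (of a) = f a :=
  DFunLike.congr_fun (Algebra.GrothendieckAddGroup.lift.symm_apply_apply f) a

theorem mk_eq (a : R) (b : (⊤ : AddSubmonoid R)) :
    (AddLocalization.mk a b : GrothendieckRing R) = of a - of (b : R) := by
  have h : ∀ c : R, (of c : GrothendieckRing R) = AddLocalization.mk c 0 := fun c =>
    (AddLocalization.mk_zero_eq_addMonoidOf_mk c).symm
  rw [h, h, Algebra.GrothendieckAddGroup.mk_sub_mk]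
  congr 1
  · simp
  · exact Subtype.ext (by simp)

theorem exists_eq_sub (x : GrothendieckRing R) : ∃ a b : R, x = of a - of b := by
  refine AddLocalization.induction_on x fun y => ⟨y.1, y.2, mk_eq _ _⟩

/-- Multiplication of formal differences as a biadditive map. -/
def mulHom : GrothendieckRing R →+ GrothendieckRing R →+ GrothendieckRing R :=
  lift
    { toFun := fun a => lift (of.comp (AddMonoidHom.mulLeft a))
      map_zero' := by
        ext x; obtain ⟨a, b, rfl⟩ := exists_eq_sub x; simp
      map_add' := fun a a' => by
        ext x; obtain ⟨b, c, rfl⟩ := exists_eq_sub x; simp [add_mul]; abel }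

@[simp] theorem mulHom_of_of (a b : R) : mulHom (of a) (of b) = of (a * b) := by
  simp [mulHom]

instance instCommRing : CommRing (GrothendieckRing R) where
  __ := (inferInstance : AddCommGroup (Algebra.GrothendieckAddGroup R))
  mul x y := mulHom x y
  one := of 1
  left_distrib x y z := map_add (mulHom x) y z
  right_distrib x y z := by
    change mulHom (x + y) z = mulHom x z + mulHom y z
    simp
  zero_mul x := by change mulHom 0 x = 0; simp
  mul_zero x := by change mulHom x 0 = 0; simp
  mul_assoc x y z := by
    change mulHom (mulHom x y) z = mulHom x (mulHom y z)
    obtain ⟨a, b, rfl⟩ := exists_eq_sub x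
    obtain ⟨c, d, rfl⟩ := exists_eq_sub y
    obtain ⟨e, f, rfl⟩ := exists_eq_sub z
    simp only [map_sub, AddMonoidHom.sub_apply, mulHom_of_of, mul_assoc]
  one_mul x := by
    change mulHom (of 1) x = x
    obtain ⟨a, b, rfl⟩ := exists_eq_sub x
    simp
  mul_one x := by
    change mulHom x (of 1) = x
    obtain ⟨a, b, rfl⟩ := exists_eq_sub x
    simp
  mul_comm x y := by
    change mulHom x y = mulHom y x
    obtain ⟨a, b, rfl⟩ := exists_eq_sub x
    obtain ⟨c, d, rfl⟩ := exists_eq_sub y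
    simp only [map_sub, AddMonoidHom.sub_apply, mulHom_of_of, mul_comm]
    abel

/-- The canonical semiring homomorphism into the Grothendieck ring. -/
def ofHom : R →+* GrothendieckRing R where
  __ := of
  map_one' := rfl
  map_mul' a b := (mulHom_of_of a b).symm

/-- The ring homomorphism between Grothendieck rings induced by a semiring homomorphism. -/
def map {S : Type v} [CommSemiring S] (f : R →+* S) : GrothendieckRing R →+* GrothendieckRing S where
  __ := lift (of.comp f.toAddMonoidHom)
  map_one' := by
    change lift (of.comp f.toAddMonoidHom) (of 1) = of 1
    simp
  map_mul' x y := by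
    change lift (of.comp f.toAddMonoidHom) (mulHom x y) =
      mulHom (lift (of.comp f.toAddMonoidHom) x) (lift (of.comp f.toAddMonoidHom) y)
    obtain ⟨a, b, rfl⟩ := exists_eq_sub x
    obtain ⟨c, d, rfl⟩ := exists_eq_sub y
    simp

/-- The extension of a function `f` on `R` to formal differences:
`f (a - b) = ∑_{k ≤ d} ∑_{j ≤ k} (-1)^j (k choose j) f (a + j b)`.
This is the unique extension of `f` to a polynomial map of degree `≤ d` when `f` itself
is polynomial of degree `≤ d`. -/
def polySum {A : Type v} [AddCommGroup A] (d : ℕ) (f : R → A) (a b : R) : A :=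
  ∑ k ∈ Finset.range (d + 1), ∑ j ∈ Finset.range (k + 1),
    ((-1 : ℤ) ^ j * (k.choose j : ℤ)) • f (a + j • b)

section Poly

variable {A : Type v} [AddCommGroup A]

/-- Translation operators on functions. -/
def shift (y : R) : Module.End ℤ (R → A) where
  toFun g := fun x => g (x + y)
  map_add' _ _ := rfl
  map_smul' _ _ := rfl

theorem shift_mul (y z : R) : (shift y * shift z : Module.End ℤ (R → A)) = shift (y + z) := by
  ext g x
  simp [shift, add_assoc]

theorem shift_comm (y z : R) : Commute (shift y : Module.End ℤ (R → A)) (shift z) := by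
  rw [Commute, SemiconjBy, shift_mul, shift_mul, add_comm]

theorem shift_pow (y : R) (j : ℕ) : (shift y : Module.End ℤ (R → A)) ^ j = shift (j • y) := by
  induction j with
  | zero => ext g x; simp [shift]
  | succ j ih => rw [pow_succ, ih, shift_mul, succ_nsmul]

theorem one_sub_shift_pow (y : R) (k : ℕ) (f : R → A) (x : R) :
    (((1 - shift y : Module.End ℤ (R → A)) ^ k) f) x =
      ∑ j ∈ Finset.range (k + 1), ((-1 : ℤ) ^ j * (k.choose j : ℤ)) • f (x + j • y) := by
  have h : (1 - shift y : Module.End ℤ (R → A)) = (-shift y) + 1 := by abel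
  rw [h, (Commute.one_right _).add_pow]
  simp only [one_pow, mul_one, LinearMap.sum_apply, Finset.sum_apply]
  refine Finset.sum_congr rfl fun j _ => ?_
  have h2 : ((-shift y : Module.End ℤ (R → A)) ^ j) = ((-1 : ℤ) ^ j) • shift (j • y) := by
    rw [neg_pow, shift_pow]
    rcases Nat.even_or_odd j with hj | hj <;> simp [hj.neg_one_pow]
  have h3 : ((k.choose j : ℕ) : Module.End ℤ (R → A)) = ((k.choose j : ℤ)) • 1 := by
    simp
  rw [h2, h3, smul_mul_smul_comm, mul_one]
  rfl

theorem polySum_add {d : ℕ} {f : R → A}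
    (hf : ∀ y : R, ((1 - shift y : Module.End ℤ (R → A)) ^ (d + 1)) f = 0) (a b c : R) :
    polySum d f (a + c) (b + c) = polySum d f a b := by
  have key : ∀ x y : R, polySum d f x y =
      ((∑ k ∈ Finset.range (d + 1), (1 - shift y : Module.End ℤ (R → A)) ^ k) f) x := by
    intro x y
    simp only [polySum, LinearMap.sum_apply, Finset.sum_apply, one_sub_shift_pow]
  have geom : ∀ y : R, (shift y : Module.End ℤ (R → A)) *
      (∑ k ∈ Finset.range (d + 1), (1 - shift y : Module.End ℤ (R → A)) ^ k) =
        1 - (1 - shift y) ^ (d + 1) := by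
    intro y
    have := mul_neg_geom_sum (1 - shift y : Module.End ℤ (R → A)) (d + 1)
    rwa [sub_sub_cancel] at this
  set P : Module.End ℤ (R → A) :=
    ∑ k ∈ Finset.range (d + 1), (1 - shift b : Module.End ℤ (R → A)) ^ k with hP
  set Q : Module.End ℤ (R → A) :=
    ∑ k ∈ Finset.range (d + 1), (1 - shift (b + c) : Module.End ℤ (R → A)) ^ k with hQ
  have comm : ∀ y z : R, Commute (shift y : Module.End ℤ (R → A))
      (∑ k ∈ Finset.range (d + 1), (1 - shift z : Module.End ℤ (R → A)) ^ k) := fun y z =>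
    Commute.sum_right _ _ _ fun k _ =>
      ((Commute.one_right _).sub_right (shift_comm y z)).pow_right k
  have commPQ : Commute P Q :=
    Commute.sum_left _ _ _ fun k _ =>
      ((Commute.one_left _).sub_left (comm b (b + c))).pow_left k
  have h1 : (shift c * Q : Module.End ℤ (R → A)) f = P f := by
    have e1 : P * (shift (b + c) * Q) = shift c * (Q * (shift b * P)) := by
      have c1 : Commute P (shift c * shift b * Q) :=
        ((comm c b).symm.mul_right (comm b b).symm).mul_right commPQ
      rw [add_comm b c, ← shift_mul c b, c1.eq, mul_assoc, mul_assoc, ← mul_assoc (shift b) Q P,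
        (comm b (b + c)).eq, mul_assoc]
    rw [geom, geom] at e1
    have e2 := congrArg (fun T : Module.End ℤ (R → A) => T f) e1
    simpa [hf, mul_sub] using e2.symm
  have h2 := congrFun h1 a
  rw [key, key, ← hP, ← hQ, ← h2]
  rfl

/-- Extension of `f` to a polynomial map of degree `≤ d` on formal differences. -/
def polyExtend (d : ℕ) (f : R → A)
    (hf : ∀ y : R, ((1 - shift y : Module.End ℤ (R → A)) ^ (d + 1)) f = 0)
    (x : GrothendieckRing R) : A :=
  AddLocalization.liftOn x (fun a b => polySum d f a b) (by
    intro a c b e h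
    obtain ⟨t, ht⟩ := AddLocalization.r_iff_exists.1 h
    simp only at ht
    rw [← polySum_add hf a b (e + t), ← polySum_add hf c e (b + t)]
    congr 1
    · rw [← add_assoc, ← add_assoc, add_comm a, add_comm c, add_comm _ (t : R),
        add_comm _ (t : R), ht]
    · abel)

end Poly

end GrothendieckRing

/-! ## Finite `H`-sets and the Burnside ring of a topological group -/

/-- A finite `H`-set with continuous action (for the discrete topology on the set), that is,
with open stabilizers. -/
structure FinGSet (H : Type u) [Group H] [TopologicalSpace H] : Type (u + 1) where
  carrier : Type u
  [mulAction : MulAction H carrier]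
  [finite : Finite carrier]
  isOpen_stabilizer : ∀ x : carrier, IsOpen (MulAction.stabilizer H x : Set H)

namespace FinGSet

attribute [instance] FinGSet.mulAction FinGSet.finite

variable {H : Type u} [Group H] [TopologicalSpace H]

/-- Isomorphism of finite `H`-sets. -/
def Iso (X Y : FinGSet H) : Prop :=
  ∃ e : X.carrier ≃ Y.carrier, ∀ (h : H) (x : X.carrier), e (h • x) = h • e x

theorem Iso.refl (X : FinGSet H) : Iso X X := ⟨Equiv.refl _, fun _ _ => rfl⟩

theorem Iso.symm {X Y : FinGSet H} : Iso X Y → Iso Y X := by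
  rintro ⟨e, he⟩
  exact ⟨e.symm, fun h y => by rw [Equiv.symm_apply_eq, he, Equiv.apply_symm_apply]⟩

theorem Iso.trans {X Y Z : FinGSet H} : Iso X Y → Iso Y Z → Iso X Z := by
  rintro ⟨e, he⟩ ⟨f, hf⟩
  exact ⟨e.trans f, fun h x => by simp [he, hf]⟩

instance setoid (H : Type u) [Group H] [TopologicalSpace H] : Setoid (FinGSet H) where
  r := Iso
  iseqv := ⟨Iso.refl, Iso.symm, Iso.trans⟩

/-- Disjoint union. -/
def sum (X Y : FinGSet H) : FinGSet H where
  carrier := X.carrier ⊕ Y.carrier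
  isOpen_stabilizer := by
    rintro (x | y)
    · convert X.isOpen_stabilizer x using 1
      ext h; simp [MulAction.mem_stabilizer_iff, Sum.smul_inl]
    · convert Y.isOpen_stabilizer y using 1
      ext h; simp [MulAction.mem_stabilizer_iff, Sum.smul_inr]

/-- Cartesian product with the diagonal action. -/
def prod (X Y : FinGSet H) : FinGSet H where
  carrier := X.carrier × Y.carrier
  isOpen_stabilizer := by
    rintro ⟨x, y⟩
    convert (X.isOpen_stabilizer x).inter (Y.isOpen_stabilizer y) using 1
    ext h; simp [MulAction.mem_stabilizer_iff]

/-- The empty `H`-set. -/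
def empty (H : Type u) [Group H] [TopologicalSpace H] : FinGSet H where
  carrier := PEmpty
  mulAction :=
    { smul := fun _ x => x
      one_smul := fun _ => rfl
      mul_smul := fun _ _ _ => rfl }
  isOpen_stabilizer := fun x => x.elim

/-- The one-point `H`-set. -/
def point (H : Type u) [Group H] [TopologicalSpace H] : FinGSet H where
  carrier := PUnit
  isOpen_stabilizer := fun x => by
    convert isOpen_univ using 1
    ext h; simp [MulAction.mem_stabilizer_iff]

/-- The transitive `H`-set `H / L`, for `L` an open subgroup of finite index. -/
def quotient (L : Subgroup H) [ContinuousMul H] (hL : IsOpen (L : Set H)) [Finite (H ⧸ L)] :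
    FinGSet H where
  carrier := H ⧸ L
  isOpen_stabilizer := by
    intro x
    induction x using QuotientGroup.induction_on with
    | H g =>
      have : (MulAction.stabilizer H (g : H ⧸ L) : Set H) = (fun h => g⁻¹ * (h * g)) ⁻¹' L := by
        ext h
        rw [SetLike.mem_coe, MulAction.mem_stabilizer_iff, eq_comm]
        exact QuotientGroup.eq
      rw [this]
      exact hL.preimage (by fun_prop)

end FinGSet

/-- The semiring of isomorphism classes of finite `H`-sets, under disjoint union and
cartesian product. -/
def BurnsideSemiring (H : Type u) [Group H] [TopologicalSpace H] : Type (u + 1) :=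
  Quotient (FinGSet.setoid H)

namespace BurnsideSemiring

variable {H : Type u} [Group H] [TopologicalSpace H]

/-- The isomorphism class of a finite `H`-set. -/
def mk (X : FinGSet H) : BurnsideSemiring H := Quotient.mk _ X

theorem mk_eq_mk {X Y : FinGSet H} : mk X = mk Y ↔ FinGSet.Iso X Y := Quotient.eq

theorem mk_eq_of_equiv {X Y : FinGSet H} (e : X.carrier ≃ Y.carrier)
    (he : ∀ (h : H) (x : X.carrier), e (h • x) = h • e x) : mk X = mk Y :=
  mk_eq_mk.2 ⟨e, he⟩

theorem ind {p : BurnsideSemiring H → Prop} (h : ∀ X, p (mk X)) (x : BurnsideSemiring H) : p x :=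
  Quotient.ind h x

instance : Add (BurnsideSemiring H) :=
  ⟨Quotient.map₂ FinGSet.sum (by
    rintro X X' ⟨e, he⟩ Y Y' ⟨f, hf⟩
    refine ⟨Equiv.sumCongr e f, ?_⟩
    rintro h (x | y)
    · exact congrArg Sum.inl (he h x)
    · exact congrArg Sum.inr (hf h y))⟩

instance : Mul (BurnsideSemiring H) :=
  ⟨Quotient.map₂ FinGSet.prod (by
    rintro X X' ⟨e, he⟩ Y Y' ⟨f, hf⟩
    exact ⟨Equiv.prodCongr e f, fun h x => Prod.ext (he h x.1) (hf h x.2)⟩)⟩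

instance : Zero (BurnsideSemiring H) := ⟨mk (FinGSet.empty H)⟩

instance : One (BurnsideSemiring H) := ⟨mk (FinGSet.point H)⟩

theorem mk_add_mk (X Y : FinGSet H) : mk X + mk Y = mk (X.sum Y) := rfl

theorem mk_mul_mk (X Y : FinGSet H) : mk X * mk Y = mk (X.prod Y) := rfl

theorem zero_def : (0 : BurnsideSemiring H) = mk (FinGSet.empty H) := rfl

theorem one_def : (1 : BurnsideSemiring H) = mk (FinGSet.point H) := rfl

private theorem add_comm' (x y : BurnsideSemiring H) : x + y = y + x := by
  induction x using ind; induction y using ind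
  refine mk_eq_of_equiv (Equiv.sumComm _ _) ?_
  rintro h (x | y) <;> rfl

private theorem zero_add' (x : BurnsideSemiring H) : 0 + x = x := by
  induction x using ind
  refine mk_eq_of_equiv (Equiv.emptySum PEmpty _) ?_
  rintro h (x | y)
  · exact x.elim
  · rfl

private theorem mul_comm' (x y : BurnsideSemiring H) : x * y = y * x := by
  induction x using ind; induction y using ind
  exact mk_eq_of_equiv (Equiv.prodComm _ _) fun _ _ => rfl

private theorem one_mul' (x : BurnsideSemiring H) : 1 * x = x := by
  induction x using ind
  exact mk_eq_of_equiv (Equiv.punitProd _) fun _ _ => rfl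

private theorem zero_mul' (x : BurnsideSemiring H) : 0 * x = 0 := by
  induction x using ind
  exact mk_eq_of_equiv (Equiv.pemptyProd _) fun _ x => x.1.elim

private theorem left_distrib' (x y z : BurnsideSemiring H) : x * (y + z) = x * y + x * z := by
  induction x using ind; induction y using ind; induction z using ind
  refine mk_eq_of_equiv (Equiv.prodSumDistrib _ _ _) ?_
  rintro h ⟨x, (y | z)⟩ <;> rfl

instance instCommSemiring : CommSemiring (BurnsideSemiring H) where
  add_assoc x y z := by
    induction x using ind; induction y using ind; induction z using ind
    refine mk_eq_of_equiv (Equiv.sumAssoc _ _ _) ?_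
    rintro h ((x | y) | z) <;> rfl
  zero_add := zero_add'
  add_zero x := by rw [add_comm', zero_add']
  add_comm := add_comm'
  mul_assoc x y z := by
    induction x using ind; induction y using ind; induction z using ind
    exact mk_eq_of_equiv (Equiv.prodAssoc _ _ _) fun _ _ => rfl
  one_mul := one_mul'
  mul_one x := by rw [mul_comm', one_mul']
  mul_comm := mul_comm'
  zero_mul := zero_mul'
  mul_zero x := by rw [mul_comm', zero_mul']
  left_distrib := left_distrib'
  right_distrib x y z := by
    rw [mul_comm', left_distrib', mul_comm' z x, mul_comm' z y]
  nsmul := nsmulRec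

end BurnsideSemiring

/-- The Burnside ring `A(H)`. -/
abbrev BurnsideRing (H : Type u) [Group H] [TopologicalSpace H] : Type (u + 1) :=
  GrothendieckRing (BurnsideSemiring H)

/-- The class of a finite `H`-set in the Burnside ring. -/
def BurnsideRing.cls {H : Type u} [Group H] [TopologicalSpace H] (X : FinGSet H) :
    BurnsideRing H :=
  GrothendieckRing.of (BurnsideSemiring.mk X)

/-! ## Restriction, transfer and norm -/

namespace FinGSet

variable {L H : Type u} [Group L] [TopologicalSpace L] [Group H] [TopologicalSpace H]

/-- The `L`-set obtained from an `H`-set by letting `L` act through `φ : L → H`. -/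
def pullback (φ : L →* H) (hφ : Continuous φ) (X : FinGSet H) : FinGSet L where
  carrier := X.carrier
  mulAction := MulAction.compHom X.carrier φ
  isOpen_stabilizer x := (X.isOpen_stabilizer x).preimage hφ

/-- An `H`-stable subset of a finite `H`-set. -/
def sub (X : FinGSet H) (p : X.carrier → Prop) (hp : ∀ (h : H) x, p x → p (h • x)) :
    FinGSet H where
  carrier := {x : X.carrier // p x}
  mulAction :=
    { smul := fun h x => ⟨h • x.1, hp h x.1 x.2⟩
      one_smul := fun x => Subtype.ext (one_smul H x.1)
      mul_smul := fun a b x => Subtype.ext (mul_smul a b x.1) }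
  isOpen_stabilizer x := by
    convert X.isOpen_stabilizer x.1 using 1
    ext h
    exact Subtype.ext_iff

variable (φ : L →* H)

/-- The equivalence relation on `H × X` with quotient `H ×_L X`. -/
def inductionSetoid (X : FinGSet L) : Setoid (H × X.carrier) where
  r a b := ∃ l : L, b.1 = a.1 * φ l⁻¹ ∧ b.2 = l • a.2
  iseqv :=
    { refl := fun a => ⟨1, by simp⟩
      symm := by
        rintro a b ⟨l, h1, h2⟩
        exact ⟨l⁻¹, by simp [h1], by simp [h2]⟩
      trans := by
        rintro a b c ⟨l, h1, h2⟩ ⟨m, h3, h4⟩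
        exact ⟨m * l, by simp [h1, h3, mul_assoc], by simp [h2, h4, mul_smul]⟩ }

/-- The action of `H` on `H ×_L X` by left multiplication. -/
instance inductionAction (X : FinGSet L) : MulAction H (Quotient (inductionSetoid φ X)) where
  smul h := Quotient.map (fun a => (h * a.1, a.2)) (by
    rintro a b ⟨l, h1, h2⟩
    exact ⟨l, by simp [h1, mul_assoc], h2⟩)
  one_smul x := by
    induction x using Quotient.inductionOn with
    | h a => exact congrArg (Quotient.mk _) (Prod.ext (one_mul _) rfl)
  mul_smul h h' x := by
    induction x using Quotient.inductionOn with
    | h a => exact congrArg (Quotient.mk _) (Prod.ext (mul_assoc _ _ _) rfl)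

theorem induction_smul_mk (X : FinGSet L) (h : H) (a : H × X.carrier) :
    h • (Quotient.mk (inductionSetoid φ X) a) = Quotient.mk _ (h * a.1, a.2) := rfl

instance [Finite (H ⧸ φ.range)] (X : FinGSet L) : Finite (Quotient (inductionSetoid φ X)) := by
  refine Finite.of_surjective
    (fun q : (H ⧸ φ.range) × X.carrier => Quotient.mk (inductionSetoid φ X) (q.1.out, q.2)) ?_
  intro x
  induction x using Quotient.inductionOn with
  | h a =>
    obtain ⟨⟨_, l, rfl⟩, hl⟩ := QuotientGroup.mk_out_eq_mul φ.range a.1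
    refine ⟨((a.1 : H ⧸ φ.range), l⁻¹ • a.2), Quotient.sound ⟨l, ?_, ?_⟩⟩
    · simp only at hl
      simp [hl]
    · simp

/-- The set `Map_L(H, X)` of functions `s : H → X` with `s (l h) = l • s h`. -/
@[ext]
structure Coind (X : FinGSet L) : Type u where
  fn : H → X.carrier
  map_mul : ∀ (l : L) (h : H), fn (φ l * h) = l • fn h

/-- The action of `H` on `Map_L(H, X)` by right translation. -/
instance coindAction (X : FinGSet L) : MulAction H (Coind φ X) where
  smul a s := ⟨fun h => s.fn (h * a), fun l h => by rw [mul_assoc, s.map_mul]⟩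
  one_smul s := Coind.ext (funext fun h => congrArg s.fn (mul_one h))
  mul_smul a b s := Coind.ext (funext fun h => congrArg s.fn (mul_assoc h a b).symm)

theorem coind_smul_apply {X : FinGSet L} (a : H) (s : Coind φ X) (h : H) :
    (a • s).fn h = s.fn (h * a) := rfl

theorem exists_rep (h : H) : ∃ (l : L) (q : H ⧸ φ.range), h = φ l * q.out⁻¹ := by
  obtain ⟨⟨_, l, rfl⟩, hl⟩ := QuotientGroup.mk_out_eq_mul φ.range h⁻¹
  refine ⟨l, ((h⁻¹ : H) : H ⧸ φ.range), ?_⟩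
  simp only at hl
  simp [hl]

theorem coind_ext {X : FinGSet L} {s t : Coind φ X}
    (h : ∀ q : H ⧸ φ.range, s.fn q.out⁻¹ = t.fn q.out⁻¹) : s = t := by
  refine Coind.ext (funext fun a => ?_)
  obtain ⟨l, q, rfl⟩ := exists_rep φ a
  rw [s.map_mul, t.map_mul, h]

instance [Finite (H ⧸ φ.range)] (X : FinGSet L) : Finite (Coind φ X) :=
  Finite.of_injective (fun (s : Coind φ X) (q : H ⧸ φ.range) => s.fn q.out⁻¹)
    fun _ _ h => coind_ext φ (congrFun h)

/-- Composition with an equivariant map. -/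
def Coind.comp {X Y : FinGSet L} (a : X.carrier → Y.carrier)
    (ha : ∀ (l : L) x, a (l • x) = l • a x) (s : Coind φ X) : Coind φ Y :=
  ⟨fun h => a (s.fn h), fun l h => by rw [s.map_mul, ha]⟩

theorem Coind.comp_injective {X Y : FinGSet L} {a : X.carrier → Y.carrier}
    (ha : ∀ (l : L) x, a (l • x) = l • a x) (hi : Function.Injective a) :
    Function.Injective (Coind.comp φ a ha) := fun _ _ e =>
  Coind.ext (funext fun h => hi (congrFun (Coind.ext_iff.1 e) h))

theorem Coind.exists_comp {X Y : FinGSet L} {a : X.carrier → Y.carrier}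
    (ha : ∀ (l : L) x, a (l • x) = l • a x) (hi : Function.Injective a) (t : Coind φ Y)
    (ht : ∀ h, ∃ x, a x = t.fn h) : ∃ s : Coind φ X, Coind.comp φ a ha s = t := by
  choose s hs using ht
  exact ⟨⟨s, fun l h => hi (by rw [hs, t.map_mul, ha, hs])⟩, Coind.ext (funext hs)⟩

/-- `k` disjoint copies of `Y`. -/
def copies (k : ℕ) (Y : FinGSet L) : FinGSet L where
  carrier := Fin k × Y.carrier
  mulAction :=
    { smul := fun l a => (a.1, l • a.2)
      one_smul := fun a => Prod.ext rfl (one_smul _ _)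
      mul_smul := fun _ _ a => Prod.ext rfl (mul_smul _ _ _) }
  isOpen_stabilizer a := by
    convert Y.isOpen_stabilizer a.2 using 1
    ext h
    exact ⟨fun e => congrArg Prod.snd e, fun e => Prod.ext rfl e⟩

/-- The inclusion `X ⊔ k Y → (X ⊔ Y) ⊔ k Y` missing the first copy of `Y`. -/
def inclMiss (k : ℕ) (X Y : FinGSet L) :
    (X.sum (copies k Y)).carrier → ((X.sum Y).sum (copies k Y)).carrier
  | Sum.inl x => Sum.inl (Sum.inl x)
  | Sum.inr a => Sum.inr a

/-- The isomorphism `X ⊔ (k + 1) Y → (X ⊔ Y) ⊔ k Y`. -/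
def inclAll (k : ℕ) (X Y : FinGSet L) :
    (X.sum (copies (k + 1) Y)).carrier → ((X.sum Y).sum (copies k Y)).carrier
  | Sum.inl x => Sum.inl (Sum.inl x)
  | Sum.inr (i, y) => Fin.cases (motive := fun _ => ((X.sum Y).sum (copies k Y)).carrier)
      (Sum.inl (Sum.inr y)) (fun j => Sum.inr (j, y)) i

theorem inclMiss_smul (k : ℕ) (X Y : FinGSet L) (l : L) (x) :
    inclMiss k X Y (l • x) = l • inclMiss k X Y x := by
  rcases x with x | ⟨i, y⟩ <;> rfl

theorem inclAll_smul (k : ℕ) (X Y : FinGSet L) (l : L) (x) :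
    inclAll k X Y (l • x) = l • inclAll k X Y x := by
  rcases x with x | ⟨i, y⟩
  · rfl
  · refine Fin.cases ?_ (fun j => ?_) i <;> rfl

theorem inclMiss_injective (k : ℕ) (X Y : FinGSet L) : Function.Injective (inclMiss k X Y) := by
  rintro (x | a) (x' | a') e
  · exact congrArg Sum.inl (Sum.inl.inj (Sum.inl.inj e))
  · exact (Sum.inl_ne_inr e).elim
  · exact (Sum.inr_ne_inl e).elim
  · exact congrArg Sum.inr (Sum.inr.inj e)

theorem inclAll_bijective (k : ℕ) (X Y : FinGSet L) : Function.Bijective (inclAll k X Y) := by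
  let g : ((X.sum Y).sum (copies k Y)).carrier → (X.sum (copies (k + 1) Y)).carrier := fun z =>
    match z with
    | Sum.inl (Sum.inl x) => Sum.inl x
    | Sum.inl (Sum.inr y) => Sum.inr (0, y)
    | Sum.inr (j, y) => Sum.inr (j.succ, y)
  refine Function.bijective_iff_has_inverse.2 ⟨g, ?_, ?_⟩
  · rintro (x | ⟨i, y⟩)
    · rfl
    · refine Fin.cases ?_ (fun j => ?_) i <;> rfl
  · rintro ((x | y) | ⟨j, y⟩) <;> rfl

section Open

variable [IsTopologicalGroup H] [Finite (H ⧸ φ.range)] (hφ : IsOpenMap φ)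

/-- The induced `H`-set `H ×_L X`. -/
def induction (X : FinGSet L) : FinGSet H where
  carrier := Quotient (inductionSetoid φ X)
  isOpen_stabilizer x := by
    induction x using Quotient.inductionOn with
    | h a =>
      have h1 : IsOpen (((MulAction.stabilizer L a.2).map φ : Subgroup H) : Set H) :=
        hφ _ (X.isOpen_stabilizer a.2)
      have h2 : IsOpen ((((MulAction.stabilizer L a.2).map φ).comap
          (MulAut.conj a.1⁻¹).toMonoidHom : Subgroup H) : Set H) := by
        refine h1.preimage ?_
        change Continuous fun h => a.1⁻¹ * h * a.1⁻¹⁻¹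
        fun_prop
      refine Subgroup.isOpen_mono ?_ h2
      rintro h ⟨l, hl, hl'⟩
      rw [MulAction.mem_stabilizer_iff, induction_smul_mk]
      refine Quotient.sound ⟨l, ?_, ?_⟩
      · have : φ l = a.1⁻¹ * h * a.1 := by simpa using hl'
        rw [map_inv, this]
        group
      · exact (MulAction.mem_stabilizer_iff.1 hl).symm

/-- The coinduced `H`-set `Map_L(H, X)`. -/
def coinduction (X : FinGSet L) : FinGSet H where
  carrier := Coind φ X
  isOpen_stabilizer s := by
    have h2 : IsOpen ((⨅ q : H ⧸ φ.range,
        ((MulAction.stabilizer L (s.fn q.out⁻¹)).map φ).comap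
          (MulAut.conj q.out⁻¹).toMonoidHom : Subgroup H) : Set H) := by
      rw [Subgroup.coe_iInf]
      refine isOpen_iInter_of_finite fun q => ?_
      have h1 : IsOpen (((MulAction.stabilizer L (s.fn q.out⁻¹)).map φ : Subgroup H) : Set H) :=
        hφ _ (X.isOpen_stabilizer (s.fn q.out⁻¹))
      refine h1.preimage ?_
      change Continuous fun h => q.out⁻¹ * h * q.out⁻¹⁻¹
      fun_prop
    refine Subgroup.isOpen_mono ?_ h2
    intro h hh
    rw [MulAction.mem_stabilizer_iff]
    refine coind_ext φ fun q => ?_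
    obtain ⟨l, hl, hl'⟩ := Subgroup.mem_iInf.1 hh q
    have : φ l = q.out⁻¹ * h * q.out := by simpa using hl'
    have e : q.out⁻¹ * h = φ l * q.out⁻¹ := by rw [this]; group
    rw [coind_smul_apply, e, s.2]
    exact MulAction.mem_stabilizer_iff.1 hl

/-- The part of `Map_L(H, X ⊔ k Y)` of those functions that meet every copy of `Y`. -/
def hitting (k : ℕ) (X Y : FinGSet L) : FinGSet H :=
  (coinduction φ hφ (X.sum (copies k Y))).sub
    (fun s => ∀ i : Fin k, ∃ (h : H) (y : Y.carrier), s.fn h = Sum.inr (i, y))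
    (fun a s hs i => by
      obtain ⟨h, y, e⟩ := hs i
      exact ⟨h * a⁻¹, y, (congrArg s.fn (inv_mul_cancel_right h a)).trans e⟩)

theorem hitting_zero (X Y : FinGSet L) : Iso (hitting φ hφ 0 X Y) (coinduction φ hφ X) := by
  refine Iso.symm ⟨Equiv.ofBijective
    (fun s : Coind φ X => ⟨Coind.comp φ (Y := X.sum (copies 0 Y)) Sum.inl (fun _ _ => rfl) s,
      fun i => i.elim0⟩) ⟨?_, ?_⟩, fun _ _ => rfl⟩
  · intro s t e
    exact Coind.comp_injective φ (X := X) (Y := X.sum (copies 0 Y)) (a := Sum.inl)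
      (fun _ _ => rfl) Sum.inl_injective (Subtype.ext_iff.1 e)
  · rintro ⟨t, ht⟩
    obtain ⟨s, hs⟩ := Coind.exists_comp φ (X := X) (Y := X.sum (copies 0 Y)) (a := Sum.inl)
      (fun _ _ => rfl) Sum.inl_injective t (fun h => by
        rcases e : t.fn h with x | ⟨i, y⟩
        · exact ⟨x, rfl⟩
        · exact i.elim0)
    exact ⟨s, Subtype.ext hs⟩

theorem hitting_succ (k : ℕ) (X Y : FinGSet L) :
    Iso ((hitting φ hφ k X Y).sum (hitting φ hφ (k + 1) X Y))
      (hitting φ hφ k (X.sum Y) Y) := by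
  refine ⟨Equiv.ofBijective (Sum.elim
    (fun s => ⟨Coind.comp φ _ (inclMiss_smul k X Y) s.1, fun i => ?_⟩)
    (fun s => ⟨Coind.comp φ _ (inclAll_smul k X Y) s.1, fun i => ?_⟩)) ⟨?_, ?_⟩, ?_⟩
  · obtain ⟨h, y, e⟩ := s.2 i
    exact ⟨h, y, by simp only [Coind.comp, e]; rfl⟩
  · obtain ⟨h, y, e⟩ := s.2 i.succ
    exact ⟨h, y, by simp only [Coind.comp, e]; rfl⟩
  · have aux : ∀ (s : (hitting φ hφ k X Y).carrier) (t : (hitting φ hφ (k + 1) X Y).carrier),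
        Coind.comp φ _ (inclMiss_smul k X Y) s.1 ≠ Coind.comp φ _ (inclAll_smul k X Y) t.1 := by
      intro s t e
      obtain ⟨h, y, e'⟩ := t.2 0
      have := congrFun (Coind.ext_iff.1 e) h
      simp only [Coind.comp, e'] at this
      rcases e2 : s.1.fn h with x | a
      · rw [e2] at this
        exact Sum.inl_ne_inr (Sum.inl.inj this)
      · rw [e2] at this
        exact Sum.inr_ne_inl this
    rintro (s | s) (t | t) e
    · exact congrArg Sum.inl (Subtype.ext
        (Coind.comp_injective φ (inclMiss_smul k X Y) (inclMiss_injective k X Y) (Subtype.ext_iff.1 e)))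
    · exact (aux s t (Subtype.ext_iff.1 e)).elim
    · exact (aux t s (Subtype.ext_iff.1 e).symm).elim
    · exact congrArg Sum.inr (Subtype.ext
        (Coind.comp_injective φ (inclAll_smul k X Y) (inclAll_bijective k X Y).1 (Subtype.ext_iff.1 e)))
  · rintro ⟨t, ht⟩
    by_cases h0 : ∃ (h : H) (y : Y.carrier), t.fn h = Sum.inl (Sum.inr y)
    · obtain ⟨s, hs⟩ := Coind.exists_comp φ (inclAll_smul k X Y) (inclAll_bijective k X Y).1 t
        (fun h => (inclAll_bijective k X Y).2 _)
      refine ⟨Sum.inr ⟨s, fun i => ?_⟩, Subtype.ext hs⟩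
      subst hs
      refine Fin.cases ?_ (fun j => ?_) i
      · obtain ⟨h, y, e⟩ := h0
        exact ⟨h, y, (inclAll_bijective k X Y).1 e⟩
      · obtain ⟨h, y, e⟩ := ht j
        exact ⟨h, y, (inclAll_bijective k X Y).1 e⟩
    · obtain ⟨s, hs⟩ := Coind.exists_comp φ (inclMiss_smul k X Y) (inclMiss_injective k X Y) t
        (fun h => by
          rcases e : t.fn h with (x | y) | a
          · exact ⟨Sum.inl x, rfl⟩
          · exact (h0 ⟨h, y, e⟩).elim
          · exact ⟨Sum.inr a, rfl⟩)
      refine ⟨Sum.inl ⟨s, fun i => ?_⟩, Subtype.ext hs⟩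
      subst hs
      obtain ⟨h, y, e⟩ := ht i
      exact ⟨h, y, inclMiss_injective k X Y e⟩
  · rintro g (s | s) <;> rfl

theorem isEmpty_hitting (X Y : FinGSet L) :
    IsEmpty (hitting φ hφ (φ.range.index + 1) X Y).carrier := by
  refine ⟨fun s => ?_⟩
  choose h y e using s.2
  have hinj : Function.Injective fun i => (((h i)⁻¹ : H) : H ⧸ φ.range) := by
    intro i j hij
    obtain ⟨l, hl⟩ := QuotientGroup.eq.1 hij
    have e1 : h i = φ l * h j := by rw [hl]; group
    have e2 := e i
    rw [e1, s.1.map_mul, e j] at e2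
    exact (congrArg Prod.fst (Sum.inr_injective e2)).symm
  have := Nat.card_le_card_of_injective _ hinj
  rw [Nat.card_fin] at this
  exact absurd this (by simp [Subgroup.index])

end Open

end FinGSet

namespace BurnsideSemiring

variable {L H : Type u} [Group L] [TopologicalSpace L] [Group H] [TopologicalSpace H]
  (φ : L →* H)

/-- Restriction along a continuous homomorphism. -/
def pullback (hφ : Continuous φ) : BurnsideSemiring H →+* BurnsideSemiring L where
  toFun := Quotient.map (FinGSet.pullback φ hφ) (by
    rintro X Y ⟨e, he⟩
    exact ⟨e, fun l x => he (φ l) x⟩)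
  map_one' := mk_eq_of_equiv (Equiv.refl PUnit) fun _ _ => rfl
  map_zero' := mk_eq_of_equiv (Equiv.refl PEmpty) fun _ x => x.elim
  map_add' x y := by
    induction x using ind with | h X
    induction y using ind with | h Y
    refine mk_eq_of_equiv (Equiv.refl (X.carrier ⊕ Y.carrier)) ?_
    rintro l (x | y) <;> rfl
  map_mul' x y := by
    induction x using ind with | h X
    induction y using ind with | h Y
    exact mk_eq_of_equiv (Equiv.refl (X.carrier × Y.carrier)) fun _ _ => rfl

variable [IsTopologicalGroup H] [Finite (H ⧸ φ.range)] (hφ : IsOpenMap φ)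

/-- Transfer: `X ↦ H ×_L X`. -/
def induction : BurnsideSemiring L →+ BurnsideSemiring H where
  toFun := Quotient.map (FinGSet.induction φ hφ) (by
    rintro X Y ⟨e, he⟩
    refine ⟨Quotient.congr (Equiv.prodCongr (Equiv.refl H) e) ?_, ?_⟩
    · rintro a b
      refine exists_congr fun l => and_congr Iff.rfl ?_
      change b.2 = l • a.2 ↔ e b.2 = l • e a.2
      rw [← he, e.apply_eq_iff_eq]
    · intro h x
      induction x using Quotient.inductionOn
      rfl)
  map_zero' := by
    have : IsEmpty (FinGSet.induction φ hφ (FinGSet.empty L)).carrier :=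
      ⟨fun x => by
        induction x using Quotient.inductionOn with
        | h a => exact a.2.elim⟩
    exact mk_eq_of_equiv (Equiv.equivOfIsEmpty _ PEmpty) fun _ x => (this.false x).elim
  map_add' x y := by
    induction x using ind with | h X
    induction y using ind with | h Y
    refine (mk_eq_of_equiv (Equiv.ofBijective
      (Sum.elim
        (Quotient.map' (s₁ := FinGSet.inductionSetoid φ X)
          (s₂ := FinGSet.inductionSetoid φ (X.sum Y)) (fun a => (a.1, Sum.inl a.2)) (by
            rintro a b ⟨l, h1, h2⟩
            exact ⟨l, h1, congrArg Sum.inl h2⟩))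
        (Quotient.map' (s₁ := FinGSet.inductionSetoid φ Y)
          (s₂ := FinGSet.inductionSetoid φ (X.sum Y)) (fun a => (a.1, Sum.inr a.2)) (by
            rintro a b ⟨l, h1, h2⟩
            exact ⟨l, h1, congrArg Sum.inr h2⟩))) ⟨?_, ?_⟩) ?_).symm
    · rintro (a | a) (b | b) e <;>
        induction a using Quotient.inductionOn <;> induction b using Quotient.inductionOn <;>
        obtain ⟨l, h1, h2⟩ := Quotient.exact e
      · exact congrArg Sum.inl (Quotient.sound ⟨l, h1, Sum.inl_injective h2⟩)
      · exact absurd h2 Sum.inr_ne_inl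
      · exact absurd h2 Sum.inl_ne_inr
      · exact congrArg Sum.inr (Quotient.sound ⟨l, h1, Sum.inr_injective h2⟩)
    · intro z
      induction z using Quotient.inductionOn with
      | h a =>
        obtain ⟨h, x | y⟩ := a
        · exact ⟨Sum.inl (Quotient.mk _ (h, x)), rfl⟩
        · exact ⟨Sum.inr (Quotient.mk _ (h, y)), rfl⟩
    · rintro h (a | a) <;> induction a using Quotient.inductionOn <;> rfl

/-- The multiplicative norm on isomorphism classes: `X ↦ Map_L(H, X)`. -/
def coinduction : BurnsideSemiring L → BurnsideSemiring H :=
  Quotient.map (FinGSet.coinduction φ hφ) (by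
    rintro X Y ⟨e, he⟩
    refine ⟨Equiv.ofBijective (FinGSet.Coind.comp φ e he)
      ⟨FinGSet.Coind.comp_injective φ he e.injective, fun t =>
        FinGSet.Coind.exists_comp φ he e.injective t fun h => e.surjective _⟩, fun _ _ => rfl⟩)

theorem shift_pow_coinduction (k : ℕ) (X Y : FinGSet L) :
    ((GrothendieckRing.shift (mk Y) - 1 : Module.End ℤ (BurnsideSemiring L → BurnsideRing H)) ^ k)
      (fun x => GrothendieckRing.of (coinduction φ hφ x)) (mk X) =
        BurnsideRing.cls (FinGSet.hitting φ hφ k X Y) := by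
  induction k generalizing X with
  | zero =>
    exact congrArg GrothendieckRing.of (mk_eq_mk.2 (FinGSet.hitting_zero φ hφ X Y).symm)
  | succ k ih =>
    have step : ∀ g : BurnsideSemiring L → BurnsideRing H,
        ((GrothendieckRing.shift (mk Y) - 1 :
          Module.End ℤ (BurnsideSemiring L → BurnsideRing H)) g) (mk X) =
            g (mk X + mk Y) - g (mk X) := fun _ => rfl
    rw [pow_succ', Module.End.mul_apply, step, mk_add_mk, ih, ih, sub_eq_iff_eq_add']
    have := congrArg (GrothendieckRing.of) (mk_eq_mk.2 (FinGSet.hitting_succ φ hφ k X Y))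
    rw [← mk_add_mk, map_add] at this
    exact this.symm

theorem coinduction_polynomial (y : BurnsideSemiring L) :
    ((1 - GrothendieckRing.shift y : Module.End ℤ (BurnsideSemiring L → BurnsideRing H)) ^
      (φ.range.index + 1)) (fun x => GrothendieckRing.of (coinduction φ hφ x)) = 0 := by
  induction y using ind with | h Y
  rw [← neg_sub, neg_pow]
  have : ((GrothendieckRing.shift (mk Y) - 1 :
      Module.End ℤ (BurnsideSemiring L → BurnsideRing H)) ^ (φ.range.index + 1))
      (fun x => GrothendieckRing.of (coinduction φ hφ x)) = 0 := by
    funext x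
    induction x using ind with | h X
    rw [shift_pow_coinduction]
    have h := FinGSet.isEmpty_hitting φ hφ X Y
    have : mk (FinGSet.hitting φ hφ (φ.range.index + 1) X Y) = 0 :=
      mk_eq_of_equiv (Equiv.equivOfIsEmpty _ PEmpty) fun _ x => (h.false x).elim
    rw [BurnsideRing.cls, this, map_zero]
    rfl
  rw [Module.End.mul_apply, this, map_zero]

end BurnsideSemiring

namespace BurnsideRing

variable {G : Type u} [Group G] [TopologicalSpace G] [IsTopologicalGroup G]

/-- The inclusion of one open subgroup in another. -/
abbrev incl {L H : OpenSubgroup G} (h : L ≤ H) : L →* H :=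
  Subgroup.inclusion (show (L : Subgroup G) ≤ H from h)

theorem continuous_incl {L H : OpenSubgroup G} (h : L ≤ H) : Continuous (incl h) :=
  continuous_inclusion h

theorem isOpenMap_incl {L H : OpenSubgroup G} (h : L ≤ H) : IsOpenMap (incl h) := by
  intro U hU
  have h1 : IsOpen (Subtype.val '' U : Set G) := L.isOpen.isOpenMap_subtype_val U hU
  convert h1.preimage (continuous_subtype_val (p := fun g => g ∈ H)) using 1
  ext x
  constructor
  · rintro ⟨y, hy, rfl⟩
    exact ⟨y, hy, rfl⟩
  · rintro ⟨y, hy, e⟩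
    exact ⟨y, hy, Subtype.ext e⟩

instance isTopologicalGroup_openSubgroup (H : OpenSubgroup G) : IsTopologicalGroup H :=
  inferInstanceAs (IsTopologicalGroup (H : Subgroup G))

instance finite_quotient_range_incl [CompactSpace G] {L H : OpenSubgroup G} (h : L ≤ H) :
    Finite (H ⧸ (incl h).range) := by
  have : CompactSpace H := isCompact_iff_compactSpace.1 H.isClosed.isCompact
  refine Subgroup.quotient_finite_of_isOpen _ ?_
  rw [MonoidHom.coe_range]
  exact (isOpenMap_incl h).isOpen_range

/-- Restriction `A(H) → A(L)`: an `H`-set is regarded as an `L`-set. -/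
def res {L H : OpenSubgroup G} (h : L ≤ H) : BurnsideRing H →+* BurnsideRing L :=
  GrothendieckRing.map (BurnsideSemiring.pullback (incl h) (continuous_incl h))

/-- Transfer `A(L) → A(H)`, the additive map with `[X] ↦ [H ×_L X]`. -/
def tr [CompactSpace G] {L H : OpenSubgroup G} (h : L ≤ H) : BurnsideRing L →+ BurnsideRing H :=
  GrothendieckRing.lift
    (GrothendieckRing.of.comp (BurnsideSemiring.induction (incl h) (isOpenMap_incl h)))

/-- Norm `A(L) → A(H)`: the extension to formal differences of the map `[X] ↦ [Map_L(H, X)]`,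
which is polynomial of degree at most `[H : L]`. -/
def norm [CompactSpace G] {L H : OpenSubgroup G} (h : L ≤ H) : BurnsideRing L → BurnsideRing H :=
  GrothendieckRing.polyExtend (incl h).range.index
    (fun x => GrothendieckRing.of
      (BurnsideSemiring.coinduction (incl h) (isOpenMap_incl h) x))
    (BurnsideSemiring.coinduction_polynomial (incl h) (isOpenMap_incl h))

theorem continuous_conj (g : G) : Continuous (MulAut.conj g).toMonoidHom := by
  change Continuous fun x => g * x * g⁻¹
  fun_prop

/-- The conjugate subgroup `g⁻¹ H g`. -/
def conjSubgroup (H : OpenSubgroup G) (g : G) : OpenSubgroup G :=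
  H.comap (MulAut.conj g).toMonoidHom (continuous_conj g)

/-- The isomorphism `g⁻¹ H g → H`, `x ↦ g x g⁻¹`. -/
def conjHom (H : OpenSubgroup G) (g : G) : conjSubgroup H g →* H :=
  ((MulAut.conj g).toMonoidHom.comp (conjSubgroup H g : Subgroup G).subtype).codRestrict
    (H : Subgroup G) fun x => x.2

theorem continuous_conjHom (H : OpenSubgroup G) (g : G) : Continuous (conjHom H g) :=
  ((continuous_conj g).comp continuous_subtype_val).subtype_mk _

/-- Conjugation `A(H) → A(g⁻¹ H g)`. -/
def conj (H : OpenSubgroup G) (g : G) : BurnsideRing H →+* BurnsideRing (conjSubgroup H g) :=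
  GrothendieckRing.map (BurnsideSemiring.pullback (conjHom H g) (continuous_conjHom H g))

end BurnsideRing

/-! ## Ideals of the Burnside Tambara functor -/

/-- An ideal of the Burnside Tambara functor of `G`, whose value at `G / H` is `A(H)`. -/
@[ext]
structure TambaraIdeal (G : Type u) [Group G] [TopologicalSpace G] [IsTopologicalGroup G]
    [CompactSpace G] : Type (u + 1) where
  level : ∀ H : OpenSubgroup G, Ideal (BurnsideRing H)
  res_mem : ∀ {L H : OpenSubgroup G} (h : L ≤ H) {x : BurnsideRing H},
    x ∈ level H → BurnsideRing.res h x ∈ level L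
  tr_mem : ∀ {L H : OpenSubgroup G} (h : L ≤ H) {x : BurnsideRing L},
    x ∈ level L → BurnsideRing.tr h x ∈ level H
  norm_mem : ∀ {L H : OpenSubgroup G} (h : L ≤ H) {x : BurnsideRing L},
    x ∈ level L → ∃ y ∈ level H, BurnsideRing.norm h x = y + BurnsideRing.norm h 0
  conj_mem : ∀ (H : OpenSubgroup G) (g : G) {x : BurnsideRing H},
    x ∈ level H → BurnsideRing.conj H g x ∈ level (BurnsideRing.conjSubgroup H g)

namespace TambaraIdeal

variable {G : Type u} [Group G] [TopologicalSpace G] [IsTopologicalGroup G] [CompactSpace G]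

/-- Elements of the Burnside Tambara functor: pairs of an open subgroup `H` and an element
of `A(H)`. -/
abbrev Elt (G : Type u) [Group G] [TopologicalSpace G] [IsTopologicalGroup G] : Type (u + 1) :=
  Σ H : OpenSubgroup G, BurnsideRing H

instance : LE (TambaraIdeal G) := ⟨fun I J => ∀ H, I.level H ≤ J.level H⟩

/-- The ideal contains a set of elements. -/
def Contains (I : TambaraIdeal G) (S : Set (Elt G)) : Prop := ∀ a ∈ S, a.2 ∈ I.level a.1

/-- The ideal generated by a set of elements: the intersection of all ideals containing it. -/
def span (S : Set (Elt G)) : TambaraIdeal G where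
  level H := ⨅ (I : TambaraIdeal G) (_ : I.Contains S), I.level H
  res_mem h x hx := by
    simp only [Submodule.mem_iInf] at hx ⊢
    exact fun I hI => I.res_mem h (hx I hI)
  tr_mem h x hx := by
    simp only [Submodule.mem_iInf] at hx ⊢
    exact fun I hI => I.tr_mem h (hx I hI)
  norm_mem h x hx := by
    simp only [Submodule.mem_iInf] at hx ⊢
    refine ⟨BurnsideRing.norm h x - BurnsideRing.norm h 0, fun I hI => ?_, by abel⟩
    obtain ⟨y, hy, e⟩ := I.norm_mem h (hx I hI)
    rw [e, add_sub_cancel_right]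
    exact hy
  conj_mem H g x hx := by
    simp only [Submodule.mem_iInf] at hx ⊢
    exact fun I hI => I.conj_mem H g (hx I hI)

/-- The ideal is generated by finitely many elements. -/
def IsFinitelyGenerated (I : TambaraIdeal G) : Prop :=
  ∃ S : Set (Elt G), S.Finite ∧ I = span S

/-- The ideal is generated by one element of `A(H)` for some open subgroup `H`. -/
def IsStronglyPrincipal (I : TambaraIdeal G) : Prop :=
  ∃ (H : OpenSubgroup G) (a : BurnsideRing H), I = span {⟨H, a⟩}

end TambaraIdeal

/-! ## The Grothendieck–Witt group of a field -/

/-- A regular quadratic form over a field `E` of characteristic different from `2`: a quadratic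
form on a finite-dimensional space with nondegenerate polar form. -/
structure QuadSpace (E : Type v) [Field E] : Type (v + 1) where
  carrier : Type v
  [addCommGroup : AddCommGroup carrier]
  [module : Module E carrier]
  [finite : FiniteDimensional E carrier]
  form : QuadraticForm E carrier
  nondegenerate : form.polarBilin.Nondegenerate

namespace QuadSpace

attribute [instance] QuadSpace.addCommGroup QuadSpace.module QuadSpace.finite

variable {E : Type v} [Field E]

/-- Nondegeneracy of the polar form can be checked on one side. -/
theorem nondegenerate_of {V : Type*} [AddCommGroup V] [Module E V] {Q : QuadraticForm E V}
    (h : ∀ x, (∀ y, QuadraticMap.polar Q x y = 0) → x = 0) : Q.polarBilin.Nondegenerate :=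
  ⟨fun x hx => h x hx, fun y hy => h y fun x => by
    rw [QuadraticMap.polar_comm]
    exact hy x⟩

/-- Isometry classes of regular quadratic forms. -/
instance setoid (E : Type v) [Field E] : Setoid (QuadSpace E) where
  r V W := QuadraticMap.Equivalent V.form W.form
  iseqv :=
    { refl := fun V => QuadraticMap.Equivalent.refl V.form
      symm := fun h => h.symm
      trans := fun h h' => h.trans h' }

/-- Orthogonal sum. -/
def sum (V W : QuadSpace E) : QuadSpace E where
  carrier := V.carrier × W.carrier
  form := QuadraticMap.prod V.form W.form
  nondegenerate := by
    refine nondegenerate_of fun x hx => ?_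
    simp only [QuadraticMap.polar_prod] at hx
    refine Prod.ext (V.nondegenerate.1 _ fun y => ?_) (W.nondegenerate.1 _ fun y => ?_)
    · simpa using hx (y, 0)
    · simpa using hx (0, y)

/-- The zero form. -/
def zero (E : Type v) [Field E] : QuadSpace E where
  carrier := PUnit
  form := 0
  nondegenerate := nondegenerate_of fun _ _ => rfl

end QuadSpace

/-- The monoid of isometry classes of regular quadratic forms under orthogonal sum. -/
def QuadClass (E : Type v) [Field E] : Type (v + 1) := Quotient (QuadSpace.setoid E)

namespace QuadClass

variable {E : Type v} [Field E]

/-- The isometry class of a regular quadratic form. -/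
def mk (V : QuadSpace E) : QuadClass E := Quotient.mk _ V

theorem ind {p : QuadClass E → Prop} (h : ∀ V, p (mk V)) (x : QuadClass E) : p x :=
  Quotient.ind h x

instance : Add (QuadClass E) :=
  ⟨Quotient.map₂ QuadSpace.sum fun _ _ h _ _ h' => QuadraticMap.Equivalent.prod h h'⟩

instance : Zero (QuadClass E) := ⟨mk (QuadSpace.zero E)⟩

private theorem add_comm' (x y : QuadClass E) : x + y = y + x := by
  induction x using ind with | h V
  induction y using ind with | h W
  exact Quotient.sound ⟨QuadraticMap.IsometryEquiv.prodComm _ _⟩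

private theorem zero_add' (x : QuadClass E) : 0 + x = x := by
  induction x using ind with | h V
  have : Unique (QuadSpace.zero E).carrier := inferInstanceAs (Unique PUnit)
  refine Quotient.sound ⟨⟨LinearEquiv.uniqueProd, fun y => ?_⟩⟩
  change V.form y.2 = 0 + V.form y.2
  rw [zero_add]

instance instAddCommMonoid : AddCommMonoid (QuadClass E) where
  add_assoc x y z := by
    induction x using ind with | h V
    induction y using ind with | h W
    induction z using ind with | h U
    exact Quotient.sound ⟨⟨LinearEquiv.prodAssoc E _ _ _, fun y => (add_assoc _ _ _).symm⟩⟩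
  zero_add := zero_add'
  add_zero x := by rw [add_comm', zero_add']
  add_comm := add_comm'
  nsmul := nsmulRec

end QuadClass

/-- The additive group of the Grothendieck–Witt ring `GW(E)`: formal differences of isometry
classes of regular quadratic forms. -/
abbrev GrothendieckWitt (E : Type v) [Field E] : Type (v + 1) :=
  Algebra.GrothendieckAddGroup (QuadClass E)

/-! ## The Dress map -/

section Dress

variable {F : Type u} {K : Type v} [Field F] [Field K] [Algebra F K]

/-- The intermediate field `K^H`. -/
abbrev fixed (H : OpenSubgroup Gal(K/F)) : IntermediateField F K :=
  IntermediateField.fixedField (H : Subgroup Gal(K/F))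

variable {H : OpenSubgroup Gal(K/F)}

/-- The algebra `Map_H(X, K)` of `H`-equivariant functions on a finite `H`-set `X`, as a vector
space over `K^H`. If `X = H / L`, evaluation at the base point identifies it with `K^L`. -/
def equivariantMaps (X : FinGSet H) : Submodule (fixed H) (X.carrier → K) where
  carrier := {f | ∀ (h : H) (x : X.carrier), f (h • x) = (h : Gal(K/F)) (f x)}
  zero_mem' := fun h x => by simp
  add_mem' := fun hf hg h x => by simp [hf h x, hg h x]
  smul_mem' := fun c f hf h x => by
    have hc : (h : Gal(K/F)) (c : K) = c := IntermediateField.mem_fixedField_iff _ _ |>.1 c.2 _ h.2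
    simp only [Pi.smul_apply, hf h x, IntermediateField.smul_def, smul_eq_mul, map_mul, hc]

noncomputable instance (X : FinGSet H) : Fintype X.carrier := Fintype.ofFinite _

theorem sum_mem_fixed {X : FinGSet H} (f g : equivariantMaps X) :
    ∑ x : X.carrier, f.1 x * g.1 x ∈ fixed H := by
  rw [IntermediateField.mem_fixedField_iff]
  intro σ hσ
  rw [map_sum]
  refine Fintype.sum_equiv (MulAction.toPerm (⟨σ, hσ⟩ : H)) _ _ fun x => ?_
  rw [map_mul, MulAction.toPerm_apply, f.2, g.2]

/-- The bilinear form `(f, g) ↦ ∑ x, f x * g x` on `Map_H(X, K)`. -/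
def dressBilin (X : FinGSet H) : LinearMap.BilinForm (fixed H) (equivariantMaps X) :=
  LinearMap.mk₂ (fixed H) (fun f g => ⟨∑ x : X.carrier, f.1 x * g.1 x, sum_mem_fixed f g⟩)
    (fun f f' g => Subtype.ext (by simp [add_mul, Finset.sum_add_distrib]))
    (fun c f g => Subtype.ext (by
      simp [IntermediateField.smul_def, mul_assoc, Finset.mul_sum]))
    (fun f g g' => Subtype.ext (by simp [mul_add, Finset.sum_add_distrib]))
    (fun c f g => Subtype.ext (by
      simp [IntermediateField.smul_def, mul_left_comm, Finset.mul_sum]))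

/-- The quadratic form `f ↦ ∑ x, f x ^ 2` on `Map_H(X, K)`. For `X = H / L` it is the trace form
`a ↦ tr (a ^ 2)` of the extension `K^L / K^H`. -/
def dressForm (X : FinGSet H) : QuadraticForm (fixed H) (equivariantMaps X) :=
  (dressBilin X).toQuadraticMap

theorem dressForm_apply (X : FinGSet H) (f : equivariantMaps X) :
    (dressForm X f : K) = ∑ x : X.carrier, f.1 x * f.1 x := rfl

/-- The stabilizer in `Gal(K/F)` of a point of a finite `H`-set. -/
def stab (X : FinGSet H) (x : X.carrier) : Subgroup Gal(K/F) :=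
  (MulAction.stabilizer H x).map (H : Subgroup Gal(K/F)).subtype

theorem isOpen_stab (X : FinGSet H) (x : X.carrier) : IsOpen (stab X x : Set Gal(K/F)) :=
  H.isOpen.isOpenMap_subtype_val _ (X.isOpen_stabilizer x)

theorem mem_stab {X : FinGSet H} {x : X.carrier} (h : H) :
    (h : Gal(K/F)) ∈ stab X x ↔ h • x = x := by
  constructor
  · rintro ⟨h', hh', e⟩
    obtain rfl : h' = h := Subtype.ext e
    exact hh'
  · exact fun e => ⟨h, e, rfl⟩

variable [IsGalois F K]

theorem fixingSubgroup_stab (X : FinGSet H) (x : X.carrier) :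
    (IntermediateField.fixedField (stab X x)).fixingSubgroup = stab X x :=
  InfiniteGalois.fixingSubgroup_fixedField
    ⟨stab X x, Subgroup.isClosed_of_isOpen _ (isOpen_stab X x)⟩

instance finite_fixedField_stab (X : FinGSet H) (x : X.carrier) :
    FiniteDimensional F (IntermediateField.fixedField (stab X x)) := by
  rw [← InfiniteGalois.isOpen_iff_finite, fixingSubgroup_stab]
  exact isOpen_stab X x

theorem apply_mem_fixedField {X : FinGSet H} (f : equivariantMaps X) (x : X.carrier) :
    f.1 x ∈ IntermediateField.fixedField (stab X x) := by
  rw [IntermediateField.mem_fixedField_iff]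
  rintro _ ⟨h, hh, rfl⟩
  have := f.2 h x
  rw [MulAction.mem_stabilizer_iff.1 hh] at this
  exact this.symm

instance finite_equivariantMaps (X : FinGSet H) :
    FiniteDimensional (fixed H) (equivariantMaps X) := by
  let φ : equivariantMaps X →ₗ[F] (∀ x : X.carrier, IntermediateField.fixedField (stab X x)) :=
    { toFun := fun f x => ⟨f.1 x, apply_mem_fixedField f x⟩
      map_add' := fun _ _ => rfl
      map_smul' := fun _ _ => rfl }
  have hφ : Function.Injective φ := fun f g e =>
    Subtype.ext (funext fun x => congrArg Subtype.val (congrFun e x))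
  have : Module.Finite F (equivariantMaps X) := Module.Finite.of_injective φ hφ
  exact Module.Finite.of_restrictScalars_finite F (fixed H) (equivariantMaps X)

theorem eq_zero_of_orthogonal {X : FinGSet H} (f : equivariantMaps X)
    (hf : ∀ g : equivariantMaps X, ∑ x : X.carrier, f.1 x * g.1 x = 0) : f = 0 := by
  classical
  refine Subtype.ext (funext fun x₀ => ?_)
  let O := {x : X.carrier // ∃ h : H, h • x₀ = x}
  choose s hs using fun o : O => o.2
  let L := IntermediateField.fixedField (stab X x₀)
  have key : ∀ (h h' : H), h • x₀ = h' • x₀ → ∀ a : L,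
      (h : Gal(K/F)) (a : K) = (h' : Gal(K/F)) (a : K) := by
    intro h h' e a
    have h1 : ((h'⁻¹ * h : H) : Gal(K/F)) ∈ stab X x₀ := by
      rw [mem_stab, mul_smul, e, inv_smul_smul]
    have h2 := (IntermediateField.mem_fixedField_iff _ _).1 a.2 _ h1
    have h3 : (h : Gal(K/F)) = (h' : Gal(K/F)) * ((h'⁻¹ * h : H) : Gal(K/F)) := by
      simp
    rw [h3, AlgEquiv.mul_apply, h2]
  let χ : O → (L →* K) := fun o =>
    (((s o : Gal(K/F)) : K →ₐ[F] K).comp L.val : L →ₐ[F] K)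
  have hχ : Function.Injective χ := by
    intro o o' e
    have h1 : ((s o')⁻¹ * s o : H) • x₀ = x₀ := by
      rw [← mem_stab, ← fixingSubgroup_stab, IntermediateField.mem_fixingSubgroup_iff]
      intro a ha
      have h2 : (s o : Gal(K/F)) a = (s o' : Gal(K/F)) a := DFunLike.congr_fun e (⟨a, ha⟩ : L)
      change ((s o' : Gal(K/F))⁻¹ * (s o : Gal(K/F))) a = a
      rw [AlgEquiv.mul_apply, h2, ← AlgEquiv.mul_apply, inv_mul_cancel, AlgEquiv.one_apply]
    rw [mul_smul, inv_smul_eq_iff, hs, hs] at h1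
    exact Subtype.ext h1
  have ind := (linearIndependent_monoidHom L K).comp χ hχ
  have hfin : Finite O := Subtype.finite
  have : Fintype O := Fintype.ofFinite O
  rw [Fintype.linearIndependent_iff] at ind
  refine ind (fun o => f.1 o.1) (funext fun a => ?_) ⟨x₀, 1, one_smul _ _⟩
  let g : equivariantMaps X := ⟨fun x => if hx : ∃ h : H, h • x₀ = x then χ ⟨x, hx⟩ a else 0, by
    intro h x
    by_cases hx : ∃ h : H, h • x₀ = x
    · have hx' : ∃ h' : H, h' • x₀ = h • x := by
        obtain ⟨h', rfl⟩ := hx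
        exact ⟨h * h', mul_smul _ _ _⟩
      dsimp only
      rw [dif_pos hx, dif_pos hx']
      change (s ⟨h • x, hx'⟩ : Gal(K/F)) (a : K) = (h : Gal(K/F)) ((s ⟨x, hx⟩ : Gal(K/F)) (a : K))
      rw [key (s ⟨h • x, hx'⟩) (h * s ⟨x, hx⟩) (by rw [mul_smul, hs, hs]) a]
      rfl
    · have hx' : ¬ ∃ h' : H, h' • x₀ = h • x := by
        rintro ⟨h', e⟩
        exact hx ⟨h⁻¹ * h', by rw [mul_smul, e, inv_smul_smul]⟩
      dsimp only
      rw [dif_neg hx, dif_neg hx', map_zero]⟩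
  have h1 := hf g
  simp only [Function.comp_apply, Finset.sum_apply, Pi.smul_apply, smul_eq_mul, Pi.zero_apply]
  rw [← h1]
  refine Fintype.sum_of_injective (fun o : O => o.1) Subtype.val_injective _ _ (fun x hx => ?_)
    (fun o => ?_)
  · have hx' : ¬ ∃ h : H, h • x₀ = x := fun h => hx ⟨⟨x, h⟩, rfl⟩
    simp only [g, dif_neg hx', mul_zero]
  · have ho : g.1 o.1 = χ o a := dif_pos o.2
    rw [ho]

variable [NeZero (2 : F)]

theorem dressForm_nondegenerate (X : FinGSet H) : (dressForm X).polarBilin.Nondegenerate := by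
  refine QuadSpace.nondegenerate_of fun f hf => eq_zero_of_orthogonal f fun g => ?_
  have h2 : (2 : K) ≠ 0 := by
    rw [← map_ofNat (algebraMap F K) 2]
    exact (map_ne_zero _).2 (NeZero.ne (2 : F))
  have h3 : QuadraticMap.polar (dressForm X) f g = dressBilin X f g + dressBilin X g f :=
    LinearMap.BilinMap.polar_toQuadraticMap _ _
  rw [hf g] at h3
  have h4 : (0 : K) = ∑ x : X.carrier, f.1 x * g.1 x + ∑ x : X.carrier, g.1 x * f.1 x :=
    congrArg Subtype.val h3
  simp only [mul_comm (g.1 _), ← two_mul] at h4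
  exact (mul_eq_zero.1 h4.symm).resolve_left h2

/-- The regular quadratic form attached to a finite `H`-set. -/
def dressSpace (X : FinGSet H) : QuadSpace (fixed H) where
  carrier := equivariantMaps X
  form := dressForm X
  nondegenerate := dressForm_nondegenerate X

/-- Transport of equivariant functions along an isomorphism of `H`-sets. -/
def equivariantMapsCongr {X Y : FinGSet H} (e : X.carrier ≃ Y.carrier)
    (he : ∀ (h : H) (x : X.carrier), e (h • x) = h • e x) :
    equivariantMaps X ≃ₗ[fixed H] equivariantMaps Y where
  toFun f := ⟨fun y => f.1 (e.symm y), fun h y => by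
    have h1 : e.symm (h • y) = h • e.symm y := by
      rw [Equiv.symm_apply_eq, he, Equiv.apply_symm_apply]
    exact (congrArg f.1 h1).trans (f.2 h _)⟩
  invFun f := ⟨fun x => f.1 (e x), fun h x =>
    (congrArg f.1 (he h x)).trans (f.2 h _)⟩
  map_add' _ _ := rfl
  map_smul' _ _ := rfl
  left_inv f := Subtype.ext (funext fun x => congrArg f.1 (e.symm_apply_apply x))
  right_inv f := Subtype.ext (funext fun y => congrArg f.1 (e.apply_symm_apply y))

/-- Equivariant functions on a disjoint union. -/
def equivariantMapsSum (X Y : FinGSet H) :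
    equivariantMaps (X.sum Y) ≃ₗ[fixed H] equivariantMaps X × equivariantMaps Y where
  toFun f := (⟨fun x => f.1 (Sum.inl x), fun h x => f.2 h (Sum.inl x)⟩,
    ⟨fun y => f.1 (Sum.inr y), fun h y => f.2 h (Sum.inr y)⟩)
  invFun f := ⟨Sum.elim f.1.1 f.2.1, by
    rintro h (x | y)
    · exact f.1.2 h x
    · exact f.2.2 h y⟩
  map_add' _ _ := rfl
  map_smul' _ _ := rfl
  left_inv f := Subtype.ext (funext fun z => by rcases z with x | y <;> rfl)
  right_inv f := rfl

theorem dressForm_congr {X Y : FinGSet H} (e : X.carrier ≃ Y.carrier)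
    (he : ∀ (h : H) (x : X.carrier), e (h • x) = h • e x) (f : equivariantMaps X) :
    dressForm Y (equivariantMapsCongr e he f) = dressForm X f := by
  refine Subtype.ext ?_
  rw [dressForm_apply, dressForm_apply]
  exact Fintype.sum_equiv e.symm _ _ fun _ => rfl

theorem dressForm_sum (X Y : FinGSet H) (f : equivariantMaps (X.sum Y)) :
    dressForm X (equivariantMapsSum X Y f).1 + dressForm Y (equivariantMapsSum X Y f).2 =
      dressForm (X.sum Y) f := by
  refine Subtype.ext ?_
  change (dressForm X (equivariantMapsSum X Y f).1 : K) +
    (dressForm Y (equivariantMapsSum X Y f).2 : K) = (dressForm (X.sum Y) f : K)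
  rw [dressForm_apply, dressForm_apply, dressForm_apply]
  have h2 := Fintype.sum_sum_type (fun z : X.carrier ⊕ Y.carrier => f.1 z * f.1 z)
  refine h2.symm.trans (Finset.sum_congr ?_ fun _ _ => rfl)
  exact Finset.ext fun z => iff_of_true (Finset.mem_univ z)
    (@Finset.mem_univ (X.sum Y).carrier _ z)

/-- The Dress map on isomorphism classes of finite `H`-sets. -/
def dressClass (H : OpenSubgroup Gal(K/F)) : BurnsideSemiring H →+ QuadClass (fixed H) where
  toFun := Quotient.map dressSpace (by
    rintro X Y ⟨e, he⟩
    refine ⟨⟨equivariantMapsCongr e he, dressForm_congr e he⟩⟩)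
  map_zero' := by
    have h1 : ∀ f : equivariantMaps (FinGSet.empty H), f = 0 := fun f =>
      Subtype.ext (funext fun x => x.elim)
    have e : equivariantMaps (FinGSet.empty H) ≃ₗ[fixed H] PUnit.{v + 1} :=
      { toFun := fun _ => PUnit.unit
        invFun := fun _ => 0
        map_add' := fun _ _ => rfl
        map_smul' := fun _ _ => rfl
        left_inv := fun f => (h1 f).symm
        right_inv := fun _ => rfl }
    refine Quotient.sound ⟨⟨e, fun f => ?_⟩⟩
    change (0 : fixed H) = dressForm (FinGSet.empty H) f
    rw [h1 f]
    exact (QuadraticMap.map_zero (dressForm (FinGSet.empty H))).symm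
  map_add' x y := by
    induction x using BurnsideSemiring.ind with | h X
    induction y using BurnsideSemiring.ind with | h Y
    refine Quotient.sound ⟨⟨equivariantMapsSum X Y, dressForm_sum X Y⟩⟩

/-- The Dress map `A(H) → GW(K^H)`, which sends the class of `H / L` to the class of the trace
form `a ↦ tr (a ^ 2)` of the extension `K^L / K^H`. -/
def dress (H : OpenSubgroup Gal(K/F)) : BurnsideRing H →+ GrothendieckWitt (fixed H) :=
  GrothendieckRing.lift (Algebra.GrothendieckAddGroup.of.comp (dressClass H))

/-- `I` is the trace ideal of `K / F`: the kernel of the Dress map at every level. -/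
def IsTraceIdeal (I : TambaraIdeal Gal(K/F)) : Prop :=
  ∀ (H : OpenSubgroup Gal(K/F)) (x : BurnsideRing H), x ∈ I.level H ↔ dress H x = 0

end Dress

/-! ## The profinite integers and the generators -/

/-- The profinite completion of the integers, written multiplicatively. -/
abbrev ZHat : Type :=
  ProfiniteGrp.ProfiniteCompletion.completion (GrpCat.of (Multiplicative ℤ))

namespace ZHat

theorem denseRange_zpow : ∃ g : ZHat, DenseRange fun k : ℤ => g ^ k := by
  let φ : Multiplicative ℤ →* ZHat :=
    { toFun := ProfiniteGrp.ProfiniteCompletion.etaFn (GrpCat.of (Multiplicative ℤ))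
      map_one' := rfl
      map_mul' := fun _ _ => rfl }
  have h : DenseRange φ :=
    ProfiniteGrp.ProfiniteCompletion.denseRange (GrpCat.of (Multiplicative ℤ))
  refine ⟨φ (Multiplicative.ofAdd 1), ?_⟩
  have e : (fun k : ℤ => φ (Multiplicative.ofAdd 1) ^ k) = φ ∘ Multiplicative.ofAdd := by
    funext k
    rw [← map_zpow, ← ofAdd_zsmul, smul_eq_mul, mul_one]
    rfl
  rw [DenseRange, e, Multiplicative.ofAdd.surjective.range_comp]
  exact h

theorem mul_comm' (x y : ZHat) : x * y = y * x := by
  obtain ⟨g, hg⟩ := denseRange_zpow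
  have h1 : ∀ k : ℤ, ∀ y : ZHat, g ^ k * y = y * g ^ k := fun k =>
    congrFun (hg.equalizer (continuous_const_mul (g ^ k)) (continuous_mul_const (g ^ k))
      (funext fun l => ((Commute.refl g).zpow_zpow k l).eq))
  exact congrFun (hg.equalizer (continuous_mul_const y) (continuous_const_mul y)
    (funext fun k => h1 k y)) x

/-- The open subgroup `n Ẑ` of `n`-fold multiples (in multiplicative notation, of `n`-th powers),
for `n ≥ 1`. -/
def multiples (n : ℕ+) : OpenSubgroup ZHat where
  carrier := Set.range fun x : ZHat => x ^ (n : ℕ)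
  mul_mem' := by
    rintro _ _ ⟨x, rfl⟩ ⟨y, rfl⟩
    exact ⟨x * y, (show Commute x y from mul_comm' x y).mul_pow (n : ℕ)⟩
  one_mem' := ⟨1, one_pow (n : ℕ)⟩
  inv_mem' := by
    rintro _ ⟨x, rfl⟩
    exact ⟨x⁻¹, inv_pow x (n : ℕ)⟩
  isOpen' := by
    let S : Subgroup ZHat :=
      { carrier := Set.range fun x : ZHat => x ^ (n : ℕ)
        mul_mem' := by
          rintro _ _ ⟨x, rfl⟩ ⟨y, rfl⟩
          exact ⟨x * y, (show Commute x y from mul_comm' x y).mul_pow (n : ℕ)⟩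
        one_mem' := ⟨1, one_pow (n : ℕ)⟩
        inv_mem' := by
          rintro _ ⟨x, rfl⟩
          exact ⟨x⁻¹, inv_pow x (n : ℕ)⟩ }
    have hS : IsClosed (S : Set ZHat) := (isCompact_range (continuous_pow (n : ℕ))).isClosed
    obtain ⟨g, hg⟩ := denseRange_zpow
    have hcover : (⋃ i : Fin (n : ℕ), (fun x => g ^ (i : ℕ) * x) '' (S : Set ZHat)) = Set.univ := by
      have hcl : IsClosed (⋃ i : Fin (n : ℕ), (fun x => g ^ (i : ℕ) * x) '' (S : Set ZHat)) :=
        isClosed_iUnion_of_finite fun i => (Homeomorph.mulLeft (g ^ (i : ℕ))).isClosedMap _ hS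
      rw [← hcl.closure_eq, ← Set.univ_subset_iff, ← hg.closure_range]
      refine closure_mono ?_
      rintro _ ⟨k, rfl⟩
      have hn : (0 : ℤ) < ((n : ℕ) : ℤ) := by exact_mod_cast n.pos
      have h1 := Int.emod_nonneg k hn.ne'
      have h2 := Int.emod_lt_of_pos k hn
      refine Set.mem_iUnion.2 ⟨⟨(k % ((n : ℕ) : ℤ)).toNat, by omega⟩, (g ^ (k / ((n : ℕ) : ℤ))) ^ (n : ℕ), ⟨_, rfl⟩, ?_⟩
      simp only
      rw [← zpow_natCast, ← zpow_natCast, Int.toNat_of_nonneg h1, ← zpow_mul, ← zpow_add,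
        mul_comm (k / _), Int.emod_add_mul_ediv]
    have hfin : S.FiniteIndex := by
      have : Finite (ZHat ⧸ S) := by
        refine Finite.of_surjective (fun i : Fin (n : ℕ) => ((g ^ (i : ℕ) : ZHat) : ZHat ⧸ S)) ?_
        intro q
        induction q using QuotientGroup.induction_on with
        | H z =>
          obtain ⟨i, y, hy, e⟩ := Set.mem_iUnion.1 (hcover.ge (Set.mem_univ z))
          refine ⟨i, QuotientGroup.eq.2 ?_⟩
          simp only at e
          rw [← e, inv_mul_cancel_left]
          exact hy
      exact Subgroup.finiteIndex_of_finite_quotient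
    exact S.isOpen_of_isClosed_of_finiteIndex hS

end ZHat

/-- The class in `A(H)` of the transitive `H`-set `H / L`, for open subgroups `L ≤ H`. -/
def BurnsideRing.orbit {G : Type u} [Group G] [TopologicalSpace G] [IsTopologicalGroup G]
    [CompactSpace G] (H L : OpenSubgroup G) : BurnsideRing H :=
  have hopen : IsOpen (((L : Subgroup G).subgroupOf (H : Subgroup G) : Subgroup H) : Set H) :=
    L.isOpen.preimage continuous_subtype_val
  have : CompactSpace H := isCompact_iff_compactSpace.1 H.isClosed.isCompact
  have : Finite (H ⧸ ((L : Subgroup G).subgroupOf (H : Subgroup G) : Subgroup H)) :=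
    Subgroup.quotient_finite_of_isOpen _ hopen
  BurnsideRing.cls (FinGSet.quotient ((L : Subgroup G).subgroupOf (H : Subgroup G)) hopen)

section Generators

variable {G : Type u} [Group G] [TopologicalSpace G] [IsTopologicalGroup G] [CompactSpace G]
  (e : G ≃ₜ* ZHat)

/-- The open subgroup of `G ≅ Ẑ` corresponding to `M Ẑ`. -/
def lvl (M : ℕ+) : OpenSubgroup G :=
  (ZHat.multiples M).comap e.toMulEquiv.toMonoidHom e.continuous

/-- The element `t_{M, k}` of `A(M Ẑ)`: the class of the transitive set `M Ẑ / k M Ẑ`. -/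
def t (M k : ℕ+) : BurnsideRing (lvl e M) :=
  BurnsideRing.orbit (lvl e M) (lvl e (k * M))

/-- The elements `t_{2^n, 4} - t_{2^n, 2} - 2` of `A(2^n Ẑ)` and `t_{p^n, p} - p` of `A(p^n Ẑ)`,
for all odd primes `p` and all `n`. -/
def generators : Set (TambaraIdeal.Elt G) :=
  {a | ∃ n : ℕ, a = ⟨lvl e (2 ^ n), t e (2 ^ n) 4 - t e (2 ^ n) 2 - 2⟩} ∪
    {a | ∃ (p : ℕ+) (n : ℕ), p.Prime ∧ p ≠ 2 ∧
      a = ⟨lvl e (p ^ n), t e (p ^ n) p - ((p : ℕ) : BurnsideRing (lvl e (p ^ n)))⟩}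

/-- `n!` as a positive integer. -/
def fact (n : ℕ+) : ℕ+ := ⟨(n : ℕ).factorial, Nat.factorial_pos n⟩

open Classical in
/-- The element `t_{m, 4} - t_{m, 2} - 2 + ∑ (t_{m, p} - p)` of `A(m Ẑ)`, where `m = n!` and
the sum is over the odd primes `p < n`. -/
def chainElt (n : ℕ+) : BurnsideRing (lvl e (fact n)) :=
  t e (fact n) 4 - t e (fact n) 2 - 2 +
    ∑ p ∈ (Finset.Iio n).filter (fun p => p.Prime ∧ p ≠ 2),
      (t e (fact n) p - ((p : ℕ) : BurnsideRing (lvl e (fact n))))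

/-- The ideal generated by the single element `chainElt e n`. -/
def chainIdeal (n : ℕ+) : TambaraIdeal G :=
  TambaraIdeal.span {⟨lvl e (fact n), chainElt e n⟩}

end Generators

end TraceIdeal

end

noncomputable section

namespace TraceIdeal

/-! ## Polynomial extensions of powers of additive maps -/

namespace GrothendieckRing

/-! Most identities in Burnside rings are checked on marks: the mark at `U` counts the points fixed
by `U ∩ H`. For an abelian group the marks separate the elements of A(H) (`ext_marks`). A transfer
becomes multiplication by the index, or zero (`mark_tr`), and a norm becomes a power (`mark_norm`).
Since every open subgroup is some M Ẑ, such identities turn into arithmetic of divisibility.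

Identification of the kernel. Modulo transfers of the generators, t_{pk} is p t_k for odd p and
t_{4k} is t_{2k} + 2 t_k; together with 2 t_2 = 4 this brings every element of A(M Ẑ) to the form n
+ m t_2 with m = 0 or 1 (`IsLarge.normal_form`). The Dress map kills all these relations. It is
compatible with transfer (`dressClass_induction_congr`). A cyclic extension of odd degree has a
self-dual normal basis (`exists_self_dual_element`). A cyclic quartic extension inside a cyclic
octic one has trace form ⟨1, 1⟩ plus that of the quadratic subextension (`exists_frame_four`). Twice
the quadratic trace form is 4⟨1⟩, because the quadratic extension lies in a cyclic quartic one
(`two_nsmul_eq`). Rank and discriminant show that no nonzero normal form is killed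
(`eq_zero_of_dress_eq_zero`). Hence the kernel lies in the ideal generated.

For the reverse inclusion, norms of quadratic forms are avoided. The virtual sets of rank 0 on which
the topological generator has sign +1 form a Tambara ideal (`signIdeal`), since the sign on Map_L(H,
X) depends only on the cardinality and the sign of X. This ideal contains the generators and meets
the normal forms only in 0. So it equals the ideal generated, and also the part of that ideal killed
by the Dress map (`IsLarge.signLevel_le`).

The chain. Restriction to suitable subgroups kills all but one summand of `chainElt`, and the norm
carries the surviving element back up to smaller M (`TambaraIdeal.mem_of_marks`). Each summand
therefore lies in the ideal of the sum, and every generator occurs once n is large.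

Infinite generation. An element of rank 0 has zero marks at all subgroups of some open D. Finitely
many elements share such a D, and the ideal of elements with this vanishing (`markIdeal`) misses one
of the generators. -/

theorem polySum_comp {R : Type u} [CommSemiring R] (ψ : R →+ ℤ) (d : ℕ) (f : ℤ → ℤ) (a b : R) :
    polySum d (fun x => f (ψ x)) a b = polySum d f (ψ a) (ψ b) := by
  simp only [polySum, map_add, map_nsmul]

/-- The operator `1 - shift y` is the negative of the forward difference with step `y`, and `d + 1`
differences annihilate a polynomial function of degree at most `d`. -/
theorem one_sub_shift_pow_pow_eq_zero {d m : ℕ} (hm : m ≤ d) (y : ℤ) :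
    ((1 - shift y : Module.End ℤ (ℤ → ℤ)) ^ (d + 1)) (fun x => x ^ m) = 0 := by
  have h : ∀ f : ℤ → ℤ, (1 - shift y : Module.End ℤ (ℤ → ℤ)) f = -fwdDiff y f := by
    intro f; funext x; simp [shift, fwdDiff]
  have h2 : ∀ (k : ℕ) (f : ℤ → ℤ), ((1 - shift y : Module.End ℤ (ℤ → ℤ)) ^ k) f =
      (-1 : ℤ) ^ k • (fwdDiff y)^[k] f := by
    intro k
    induction k with
    | zero => intro f; simp
    | succ k ih =>
      intro f
      rw [pow_succ, Module.End.mul_apply, h, ih, Function.iterate_succ_apply]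
      have : (-fwdDiff y f) = (-1 : ℤ) • fwdDiff y f := by simp
      rw [this, fwdDiff_iter_const_smul, pow_succ, smul_smul]
  rw [h2]
  have h3 : (fwdDiff y)^[d + 1] (fun x : ℤ => x ^ m) = 0 := by
    funext x
    rw [fwdDiff_iter_eq_sum_shift]
    rcases eq_or_ne y 0 with rfl | hy
    · simp only [smul_zero, add_zero, Pi.zero_apply]
      rw [← Finset.sum_smul]
      have e : ∑ k ∈ Finset.range (d + 1 + 1), (-1 : ℤ) ^ (d + 1 - k) * ((d + 1).choose k : ℤ) = 0 := by
        have h4 := (add_pow (1 : ℤ) (-1) (d + 1)).symm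
        simpa using h4
      simp [e]
    -- Along the progression x + k y the function is the polynomial (y X + x)^m in k, which turns
    -- steps of size y into unit steps.
    · have h5 := Polynomial.fwdDiff_iter_eq_zero_of_degree_lt
        (P := ((Polynomial.C y * Polynomial.X + Polynomial.C x) ^ m : Polynomial ℤ)) (n := d + 1) (by
          refine lt_of_le_of_lt Polynomial.natDegree_pow_le ?_
          have : (Polynomial.C y * Polynomial.X + Polynomial.C x : Polynomial ℤ).natDegree ≤ 1 := by
            compute_degree
          nlinarith)
      have h6 := congrFun h5 0
      rw [fwdDiff_iter_eq_sum_shift] at h6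
      simp only [Pi.zero_apply] at h6 ⊢
      rw [← h6]
      refine Finset.sum_congr rfl fun k _ => ?_
      congr 1
      simp
      ring
  rw [h3, smul_zero]

/-- By `polySum_add` both arguments may be translated by `-ψ b`, after which the second one is 0.
All terms with k > 0 then become alternating binomial sums and vanish. This evaluates marks of norms
of formal differences. -/
theorem polySum_pow {R : Type u} [CommSemiring R] (ψ : R →+ ℤ) {d m : ℕ} (hm : m ≤ d) (a b : R) :
    polySum d (fun x => ψ x ^ m) a b = (ψ a - ψ b) ^ m := by
  rw [polySum_comp ψ d (fun x => x ^ m),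
    ← polySum_add (fun y => one_sub_shift_pow_pow_eq_zero hm y) (ψ a) (ψ b) (-ψ b), polySum,
    Finset.sum_eq_single 0]
  · simp [sub_eq_add_neg]
  · intro k _ hk
    have h4 := (add_pow (-1 : ℤ) 1 k).symm
    simp only [add_neg_cancel, smul_zero, add_zero, ← Finset.sum_smul]
    simp only [one_pow, mul_one, neg_add_cancel, zero_pow hk] at h4
    rw [h4, zero_smul]
  · simp

theorem map_polySum {R : Type u} [CommSemiring R] {A B : Type*} [AddCommGroup A] [AddCommGroup B]
    (g : A →+ B) (d : ℕ) (f : R → A) (a b : R) :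
    g (polySum d f a b) = polySum d (fun x => g (f x)) a b := by
  simp only [polySum, map_sum, map_zsmul]

theorem polyExtend_sub {R : Type u} [CommSemiring R] {A : Type v} [AddCommGroup A] (d : ℕ)
    (f : R → A) (hf : ∀ y : R, ((1 - shift y : Module.End ℤ (R → A)) ^ (d + 1)) f = 0) (a b : R) :
    polyExtend d f hf (of a - of b) = polySum d f a b := by
  have : (of a - of b : GrothendieckRing R) = AddLocalization.mk a ⟨b, AddSubmonoid.mem_top b⟩ := (mk_eq a ⟨b, AddSubmonoid.mem_top b⟩).symm
  rw [this]
  rfl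

theorem hom_ext {R : Type u} [CommSemiring R] {A : Type v} [AddCommGroup A]
    {f g : GrothendieckRing R →+ A} (h : ∀ a, f (of a) = g (of a)) : f = g := by
  ext x
  obtain ⟨a, b, rfl⟩ := exists_eq_sub x
  simp [h]

theorem of_mul (R : Type u) [CommSemiring R] (a b : R) :
    (of (a * b) : GrothendieckRing R) = of a * of b := (mulHom_of_of a b).symm

@[simp] theorem map_of {R : Type u} {S : Type v} [CommSemiring R] [CommSemiring S] (f : R →+* S) (a : R) :
    map f (of a) = of (f a) := lift_of _ a

/-- The extension of a semiring homomorphism into a commutative ring to formal differences. -/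
def liftRing {R : Type u} [CommSemiring R] {A : Type v} [CommRing A] (f : R →+* A) :
    GrothendieckRing R →+* A where
  __ := lift f.toAddMonoidHom
  map_one' := by
    change lift f.toAddMonoidHom (of 1) = 1
    simp
  map_mul' x y := by
    change lift f.toAddMonoidHom (x * y) = lift f.toAddMonoidHom x * lift f.toAddMonoidHom y
    obtain ⟨a, b, rfl⟩ := exists_eq_sub x
    obtain ⟨c, d, rfl⟩ := exists_eq_sub y
    simp only [sub_mul, mul_sub, ← of_mul, map_sub, lift_of]
    simp

@[simp] theorem liftRing_of {R : Type u} [CommSemiring R] {A : Type v} [CommRing A] (f : R →+* A)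
    (a : R) : liftRing f (of a) = f a := lift_of _ a

end GrothendieckRing

/-! ## Marks -/

section Marks

variable {G : Type u} [Group G] [TopologicalSpace G] {H : OpenSubgroup G}

/-- The points of an `H`-set that are fixed by `U ∩ H`. -/
abbrev FinGSet.fixedPts (U : Subgroup G) (X : FinGSet H) : Type u :=
  {x : X.carrier // ∀ h : H, (h : G) ∈ U → h • x = x}

/-- The mark of an `H`-set at `U`: the number of points fixed by `U ∩ H`. -/
def BurnsideSemiring.mark (U : Subgroup G) : BurnsideSemiring H →+* ℕ where
  toFun := Quotient.lift (fun X => Nat.card (X.fixedPts U)) (by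
    rintro X Y ⟨e, he⟩
    refine Nat.card_congr (e.subtypeEquiv fun x => ?_)
    simp only [← he, e.apply_eq_iff_eq])
  map_one' := by
    change Nat.card ((FinGSet.point H).fixedPts U) = 1
    rw [Nat.card_eq_one_iff_unique]
    exact ⟨⟨fun a b => Subtype.ext rfl⟩, ⟨⟨PUnit.unit, fun _ _ => rfl⟩⟩⟩
  map_zero' := by
    change Nat.card ((FinGSet.empty H).fixedPts U) = 0
    rw [Nat.card_eq_zero]
    exact Or.inl ⟨fun x => x.1.elim⟩
  map_add' x y := by
    induction x using BurnsideSemiring.ind with | h X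
    induction y using BurnsideSemiring.ind with | h Y
    change Nat.card ((X.sum Y).fixedPts U) = Nat.card (X.fixedPts U) + Nat.card (Y.fixedPts U)
    rw [← Nat.card_sum]
    refine Nat.card_congr
      { toFun := fun x => match x with
          | ⟨Sum.inl a, ha⟩ => Sum.inl ⟨a, fun h hh => Sum.inl_injective (ha h hh)⟩
          | ⟨Sum.inr a, ha⟩ => Sum.inr ⟨a, fun h hh => Sum.inr_injective (ha h hh)⟩
        invFun := Sum.elim (fun a => ⟨Sum.inl a.1, fun h hh => congrArg Sum.inl (a.2 h hh)⟩)
          (fun a => ⟨Sum.inr a.1, fun h hh => congrArg Sum.inr (a.2 h hh)⟩)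
        left_inv := by rintro ⟨a | a, ha⟩ <;> rfl
        right_inv := by rintro (a | a) <;> rfl }
  map_mul' x y := by
    induction x using BurnsideSemiring.ind with | h X
    induction y using BurnsideSemiring.ind with | h Y
    change Nat.card ((X.prod Y).fixedPts U) = Nat.card (X.fixedPts U) * Nat.card (Y.fixedPts U)
    rw [← Nat.card_prod]
    exact Nat.card_congr
      { toFun := fun x => (⟨x.1.1, fun h hh => congrArg Prod.fst (x.2 h hh)⟩,
          ⟨x.1.2, fun h hh => congrArg Prod.snd (x.2 h hh)⟩)
        invFun := fun a => ⟨(a.1.1, a.2.1), fun h hh => Prod.ext (a.1.2 h hh) (a.2.2 h hh)⟩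
        left_inv := fun _ => rfl
        right_inv := fun _ => rfl }

theorem BurnsideSemiring.mark_mk (U : Subgroup G) (X : FinGSet H) :
    mark U (mk X) = Nat.card (X.fixedPts U) := rfl

namespace BurnsideRing

/-- The mark homomorphism at `U` on the Burnside ring. -/
def mark (U : Subgroup G) : BurnsideRing H →+* ℤ :=
  GrothendieckRing.liftRing ((Nat.castRingHom ℤ).comp (BurnsideSemiring.mark U))

theorem mark_of (U : Subgroup G) (x : BurnsideSemiring H) :
    mark U (GrothendieckRing.of x) = (BurnsideSemiring.mark U x : ℤ) := by
  simp [mark]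

theorem mark_cls (U : Subgroup G) (X : FinGSet H) :
    mark U (cls X) = (Nat.card (X.fixedPts U) : ℤ) := mark_of U _

theorem mark_eq_card (U : Subgroup G) (X : FinGSet H)
    (hU : ∀ (h : H), (h : G) ∈ U → ∀ x : X.carrier, h • x = x) :
    mark U (cls X) = (Nat.card X.carrier : ℤ) := by
  rw [mark_cls]
  exact congrArg Nat.cast (Nat.card_congr (Equiv.subtypeUnivEquiv fun x h hh => hU h hh x))

theorem mark_bot (X : FinGSet H) : mark ⊥ (cls X) = (Nat.card X.carrier : ℤ) :=
  mark_eq_card _ _ fun h hh x => by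
    have : h = 1 := Subtype.ext (Subgroup.mem_bot.1 hh)
    rw [this, one_smul]

variable [IsTopologicalGroup G]

theorem mark_res (U : Subgroup G) {L : OpenSubgroup G} (h : L ≤ H) (x : BurnsideRing H) :
    mark U (res h x) = mark (U ⊓ L) x := by
  refine DFunLike.congr_fun (f := ((mark U).toAddMonoidHom.comp (res h).toAddMonoidHom))
    (g := (mark (U ⊓ (L : Subgroup G))).toAddMonoidHom) (GrothendieckRing.hom_ext fun a => ?_) x
  induction a using BurnsideSemiring.ind with | h X
  change mark U (res h (GrothendieckRing.of _)) = mark (U ⊓ (L : Subgroup G)) (cls X)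
  rw [res, GrothendieckRing.map_of]
  change mark U (cls (FinGSet.pullback (incl h) (continuous_incl h) X)) = _
  rw [mark_cls, mark_cls]
  refine congrArg Nat.cast (Nat.card_congr (Equiv.subtypeEquivRight fun x => ?_))
  constructor
  · intro hx a ha
    exact hx ⟨a, ha.2⟩ ha.1
  · intro hx a ha
    exact hx (incl h a) ⟨ha, a.2⟩

theorem incl_injective {L : OpenSubgroup G} (h : L ≤ H) : Function.Injective (incl h) :=
  Subgroup.inclusion_injective _

end BurnsideRing

end Marks

namespace FinGSet

/-- A choice of representatives of cosets identifies `H ×_L X` with `H / L × X`. -/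
def inductionEquiv {L H : Type u} [Group L] [TopologicalSpace L] [Group H] [TopologicalSpace H]
    (φ : L →* H) (hφ : Function.Injective φ) (X : FinGSet L) :
    (H ⧸ φ.range) × X.carrier ≃ Quotient (inductionSetoid φ X) :=
  Equiv.ofBijective (fun q => Quotient.mk (inductionSetoid φ X) (q.1.out, q.2)) (by
    refine ⟨?_, ?_⟩
    · rintro ⟨q, x⟩ ⟨q', x'⟩ e
      obtain ⟨l, h1, h2⟩ := Quotient.exact e
      simp only at h1 h2
      have hq : q = q' := by
        rw [← QuotientGroup.out_eq' q, ← QuotientGroup.out_eq' q', h1]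
        exact QuotientGroup.eq.2 ⟨l⁻¹, by group⟩
      subst hq
      have hl : l = 1 := by
        have : φ l⁻¹ = 1 := by simpa using h1.symm
        simpa using hφ (this.trans φ.map_one.symm)
      rw [h2, hl, one_smul]
    · intro x
      induction x using Quotient.inductionOn with
      | h a =>
        obtain ⟨⟨_, l, rfl⟩, hl⟩ := QuotientGroup.mk_out_eq_mul φ.range a.1
        refine ⟨((a.1 : H ⧸ φ.range), l⁻¹ • a.2), Quotient.sound ⟨l, ?_, ?_⟩⟩
        · simp only at hl
          simp [hl]
        · simp)

end FinGSet

/-! ### Marks of transfers and norms for an abelian group. -/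

section Abelian

variable {G : Type u} [CommGroup G] [TopologicalSpace G] [IsTopologicalGroup G]
  {L H : OpenSubgroup G}

/-- By commutativity `b` fixes the class of `(a, x)` exactly when `b` comes from an element of `L`
fixing `x`; the representative `a` plays no role. -/
theorem FinGSet.mem_fixedPts_induction (h : L ≤ H) (U : Subgroup G)
    (X : FinGSet L) (a : H) (x : X.carrier) :
    (∀ b : H, (b : G) ∈ U → b • Quotient.mk (inductionSetoid (BurnsideRing.incl h) X) (a, x) =
      Quotient.mk _ (a, x)) ↔
    U ⊓ H ≤ (L : Subgroup G) ∧ ∀ l : L, (l : G) ∈ U → l • x = x := by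
  constructor
  · intro hb
    have key : ∀ b : H, (b : G) ∈ U → ∃ l : L, (l : G) = b ∧ l • x = x := by
      intro b hbU
      have h1 := hb b hbU
      rw [induction_smul_mk] at h1
      obtain ⟨l, h2, h3⟩ := Quotient.exact h1
      simp only at h2 h3
      refine ⟨l, ?_, h3.symm⟩
      have h4 : a * BurnsideRing.incl h l = a * b := by
        rw [mul_comm a b]
        nth_rw 1 [h2]
        simp
      exact congrArg Subtype.val (mul_left_cancel h4)
    refine ⟨fun b hbU => ?_, fun l hl => ?_⟩
    · obtain ⟨l, e, _⟩ := key ⟨b, hbU.2⟩ hbU.1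
      rw [← show (l : G) = b from e]
      exact l.2
    · obtain ⟨l', e, hx⟩ := key (BurnsideRing.incl h l) hl
      rwa [show l' = l from Subtype.ext e] at hx
  · rintro ⟨h1, h2⟩ b hb
    rw [induction_smul_mk]
    refine Quotient.sound ⟨⟨b, h1 ⟨hb, b.2⟩⟩, ?_, (h2 _ hb).symm⟩
    have : BurnsideRing.incl h ⟨b, h1 ⟨hb, b.2⟩⟩ = b := rfl
    simp only [map_inv, this]
    rw [mul_comm b a, mul_inv_cancel_right]

namespace BurnsideRing

variable [CompactSpace G]

theorem tr_of (h : L ≤ H) (a : BurnsideSemiring L) : tr h (GrothendieckRing.of a) =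
    GrothendieckRing.of (BurnsideSemiring.induction (incl h) (isOpenMap_incl h) a) := by
  simp [tr]

theorem tr_cls (h : L ≤ H) (X : FinGSet L) :
    tr h (cls X) = cls (X.induction (incl h) (isOpenMap_incl h)) := tr_of h _

theorem norm_of_sub_of (h : L ≤ H) (a b : BurnsideSemiring L) :
    norm h (GrothendieckRing.of a - GrothendieckRing.of b) =
      GrothendieckRing.polySum (incl h).range.index
        (fun x => GrothendieckRing.of
          (BurnsideSemiring.coinduction (incl h) (isOpenMap_incl h) x)) a b :=
  GrothendieckRing.polyExtend_sub _ _ _ a b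

open Classical in
-- Under the bijection of H ×_L X with H / L × X, the fixed points of U are all of H / L × X^U when
-- U ∩ H lies in L, and there are none otherwise.
theorem mark_tr (U : Subgroup G) (h : L ≤ H) (x : BurnsideRing L) :
    mark U (tr h x) =
      if U ⊓ H ≤ (L : Subgroup G) then ((incl h).range.index : ℤ) * mark U x else 0 := by
  let f : BurnsideRing L →+ ℤ := (if U ⊓ H ≤ (L : Subgroup G) then
    (AddMonoidHom.mulLeft ((incl h).range.index : ℤ)).comp (mark U).toAddMonoidHom else 0)
  have hf : ∀ x, f x = if U ⊓ H ≤ (L : Subgroup G) then ((incl h).range.index : ℤ) * mark U x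
      else 0 := by
    intro x
    by_cases hU : U ⊓ H ≤ (L : Subgroup G) <;> simp [f, hU]
  rw [← hf]
  refine DFunLike.congr_fun (f := ((mark U).toAddMonoidHom.comp (tr h)))
    (g := f) (GrothendieckRing.hom_ext fun a => ?_) x
  induction a using BurnsideSemiring.ind with | h X
  change mark U (tr h (cls X)) = f (cls X)
  rw [tr_cls, hf, mark_cls, mark_cls]
  by_cases hU : U ⊓ H ≤ (L : Subgroup G)
  · rw [if_pos hU, Subgroup.index, ← Nat.cast_mul, ← Nat.card_prod]
    refine congrArg Nat.cast (Nat.card_congr ?_)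
    let e := FinGSet.inductionEquiv (incl h) (incl_injective h) X
    refine Equiv.trans (e.subtypeEquiv (p := fun q => ∀ l : L, (l : G) ∈ U → l • q.2 = q.2)
      fun q => ?_).symm ?_
    · exact ((FinGSet.mem_fixedPts_induction h U X q.1.out q.2).trans (and_iff_right hU)).symm
    · exact
      { toFun := fun q => (q.1.1, ⟨q.1.2, q.2⟩)
        invFun := fun q => ⟨(q.1, q.2.1), q.2.2⟩
        left_inv := fun _ => rfl
        right_inv := fun _ => rfl }
  · rw [if_neg hU, Nat.cast_eq_zero, Nat.card_eq_zero]
    refine Or.inl ⟨?_⟩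
    rintro ⟨z, hz⟩
    induction z using Quotient.inductionOn with
    | h a => exact hU ((FinGSet.mem_fixedPts_induction h U X a.1 a.2).1 hz).1

end BurnsideRing

/-- The number of double cosets of `L` and `U` in `H`. -/
def dblIndex (H L : OpenSubgroup G) (U : Subgroup G) : ℕ :=
  ((L : Subgroup G).subgroupOf (H : Subgroup G) ⊔ U.subgroupOf (H : Subgroup G)).index

open BurnsideRing in
-- In an abelian group the double cosets of `L` and `U` are the cosets of the product `L U`, so any
-- element differs from the chosen representative by a product of an element of `L` and one of `U`.
theorem FinGSet.coind_dec (h : L ≤ H) (U : Subgroup G) (a : H) :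
    ∃ (l : L) (b : H), (b : G) ∈ U ∧ a = incl h l * ((a : H ⧸ ((L : Subgroup G).subgroupOf
      (H : Subgroup G) ⊔ U.subgroupOf (H : Subgroup G) : Subgroup H)).out * b) := by
  obtain ⟨⟨c, hcm⟩, hc'⟩ := QuotientGroup.mk_out_eq_mul ((L : Subgroup G).subgroupOf (H : Subgroup G) ⊔
      U.subgroupOf (H : Subgroup G) : Subgroup H) a
  obtain ⟨l, hl, b, hb, e⟩ := Subgroup.mem_sup.1 hcm
  refine ⟨⟨(l : G)⁻¹, inv_mem hl⟩, b⁻¹, inv_mem hb, ?_⟩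
  have : incl h ⟨(l : G)⁻¹, inv_mem hl⟩ = l⁻¹ := rfl
  rw [this, hc']
  simp only [← e]
  rw [mul_comm l⁻¹, mul_assoc, mul_assoc, ← mul_inv_rev, mul_inv_cancel, mul_one]

open BurnsideRing in
/-- The functions in `Map_L(H, X)` that are fixed by `U` are determined by their values at
representatives of the double cosets of `L` and `U`, which are arbitrary points of `X` fixed
by `L ∩ U`. -/
def FinGSet.coindFixedEquiv (h : L ≤ H) (U : Subgroup G) (X : FinGSet L) :
    {s : Coind (incl h) X // ∀ b : H, (b : G) ∈ U → b • s = s} ≃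
    (H ⧸ ((L : Subgroup G).subgroupOf (H : Subgroup G) ⊔ U.subgroupOf (H : Subgroup G) :
      Subgroup H) → X.fixedPts U) :=
  Equiv.ofBijective (fun s q => ⟨s.1.fn q.out, fun l hl => by
    rw [← s.1.map_mul, mul_comm, ← coind_smul_apply, s.2 _ hl]⟩) (by
    refine ⟨?_, ?_⟩
    · rintro ⟨s, hs⟩ ⟨t, ht⟩ e
      refine Subtype.ext (Coind.ext (funext fun a => ?_))
      obtain ⟨l, b, hb, ha⟩ := coind_dec h U a
      have e1 := congrArg Subtype.val (congrFun e (QuotientGroup.mk a))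
      simp only at e1
      rw [ha, s.map_mul, t.map_mul, ← coind_smul_apply, ← coind_smul_apply, hs b hb, ht b hb, e1]
    · intro f
      choose l b hb hl using coind_dec h U
      -- The decompositions of a and a' are chosen independently. They disagree by an element of L
      -- lying in U, which fixes the values of f, so the function built from f is both L-equivariant
      -- and U-invariant.
      have key : ∀ (a a' : H) (m : L) (c : H), (c : G) ∈ U → a' = incl h m * (a * c) →
          l a' • (f (QuotientGroup.mk a')).1 = m • l a • (f (QuotientGroup.mk a)).1 := by
        intro a a' m c hcU e
        have hq : (QuotientGroup.mk a' : H ⧸ ((L : Subgroup G).subgroupOf (H : Subgroup G) ⊔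
            U.subgroupOf (H : Subgroup G) : Subgroup H)) = QuotientGroup.mk a := by
          refine (QuotientGroup.eq.2 (Subgroup.mem_sup.2 ⟨incl h m, m.2, c, hcU, ?_⟩)).symm
          rw [e, mul_left_comm, inv_mul_cancel_left]
        have e1 := e.symm.trans (hl a')
        rw [hq] at e1
        nth_rw 1 [hl a] at e1
        have e2 : incl h (l a') = incl h m * incl h (l a) * (b a * c * (b a')⁻¹) := by
          rw [← mul_assoc, eq_mul_inv_iff_mul_eq]
          refine mul_right_cancel (b := (QuotientGroup.mk a : H ⧸ ((L : Subgroup G).subgroupOf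
            (H : Subgroup G) ⊔ U.subgroupOf (H : Subgroup G) : Subgroup H)).out) ?_
          simp only [mul_assoc, mul_comm, mul_left_comm] at e1 ⊢
          exact e1.symm
        have e3 : incl h ((m * l a)⁻¹ * l a') = b a * c * (b a')⁻¹ := by
          rw [map_mul, map_inv, map_mul, e2, inv_mul_cancel_left]
        have e4 : ((((m * l a)⁻¹ * l a' : L)) : G) ∈ U := by
          have : ((((m * l a)⁻¹ * l a' : L)) : G) = ((b a * c * (b a')⁻¹ : H) : G) :=
            congrArg Subtype.val e3
          rw [this]
          exact mul_mem (mul_mem (hb a) hcU) (inv_mem (hb a'))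
        have e5 := (f (QuotientGroup.mk a)).2 _ e4
        rw [hq, ← mul_smul, ← inv_smul_eq_iff, ← mul_smul, e5]
      refine ⟨⟨⟨fun a => l a • (f (QuotientGroup.mk a)).1, fun m a => ?_⟩, fun c hcU => ?_⟩, ?_⟩
      · exact key a _ m 1 (one_mem _) (by simp)
      · refine Coind.ext (funext fun a => ?_)
        rw [coind_smul_apply]
        exact (key a _ 1 c hcU (by simp)).trans (one_smul _ _)
      · funext q
        refine Subtype.ext ?_
        have e1 := hl q.out
        simp only
        rw [QuotientGroup.out_eq'] at e1 ⊢
        refine (f q).2 _ ?_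
        have e2 : incl h (l q.out) = (b q.out)⁻¹ := by
          rw [mul_left_comm, eq_comm, mul_eq_left] at e1
          exact eq_inv_of_mul_eq_one_left e1
        have e3 : ((l q.out : L) : G) = (((b q.out)⁻¹ : H) : G) := congrArg Subtype.val e2
        rw [e3]
        exact inv_mem (hb _))

namespace BurnsideRing

variable [CompactSpace G]

theorem mark_coinduction (U : Subgroup G) (h : L ≤ H) (a : BurnsideSemiring L) :
    BurnsideSemiring.mark U (BurnsideSemiring.coinduction (incl h) (isOpenMap_incl h) a) =
      BurnsideSemiring.mark U a ^ dblIndex H L U := by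
  induction a using BurnsideSemiring.ind with | h X
  change Nat.card {s : FinGSet.Coind (incl h) X // ∀ b : H, (b : G) ∈ U → b • s = s} = _
  have : Finite (H ⧸ ((L : Subgroup G).subgroupOf (H : Subgroup G) ⊔
      U.subgroupOf (H : Subgroup G) : Subgroup H)) := by
    refine Finite.of_surjective (α := H ⧸ (incl h).range) (Subgroup.quotientMapOfLE ?_) ?_
    · rintro _ ⟨l, rfl⟩
      exact Subgroup.mem_sup_left l.2
    · intro q
      induction q using QuotientGroup.induction_on with
      | H a => exact ⟨QuotientGroup.mk a, rfl⟩
  rw [Nat.card_congr (FinGSet.coindFixedEquiv h U X), Nat.card_fun]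
  rfl

theorem range_incl (h : L ≤ H) : (incl h).range = (L : Subgroup G).subgroupOf (H : Subgroup G) := by
  ext x
  exact ⟨by rintro ⟨l, rfl⟩; exact l.2, fun hx => ⟨⟨x, hx⟩, rfl⟩⟩

theorem finite_quotient_subgroupOf (h : L ≤ H) :
    Finite (H ⧸ (L : Subgroup G).subgroupOf (H : Subgroup G)) := by
  rw [← range_incl h]
  exact finite_quotient_range_incl h

theorem dblIndex_le (h : L ≤ H) (U : Subgroup G) : dblIndex H L U ≤ (incl h).range.index := by
  have := finite_quotient_subgroupOf h
  have := Subgroup.finiteIndex_of_finite_quotient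
    (H := (L : Subgroup G).subgroupOf (H : Subgroup G))
  rw [range_incl]
  refine Nat.le_of_dvd ?_ (Subgroup.index_dvd_of_le le_sup_left)
  exact Nat.pos_of_ne_zero Subgroup.FiniteIndex.index_ne_zero

theorem dblIndex_pos (h : L ≤ H) (U : Subgroup G) : 0 < dblIndex H L U := by
  have := finite_quotient_subgroupOf h
  have := Subgroup.finiteIndex_of_finite_quotient
    (H := (L : Subgroup G).subgroupOf (H : Subgroup G))
  have h2 : (L : Subgroup G).subgroupOf (H : Subgroup G) ≤
    (L : Subgroup G).subgroupOf (H : Subgroup G) ⊔ U.subgroupOf (H : Subgroup G) := le_sup_left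
  have := Subgroup.finiteIndex_of_le h2
  exact Nat.pos_of_ne_zero Subgroup.FiniteIndex.index_ne_zero

/-- A mark is additive, so it passes through the alternating sum that defines the norm; on actual
sets it gives a power (`mark_coinduction`). The exponent is at most the degree of the extension by
`dblIndex_le`, so `polySum_pow` applies. -/
theorem mark_norm (U : Subgroup G) (h : L ≤ H) (x : BurnsideRing L) :
    mark U (norm h x) = mark U x ^ dblIndex H L U := by
  obtain ⟨a, b, rfl⟩ := GrothendieckRing.exists_eq_sub x
  rw [norm_of_sub_of]
  refine (GrothendieckRing.map_polySum (mark U).toAddMonoidHom _ _ a b).trans ?_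
  rw [map_sub, mark_of, mark_of]
  refine Eq.trans ?_ (GrothendieckRing.polySum_pow
    ((Nat.castAddMonoidHom ℤ).comp (BurnsideSemiring.mark U).toAddMonoidHom) (dblIndex_le h U) a b)
  congr 1
  funext x
  change mark U (GrothendieckRing.of _) = _
  rw [mark_of, mark_coinduction, Nat.cast_pow]
  rfl

end BurnsideRing

end Abelian

/-! ### Transitive sets as quotients by open subgroups. -/

section TransitiveSets

variable {G : Type u} [Group G] [TopologicalSpace G] [IsTopologicalGroup G] [CompactSpace G]

namespace BurnsideRing

/-- The subgroup `L ∩ H` of `H`. -/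
abbrev relSub (H L : OpenSubgroup G) : Subgroup H := (L : Subgroup G).subgroupOf (H : Subgroup G)

theorem isOpen_relSub (H L : OpenSubgroup G) : IsOpen (relSub H L : Set H) :=
  L.isOpen.preimage continuous_subtype_val

instance finite_quotient_relSub (H L : OpenSubgroup G) : Finite (H ⧸ relSub H L) :=
  have : CompactSpace H := isCompact_iff_compactSpace.1 H.isClosed.isCompact
  Subgroup.quotient_finite_of_isOpen _ (isOpen_relSub H L)

/-- The transitive `H`-set `H / (L ∩ H)`. -/
def orbitSet (H L : OpenSubgroup G) : FinGSet H := FinGSet.quotient (relSub H L) (isOpen_relSub H L)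

theorem orbit_eq (H L : OpenSubgroup G) : orbit H L = cls (orbitSet H L) := rfl

end BurnsideRing

end TransitiveSets

/-! ### Orbit decomposition, and separation of virtual sets by marks. -/

section Orbits

variable {G : Type u} [CommGroup G] [TopologicalSpace G] [IsTopologicalGroup G] [CompactSpace G]
  {L H : OpenSubgroup G}

namespace BurnsideRing

theorem smul_eq_iff_orbitSet (b : H) (x : (orbitSet H L).carrier) : b • x = x ↔ (b : G) ∈ L := by
  induction x using QuotientGroup.induction_on with
  | H a =>
    refine (eq_comm.trans (QuotientGroup.eq (s := relSub H L) (a := a) (b := b * a))).trans ?_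
    rw [mul_left_comm, inv_mul_cancel, mul_one]
    exact Iff.rfl

open Classical in
theorem mark_orbit (U : Subgroup G) (H L : OpenSubgroup G) :
    mark U (orbit H L) = if U ⊓ H ≤ (L : Subgroup G) then ((relSub H L).index : ℤ) else 0 := by
  rw [orbit_eq]
  split_ifs with h
  · refine mark_eq_card _ _ fun b hb x => ?_
    rw [smul_eq_iff_orbitSet]
    exact h ⟨hb, b.2⟩
  · rw [mark_cls, Nat.cast_eq_zero, Nat.card_eq_zero]
    refine Or.inl ⟨fun x => h fun b hb => ?_⟩
    exact (smul_eq_iff_orbitSet ⟨b, hb.2⟩ x.1).1 (x.2 ⟨b, hb.2⟩ hb.1)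

end BurnsideRing

open BurnsideRing

namespace FinGSet

/-- The stabilizer of a point of an `H`-set as an open subgroup of `G`. -/
def openStab (X : FinGSet H) (x : X.carrier) : OpenSubgroup G where
  __ := (MulAction.stabilizer H x).map (H : Subgroup G).subtype
  isOpen' := H.isOpen.isOpenMap_subtype_val _ (X.isOpen_stabilizer x)

theorem mem_openStab (X : FinGSet H) (x : X.carrier) (b : H) :
    (b : G) ∈ X.openStab x ↔ b • x = x := by
  constructor
  · rintro ⟨h', hh', e⟩
    obtain rfl : h' = b := Subtype.ext e
    exact hh'
  · exact fun e => ⟨b, e, rfl⟩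

theorem openStab_le (X : FinGSet H) (x : X.carrier) : X.openStab x ≤ H := by
  rintro _ ⟨b, _, rfl⟩
  exact b.2

/-- The complement of the orbit of a point. -/
def removeOrbit (X : FinGSet H) (x : X.carrier) : FinGSet H :=
  X.sub (fun y => y ∉ MulAction.orbit H x) fun b y hy => by
    rintro ⟨a, ha⟩
    refine hy ⟨b⁻¹ * a, ?_⟩
    simp only at ha ⊢
    rw [mul_smul, ha, inv_smul_smul]

theorem card_removeOrbit_lt (X : FinGSet H) (x : X.carrier) :
    Nat.card (X.removeOrbit x).carrier < Nat.card X.carrier := by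
  refine Finite.card_subtype_lt (x := x) ?_
  simp

theorem mk_eq_orbit_add (X : FinGSet H) (x : X.carrier) :
    BurnsideSemiring.mk X = BurnsideSemiring.mk (orbitSet H (X.openStab x)) +
      BurnsideSemiring.mk (X.removeOrbit x) := by
  have hrel : ∀ a b : H, QuotientGroup.leftRel (relSub H (X.openStab x)) a b ↔ a • x = b • x := by
    intro a b
    rw [QuotientGroup.leftRel_apply, Subgroup.mem_subgroupOf]
    refine (mem_openStab X x (a⁻¹ * b)).trans ?_
    rw [mul_smul, inv_smul_eq_iff, eq_comm]
  let f : (orbitSet H (X.openStab x)).carrier → X.carrier :=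
    Quotient.lift (fun a : H => a • x) fun a b h => (hrel a b).1 h
  refine (BurnsideSemiring.mk_eq_of_equiv (Equiv.ofBijective
    (Sum.elim f (fun y : (X.removeOrbit x).carrier => y.1)) ⟨?_, ?_⟩) ?_).symm
  · rintro (a | a) (b | b) e
    · induction a using Quotient.inductionOn
      induction b using Quotient.inductionOn
      exact congrArg Sum.inl (Quotient.sound ((hrel _ _).2 e))
    · induction a using Quotient.inductionOn with
      | h a => exact (b.2 ⟨a, e⟩).elim
    · induction b using Quotient.inductionOn with
      | h b => exact (a.2 ⟨b, e.symm⟩).elim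
    · exact congrArg Sum.inr (Subtype.ext e)
  · intro y
    by_cases hy : y ∈ MulAction.orbit H x
    · obtain ⟨a, rfl⟩ := hy
      exact ⟨Sum.inl (Quotient.mk _ a), rfl⟩
    · exact ⟨Sum.inr ⟨y, hy⟩, rfl⟩
  · rintro b (a | a)
    · induction a using Quotient.inductionOn with
      | h a => exact mul_smul b a x
    · rfl

theorem cls_eq_orbit_add (X : FinGSet H) (x : X.carrier) :
    cls X = orbit H (X.openStab x) + cls (X.removeOrbit x) :=
  (congrArg GrothendieckRing.of (X.mk_eq_orbit_add x)).trans (map_add _ _ _)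

theorem mk_eq_zero (X : FinGSet H) (h : IsEmpty X.carrier) : BurnsideSemiring.mk X = 0 :=
  BurnsideSemiring.mk_eq_of_equiv (Equiv.equivOfIsEmpty _ PEmpty) fun _ x => (h.false x).elim

/-- An abelian group of finite sets with the same marks are isomorphic. -/
theorem mk_eq_mk_of_marks (n : ℕ) : ∀ (X Y : FinGSet H), Nat.card X.carrier = n →
    (∀ U : OpenSubgroup G, U ≤ H → Nat.card (X.fixedPts (U : Subgroup G)) =
      Nat.card (Y.fixedPts (U : Subgroup G))) →
    BurnsideSemiring.mk X = BurnsideSemiring.mk Y := by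
  induction n using Nat.strong_induction_on with
  | _ n ih =>
  intro X Y hn hXY
  rcases isEmpty_or_nonempty X.carrier with hX | hX
  · have hY : IsEmpty Y.carrier := by
      refine ⟨fun y => ?_⟩
      have h1 := hXY (Y.openStab y) (Y.openStab_le y)
      have h2 : Nat.card (X.fixedPts (Y.openStab y : Subgroup G)) = 0 :=
        Nat.card_eq_zero.2 (Or.inl ⟨fun z => hX.false z.1⟩)
      rw [h2, eq_comm, Nat.card_eq_zero] at h1
      rcases h1 with h1 | h1
      · exact h1.false ⟨y, fun b hb => (Y.mem_openStab y b).1 hb⟩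
      · exact h1.not_finite inferInstance
    rw [mk_eq_zero X hX, mk_eq_zero Y hY]
  · obtain ⟨x⟩ := hX
    -- Take a point with maximal stabilizer. Equality of marks at this stabilizer yields a point of
    -- Y, and then again one of X, with stabilizers at least as large; maximality makes them equal.
    -- The two isomorphic orbits are then removed and induction applies.
    obtain ⟨x₀, -, hx₀⟩ := Set.Finite.exists_maximalFor (fun z : X.carrier => X.openStab z)
      Set.univ Set.finite_univ ⟨x, trivial⟩
    have step : ∀ (V W : FinGSet H), (∀ U : OpenSubgroup G, U ≤ H →
        Nat.card (V.fixedPts (U : Subgroup G)) = Nat.card (W.fixedPts (U : Subgroup G))) →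
        ∀ v : V.carrier, ∃ w : W.carrier, V.openStab v ≤ W.openStab w := by
      intro V W hVW v
      have h1 := hVW (V.openStab v) (V.openStab_le v)
      have h2 : 0 < Nat.card (V.fixedPts (V.openStab v : Subgroup G)) :=
        have : Nonempty (V.fixedPts (V.openStab v : Subgroup G)) :=
          ⟨⟨v, fun b hb => (V.mem_openStab v b).1 hb⟩⟩
        Nat.card_pos
      rw [h1] at h2
      obtain ⟨⟨w, hw⟩⟩ := (Nat.card_pos_iff.1 h2).1
      refine ⟨w, fun b hb => ?_⟩
      exact (W.mem_openStab w ⟨b, V.openStab_le v hb⟩).2 (hw ⟨b, V.openStab_le v hb⟩ hb)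
    obtain ⟨y₀, hy₀⟩ := step X Y hXY x₀
    obtain ⟨x₁, hx₁⟩ := step Y X (fun U hU => (hXY U hU).symm) y₀
    have hst : X.openStab x₀ = Y.openStab y₀ :=
      le_antisymm hy₀ (hx₁.trans (hx₀ trivial (hy₀.trans hx₁)))
    rw [mk_eq_orbit_add X x₀, mk_eq_orbit_add Y y₀, ← hst]
    congr 1
    refine ih _ ?_ _ _ rfl fun U hU => ?_
    · rw [← hn]
      exact card_removeOrbit_lt X x₀
    · have h1 := hXY U hU
      rw [← BurnsideSemiring.mark_mk, ← BurnsideSemiring.mark_mk, mk_eq_orbit_add X x₀,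
        mk_eq_orbit_add Y y₀, ← hst, map_add, map_add] at h1
      exact Nat.add_left_cancel h1

end FinGSet

namespace BurnsideRing

/-- The marks at the open subgroups of `H` separate the elements of `A(H)`. -/
theorem ext_marks {x y : BurnsideRing H}
    (h : ∀ U : OpenSubgroup G, U ≤ H → mark (U : Subgroup G) x = mark (U : Subgroup G) y) :
    x = y := by
  obtain ⟨a, b, rfl⟩ := GrothendieckRing.exists_eq_sub x
  obtain ⟨c, d, rfl⟩ := GrothendieckRing.exists_eq_sub y
  rw [sub_eq_sub_iff_add_eq_add, ← map_add, ← map_add]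
  congr 1
  have h2 : ∀ U : OpenSubgroup G, U ≤ H → BurnsideSemiring.mark (U : Subgroup G) (a + d) =
      BurnsideSemiring.mark (U : Subgroup G) (c + b) := by
    intro U hU
    have := h U hU
    simp only [map_sub, mark_of] at this
    rw [map_add, map_add]
    omega
  generalize a + d = p at h2
  generalize c + b = q at h2
  induction p using BurnsideSemiring.ind with | h X
  induction q using BurnsideSemiring.ind with | h Y
  exact FinGSet.mk_eq_mk_of_marks _ X Y rfl h2

/-- The Burnside ring is additively generated by the transitive sets. -/
theorem mem_of_orbit_mem (S : AddSubgroup (BurnsideRing H))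
    (hS : ∀ L : OpenSubgroup G, L ≤ H → orbit H L ∈ S) (x : BurnsideRing H) : x ∈ S := by
  have key : ∀ (n : ℕ) (X : FinGSet H), Nat.card X.carrier = n → cls X ∈ S := by
    intro n
    induction n using Nat.strong_induction_on with
    | _ n ih =>
    intro X hn
    rcases isEmpty_or_nonempty X.carrier with hX | hX
    · rw [cls, FinGSet.mk_eq_zero X hX, map_zero]
      exact zero_mem S
    · obtain ⟨x⟩ := hX
      rw [FinGSet.cls_eq_orbit_add X x]
      refine add_mem (hS _ (X.openStab_le x)) (ih _ ?_ _ rfl)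
      rw [← hn]
      exact FinGSet.card_removeOrbit_lt X x
  obtain ⟨a, b, rfl⟩ := GrothendieckRing.exists_eq_sub x
  induction a using BurnsideSemiring.ind with | h X
  induction b using BurnsideSemiring.ind with | h Y
  exact sub_mem (key _ X rfl) (key _ Y rfl)

end BurnsideRing

end Orbits

/-! ## Open subgroups of the profinite integers -/

/-- The generator is the image of 1, whose powers are dense. If its k-th power is an M-th power,
projection to the quotient ℤ/M, where M-th powers are trivial, shows that M divides k. -/
theorem ZHat.exists_generator : ∃ g : ZHat, (DenseRange fun k : ℤ => g ^ k) ∧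
    ∀ (M : ℕ+) (k : ℤ), g ^ k ∈ multiples M ↔ (M : ℤ) ∣ k := by
  let φ : Multiplicative ℤ →* ZHat :=
    { toFun := ProfiniteGrp.ProfiniteCompletion.etaFn (GrpCat.of (Multiplicative ℤ))
      map_one' := rfl
      map_mul' := fun _ _ => rfl }
  have h : DenseRange φ :=
    ProfiniteGrp.ProfiniteCompletion.denseRange (GrpCat.of (Multiplicative ℤ))
  have e0 : ∀ k : ℤ, φ (Multiplicative.ofAdd 1) ^ k = φ (Multiplicative.ofAdd k) := by
    intro k
    rw [← map_zpow, ← ofAdd_zsmul, smul_eq_mul, mul_one]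
  have e : (fun k : ℤ => φ (Multiplicative.ofAdd 1) ^ k) = φ ∘ Multiplicative.ofAdd := funext e0
  refine ⟨φ (Multiplicative.ofAdd 1), ?_, fun M k => ⟨?_, ?_⟩⟩
  · rw [DenseRange, e, Multiplicative.ofAdd.surjective.range_comp]
    exact h
  · rintro ⟨x, hx⟩
    let S : Subgroup (Multiplicative ℤ) := AddSubgroup.toSubgroup (AddSubgroup.zmultiples (M : ℤ))
    have hcard : Nat.card (Multiplicative ℤ ⧸ S) = M := by
      change Nat.card (ℤ ⧸ AddSubgroup.zmultiples (M : ℤ)) = M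
      rw [Nat.card_congr (Int.quotientZMultiplesNatEquivZMod (M : ℕ)).toEquiv, Nat.card_zmod]
    have hfin : Finite (Multiplicative ℤ ⧸ S) :=
      Nat.finite_of_card_ne_zero (by rw [hcard]; exact M.ne_zero)
    have : S.FiniteIndex := Subgroup.finiteIndex_of_finite_quotient
    let N : FiniteIndexNormalSubgroup (Multiplicative ℤ) := FiniteIndexNormalSubgroup.ofSubgroup S
    let π : ZHat →* (Multiplicative ℤ ⧸ S) :=
      { toFun := fun z => z.1 N
        map_one' := rfl
        map_mul' := fun _ _ => rfl }
    have h1 : π (φ (Multiplicative.ofAdd k)) = QuotientGroup.mk (Multiplicative.ofAdd k) := rfl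
    have h2 : π (x ^ (M : ℕ)) = 1 := by
      rw [map_pow, ← hcard, pow_card_eq_one']
    simp only at hx
    rw [hx, e0, h1, QuotientGroup.eq_one_iff] at h2
    exact Int.mem_zmultiples_iff.1 h2
  · rintro ⟨j, rfl⟩
    exact ⟨φ (Multiplicative.ofAdd 1) ^ j, by
      simp only
      rw [← zpow_natCast, ← zpow_mul, mul_comm]⟩

section Generator

variable {G : Type u} [CommGroup G] [TopologicalSpace G] [IsTopologicalGroup G] [CompactSpace G]
  (e : G ≃ₜ* ZHat)

/-- A topological generator. -/
def gen : G := e.symm ZHat.exists_generator.choose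

theorem gen_zpow_mem_lvl (M : ℕ+) (k : ℤ) : gen e ^ k ∈ lvl e M ↔ (M : ℤ) ∣ k := by
  have h : gen e ^ k ∈ lvl e M ↔ e (gen e ^ k) ∈ ZHat.multiples M := Iff.rfl
  rw [h, map_zpow, gen, e.apply_symm_apply]
  exact ZHat.exists_generator.choose_spec.2 M k

theorem exists_zpow_mul_mem (V : OpenSubgroup G) (x : G) : ∃ k : ℤ, x⁻¹ * gen e ^ k ∈ V := by
  have hd : DenseRange fun k : ℤ => gen e ^ k := by
    have h1 := e.symm.surjective.denseRange.comp ZHat.exists_generator.choose_spec.1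
      e.symm.continuous
    convert h1 using 2 with k
    rw [gen, Function.comp_apply, map_zpow]
  obtain ⟨_, hz, ⟨k, rfl⟩⟩ := hd.exists_mem_open (s := (fun y => x⁻¹ * y) ⁻¹' (V : Set G))
    (V.isOpen.preimage (by fun_prop)) ⟨x, by simp⟩ |>.elim
    (fun k hk => (⟨_, hk, k, rfl⟩ : ∃ z, z ∈ (fun y => x⁻¹ * y) ⁻¹' (V : Set G) ∧
      z ∈ Set.range fun k : ℤ => gen e ^ k))
  exact ⟨k, hz⟩

/-- By density, an element of `H` can be approximated modulo `H ⊓ L` by a power of the generator, so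
an inclusion of open subgroups can be tested on these powers. -/
theorem openSubgroup_le_of_gen {H L : OpenSubgroup G}
    (h : ∀ k : ℤ, gen e ^ k ∈ H → gen e ^ k ∈ L) : H ≤ L := by
  intro x hx
  obtain ⟨k, hk⟩ := exists_zpow_mul_mem e (H ⊓ L) x
  have h1 := h k ((mul_mem_cancel_left (inv_mem hx)).1 hk.1)
  exact inv_mem_iff.1 ((mul_mem_cancel_right h1).1 hk.2)

/-- The integer M is the order of the generator in the finite quotient G / H. -/
theorem exists_eq_lvl (H : OpenSubgroup G) : ∃ M : ℕ+, H = lvl e M := by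
  have : Finite (G ⧸ (H : Subgroup G)) := Subgroup.quotient_finite_of_isOpen _ H.isOpen
  let q : G ⧸ (H : Subgroup G) := QuotientGroup.mk (gen e)
  have hmem : ∀ i : ℤ, gen e ^ i ∈ H ↔ (orderOf q : ℤ) ∣ i := by
    intro i
    rw [orderOf_dvd_iff_zpow_eq_one]
    exact (QuotientGroup.eq_one_iff (N := (H : Subgroup G)) (gen e ^ i)).symm
  refine ⟨Nat.toPNat (orderOf q) (orderOf_pos q), le_antisymm ?_ ?_⟩ <;>
    refine openSubgroup_le_of_gen e fun k hk => ?_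
  · exact (gen_zpow_mem_lvl e _ k).2 ((hmem k).1 hk)
  · exact (hmem k).2 ((gen_zpow_mem_lvl e _ k).1 hk)

theorem lvl_le_lvl {M N : ℕ+} : lvl e N ≤ lvl e M ↔ M ∣ N := by
  constructor
  · intro h
    have h1 := h ((gen_zpow_mem_lvl e N N).2 dvd_rfl)
    rw [PNat.dvd_iff]
    exact_mod_cast (gen_zpow_mem_lvl e M N).1 h1
  · intro h
    refine openSubgroup_le_of_gen e fun k hk => ?_
    rw [gen_zpow_mem_lvl] at hk ⊢
    exact (Int.natCast_dvd_natCast.2 (PNat.dvd_iff.1 h)).trans hk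

theorem lvl_mul_le (k M : ℕ+) : lvl e (k * M) ≤ lvl e M := (lvl_le_lvl e).2 (dvd_mul_left M k)

theorem lvl_injective {M N : ℕ+} (h : lvl e M = lvl e N) : M = N :=
  PNat.dvd_antisymm ((lvl_le_lvl e).1 h.ge) ((lvl_le_lvl e).1 h.le)

/-- The topological generator of `M Ẑ`. -/
def genAt (M : ℕ+) : lvl e M := ⟨gen e ^ (M : ℤ), (gen_zpow_mem_lvl e M M).2 dvd_rfl⟩

theorem coe_genAt_zpow (M : ℕ+) (k : ℤ) : ((genAt e M ^ k : lvl e M) : G) = gen e ^ (M * k : ℤ) := by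
  rw [zpow_mul]
  rfl

theorem genAt_zpow_mem_lvl (M k : ℕ+) (i : ℤ) :
    ((genAt e M ^ i : lvl e M) : G) ∈ lvl e (k * M) ↔ (k : ℤ) ∣ i := by
  rw [coe_genAt_zpow, gen_zpow_mem_lvl, PNat.mul_coe, Nat.cast_mul, mul_comm]
  exact Int.mul_dvd_mul_iff_left (by exact_mod_cast M.ne_zero)

theorem exists_genAt_zpow (M : ℕ+) (V : OpenSubgroup G) (x : lvl e M) :
    ∃ k : ℤ, ((x⁻¹ * genAt e M ^ k : lvl e M) : G) ∈ V := by
  obtain ⟨k, hk⟩ := exists_zpow_mul_mem e (lvl e M ⊓ V) x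
  have h1 := (mul_mem_cancel_left (inv_mem x.2)).1 hk.1
  obtain ⟨j, rfl⟩ := (gen_zpow_mem_lvl e M k).1 h1
  exact ⟨j, by rw [Subgroup.coe_mul, coe_genAt_zpow]; exact hk.2⟩

open BurnsideRing

/-- The powers of the generator represent the cosets. -/
def quotientEquivFin (M k : ℕ+) : Fin (k : ℕ) ≃ lvl e M ⧸ relSub (lvl e M) (lvl e (k * M)) :=
  Equiv.ofBijective (fun i => QuotientGroup.mk (genAt e M ^ (i : ℕ))) (by
    constructor
    · intro i j hij
      have h1 : ((genAt e M ^ ((j : ℤ) - (i : ℤ)) : lvl e M) : G) ∈ lvl e (k * M) := by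
        have h2 := QuotientGroup.eq.1 hij
        rw [← zpow_natCast, ← zpow_natCast, ← zpow_neg, ← zpow_add, neg_add_eq_sub] at h2
        exact h2
      rw [genAt_zpow_mem_lvl] at h1
      have h3 := Int.eq_zero_of_abs_lt_dvd h1 (by rw [abs_lt]; omega)
      exact Fin.ext (by omega)
    · intro q
      induction q using QuotientGroup.induction_on with
      | H x =>
        obtain ⟨z, hz⟩ := exists_genAt_zpow e M (lvl e (k * M)) x
        have hk : (0 : ℤ) < ((k : ℕ) : ℤ) := by exact_mod_cast k.pos
        have h1 := Int.emod_nonneg z hk.ne'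
        have h2 := Int.emod_lt_of_pos z hk
        refine ⟨⟨(z % ((k : ℕ) : ℤ)).toNat, by omega⟩, ?_⟩
        refine (QuotientGroup.eq.2 ?_).symm
        have h4 : x⁻¹ * genAt e M ^ (z % ((k : ℕ) : ℤ)).toNat =
            x⁻¹ * genAt e M ^ z * genAt e M ^ (-(k * (z / k)) : ℤ) := by
          rw [mul_assoc, ← zpow_add, ← zpow_natCast, Int.toNat_of_nonneg h1, Int.emod_def]
          rfl
        refine (congrArg (fun y : lvl e M => (y : G) ∈ lvl e (k * M)) h4).mpr ?_
        exact mul_mem hz ((genAt_zpow_mem_lvl e M k _).2 ((Dvd.intro _ rfl).neg_right)))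

theorem quotientEquivFin_apply (M k : ℕ+) (i : Fin (k : ℕ)) :
    quotientEquivFin e M k i = QuotientGroup.mk (genAt e M ^ (i : ℕ)) := rfl

theorem index_relSub (M k : ℕ+) : (relSub (lvl e M) (lvl e (k * M))).index = k := by
  rw [Subgroup.index, ← Nat.card_congr (quotientEquivFin e M k), Nat.card_fin]

theorem index_range_incl (M k : ℕ+) : (incl (lvl_mul_le e k M)).range.index = k := by
  rw [range_incl]
  exact index_relSub e M k

theorem dblIndex_of_le (M q N : ℕ+) (h : q * M ∣ N) :
    dblIndex (lvl e M) (lvl e (q * M)) (lvl e N : Subgroup G) = q := by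
  rw [dblIndex, sup_eq_left.2, index_relSub e M q]
  exact Subgroup.comap_mono ((lvl_le_lvl e).2 h)

/-- The number of double cosets divides the prime `q`. It can equal `q` only if N Ẑ is already
contained in qM Ẑ. -/
theorem dblIndex_of_prime (M q N : ℕ+) (hq : q.Prime) (hMN : M ∣ N) (h : ¬ q * M ∣ N) :
    dblIndex (lvl e M) (lvl e (q * M)) (lvl e N : Subgroup G) = 1 := by
  have h1 : dblIndex (lvl e M) (lvl e (q * M)) (lvl e N : Subgroup G) ∣ q := by
    rw [← index_relSub e M q]
    exact Subgroup.index_dvd_of_le le_sup_left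
  refine ((Nat.dvd_prime hq).1 h1).resolve_right fun h2 => h ?_
  rw [dblIndex, ← index_relSub e M q] at h2
  have h3 : relSub (lvl e M) (lvl e (q * M)) = relSub (lvl e M) (lvl e (q * M)) ⊔
      (lvl e N : Subgroup G).subgroupOf (lvl e M : Subgroup G) := by
    have h4 := Subgroup.relIndex_mul_index (le_sup_left :
      relSub (lvl e M) (lvl e (q * M)) ≤ relSub (lvl e M) (lvl e (q * M)) ⊔
      (lvl e N : Subgroup G).subgroupOf (lvl e M : Subgroup G))
    refine le_antisymm le_sup_left (Subgroup.relIndex_eq_one.1 ?_)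
    rw [h2] at h4
    have : 0 < (relSub (lvl e M) (lvl e (q * M))).index := by
      rw [index_relSub]; exact q.pos
    exact Nat.eq_of_mul_eq_mul_right this (by rw [h4, one_mul])
  rw [eq_comm, sup_eq_left] at h3
  rw [← lvl_le_lvl e]
  intro x hx
  exact h3 (x := ⟨x, (lvl_le_lvl e).2 hMN hx⟩) hx

open Classical in
theorem mark_t (M k N : ℕ+) (hMN : M ∣ N) :
    mark (lvl e N : Subgroup G) (t e M k) = if k * M ∣ N then ((k : ℕ) : ℤ) else 0 := by
  have h1 : (lvl e N : Subgroup G) ⊓ (lvl e M : Subgroup G) ≤ lvl e (k * M) ↔ k * M ∣ N := by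
    rw [← lvl_le_lvl e]
    exact ⟨fun h x hx => h ⟨hx, (lvl_le_lvl e).2 hMN hx⟩, fun h x hx => h hx.1⟩
  rw [t, mark_orbit, index_relSub]
  simp only [h1]

theorem ext_marks_lvl {M : ℕ+} {x y : BurnsideRing (lvl e M)}
    (h : ∀ N : ℕ+, M ∣ N → mark (lvl e N : Subgroup G) x = mark (lvl e N : Subgroup G) y) :
    x = y := by
  refine ext_marks fun U hU => ?_
  obtain ⟨N, rfl⟩ := exists_eq_lvl e U
  exact h N ((lvl_le_lvl e).1 hU)

theorem mem_of_t_mem {M : ℕ+} (S : AddSubgroup (BurnsideRing (lvl e M)))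
    (hS : ∀ k : ℕ+, t e M k ∈ S) (x : BurnsideRing (lvl e M)) : x ∈ S := by
  refine mem_of_orbit_mem S (fun L hL => ?_) x
  obtain ⟨N, rfl⟩ := exists_eq_lvl e L
  obtain ⟨k, rfl⟩ := (lvl_le_lvl e).1 hL
  have := hS k
  rw [t, mul_comm k M] at this
  exact this

end Generator

/-! ### Marks at the levels M Ẑ, and descent of the generators along the norm. -/

section Marks

variable {G : Type u} [CommGroup G] [TopologicalSpace G] [IsTopologicalGroup G] [CompactSpace G]
  (e : G ≃ₜ* ZHat)

open BurnsideRing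

theorem BurnsideRing.mark_inf {H : OpenSubgroup G} (U : Subgroup G) (x : BurnsideRing H) :
    mark (U ⊓ H) x = mark U x := by
  refine DFunLike.congr_fun (f := (mark (U ⊓ (H : Subgroup G)) : BurnsideRing H →+* ℤ).toAddMonoidHom)
    (g := (mark U).toAddMonoidHom) (GrothendieckRing.hom_ext fun a => ?_) x
  induction a using BurnsideSemiring.ind with | h X
  change mark (U ⊓ (H : Subgroup G)) (cls X) = mark U (cls X)
  rw [mark_cls, mark_cls]
  refine congrArg Nat.cast (Nat.card_congr (Equiv.subtypeEquivRight fun x => ?_))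
  exact ⟨fun h b hb => h b ⟨hb, b.2⟩, fun h b hb => h b hb.1⟩

theorem lvl_inf_of_dvd {M N : ℕ+} (h : M ∣ N) :
    (lvl e N : Subgroup G) ⊓ (lvl e M : Subgroup G) = lvl e N :=
  inf_eq_left.2 ((lvl_le_lvl e).2 h)

/-- If N = M s with s prime to q, then the least common multiple of N and qM is qN. -/
theorem lvl_inf_of_coprime {M N q : ℕ+} (hq : q.Prime) (hMN : M ∣ N) (h : ¬ q * M ∣ N) :
    (lvl e N : Subgroup G) ⊓ (lvl e (q * M) : Subgroup G) = lvl e (q * N) := by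
  have h1 : lvl e N ⊓ lvl e (q * M) = lvl e (q * N) := by
    refine le_antisymm (openSubgroup_le_of_gen e fun k hk => ?_)
      (le_inf ((lvl_le_lvl e).2 (dvd_mul_left _ _)) ((lvl_le_lvl e).2 (mul_dvd_mul_left _ hMN)))
    have h1 := (gen_zpow_mem_lvl e _ _).1 hk.1
    have h2 := (gen_zpow_mem_lvl e _ _).1 hk.2
    rw [gen_zpow_mem_lvl]
    obtain ⟨s, rfl⟩ := hMN
    have hqs : ¬ (q : ℕ) ∣ s := by
      intro hd
      refine h ?_
      rw [mul_comm M s]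
      exact mul_dvd_mul_right (PNat.dvd_iff.2 hd) M
    have hco : IsCoprime ((q : ℕ) : ℤ) ((s : ℕ) : ℤ) :=
      Nat.isCoprime_iff_coprime.2 ((Nat.Prime.coprime_iff_not_dvd hq).2 hqs)
    obtain ⟨j, rfl⟩ := (dvd_mul_right (M : ℤ) s).trans (by simpa using h1)
    have hM : ((M : ℕ) : ℤ) ≠ 0 := by exact_mod_cast M.ne_zero
    simp only [PNat.mul_coe, Nat.cast_mul] at h1 h2 ⊢
    rw [mul_comm ((q : ℕ) : ℤ)] at h2
    rw [Int.mul_dvd_mul_iff_left hM] at h1 h2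
    rw [mul_left_comm, Int.mul_dvd_mul_iff_left hM]
    exact hco.mul_dvd h2 h1
  exact congrArg (fun U : OpenSubgroup G => (U : Subgroup G)) h1

theorem mark_res_lvl {M k N : ℕ+} (h : k * M ∣ N) (x : BurnsideRing (lvl e M)) :
    mark (lvl e N : Subgroup G) (res (lvl_mul_le e k M) x) = mark (lvl e N : Subgroup G) x := by
  rw [mark_res, lvl_inf_of_dvd e h]

theorem mark_tr_of_dvd {M k N : ℕ+} (h : k * M ∣ N) (x : BurnsideRing (lvl e (k * M))) :
    mark (lvl e N : Subgroup G) (tr (lvl_mul_le e k M) x) =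
      ((k : ℕ) : ℤ) * mark (lvl e N : Subgroup G) x := by
  rw [mark_tr, if_pos, index_range_incl]
  exact inf_le_left.trans ((lvl_le_lvl e).2 h)

theorem mark_tr_of_not_dvd {M k N : ℕ+} (hMN : M ∣ N) (h : ¬ k * M ∣ N)
    (x : BurnsideRing (lvl e (k * M))) :
    mark (lvl e N : Subgroup G) (tr (lvl_mul_le e k M) x) = 0 := by
  rw [mark_tr, if_neg]
  rw [lvl_inf_of_dvd e hMN]
  exact fun h' => h ((lvl_le_lvl e).1 h')

theorem mark_norm_of_dvd {M q N : ℕ+} (h : q * M ∣ N) (x : BurnsideRing (lvl e (q * M))) :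
    mark (lvl e N : Subgroup G) (norm (lvl_mul_le e q M) x) =
      mark (lvl e N : Subgroup G) x ^ (q : ℕ) := by
  rw [mark_norm, dblIndex_of_le e M q N h]

theorem mark_norm_of_not_dvd {M q N : ℕ+} (hq : q.Prime) (hMN : M ∣ N) (h : ¬ q * M ∣ N)
    (x : BurnsideRing (lvl e (q * M))) :
    mark (lvl e N : Subgroup G) (norm (lvl_mul_le e q M) x) =
      mark (lvl e (q * N) : Subgroup G) x := by
  rw [mark_norm, dblIndex_of_prime e M q N hq hMN h, pow_one, ← lvl_inf_of_coprime e hq hMN h,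
    mark_inf]

/-- The exponents in `mark_norm` are positive. Hence the correction term N(0) in the definition of a
Tambara ideal disappears, and the norm maps the ideal into itself (`TambaraIdeal.norm_mem'`). -/
theorem norm_zero {L H : OpenSubgroup G} (h : L ≤ H) : norm h 0 = 0 := by
  refine ext_marks fun U _ => ?_
  rw [mark_norm, map_zero, map_zero, zero_pow (dblIndex_pos h _).ne']

theorem TambaraIdeal.norm_mem' (I : TambaraIdeal G) {L H : OpenSubgroup G} (h : L ≤ H)
    {x : BurnsideRing L} (hx : x ∈ I.level L) : norm h x ∈ I.level H := by
  obtain ⟨y, hy, e⟩ := I.norm_mem h hx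
  rwa [e, norm_zero, add_zero]

/-- Descent of ideal membership along a subgroup of prime index, through the norm. -/
theorem TambaraIdeal.mem_of_marks (I : TambaraIdeal G) {M q : ℕ+} (hq : q.Prime)
    {x : BurnsideRing (lvl e M)} {y z : BurnsideRing (lvl e (q * M))}
    (h1 : ∀ N : ℕ+, M ∣ N → ¬ q * M ∣ N →
      mark (lvl e (q * N) : Subgroup G) y = mark (lvl e N : Subgroup G) x)
    (h2 : ∀ N : ℕ+, q * M ∣ N → mark (lvl e N : Subgroup G) y ^ (q : ℕ) =
      mark (lvl e N : Subgroup G) x + ((q : ℕ) : ℤ) *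
        (mark (lvl e N : Subgroup G) z * mark (lvl e N : Subgroup G) y))
    (hy : y ∈ I.level (lvl e (q * M))) : x ∈ I.level (lvl e M) := by
  -- At N divisible by qM the norm is a q-th power and the transfer contributes a factor q, which is
  -- `h2`. At the other N the norm reads the mark at qN and the transfer vanishes, which is `h1`.
  have key : norm (lvl_mul_le e q M) y = x + tr (lvl_mul_le e q M) (z * y) := by
    refine ext_marks_lvl e fun N hN => ?_
    rw [map_add]
    by_cases h : q * M ∣ N
    · rw [mark_norm_of_dvd e h, mark_tr_of_dvd e h, map_mul, h2 N h]
    · rw [mark_norm_of_not_dvd e hq hN h, mark_tr_of_not_dvd e hN h, h1 N hN h, add_zero]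
  have e1 : x = norm (lvl_mul_le e q M) y - tr (lvl_mul_le e q M) (z * y) := by
    rw [key, add_sub_cancel_right]
  rw [e1]
  exact sub_mem (I.norm_mem' _ hy) (I.tr_mem _ (Ideal.mul_mem_left _ _ hy))

/-- The element `t_{M, p} - p` of `A(M Ẑ)`. -/
def oddElt (p M : ℕ+) : BurnsideRing (lvl e M) := t e M p - ((p : ℕ) : BurnsideRing (lvl e M))

/-- The element `t_{M, 4} - t_{M, 2} - 2` of `A(M Ẑ)`. -/
def evenElt (M : ℕ+) : BurnsideRing (lvl e M) := t e M 4 - t e M 2 - 2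

open Classical in
theorem mark_oddElt {p M N : ℕ+} (h : M ∣ N) : mark (lvl e N : Subgroup G) (oddElt e p M) =
    (if p * M ∣ N then ((p : ℕ) : ℤ) else 0) - ((p : ℕ) : ℤ) := by
  rw [oddElt, map_sub, mark_t e M p N h, map_natCast]

open Classical in
theorem mark_evenElt {M N : ℕ+} (h : M ∣ N) : mark (lvl e N : Subgroup G) (evenElt e M) =
    (if 4 * M ∣ N then 4 else 0) - (if 2 * M ∣ N then 2 else 0) - 2 := by
  rw [evenElt, map_sub, map_sub, mark_t e M _ N h, mark_t e M _ N h, map_ofNat]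
  rfl

theorem mul_dvd_mul_cancel_left (q a b : ℕ+) : q * a ∣ q * b ↔ a ∣ b := by
  simp only [PNat.dvd_iff, PNat.mul_coe]
  exact Nat.mul_dvd_mul_iff_left q.pos

theorem mul_dvd_iff_of_coprime {k r M N : ℕ+} (hc : Nat.Coprime k r) (h : r * M ∣ N) :
    k * (r * M) ∣ N ↔ k * M ∣ N := by
  obtain ⟨s, rfl⟩ := h
  rw [show k * (r * M) = M * (r * k) by ring, show k * M = M * k by ring,
    show r * M * s = M * (r * s) by ring, mul_dvd_mul_cancel_left, mul_dvd_mul_cancel_left,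
    mul_dvd_mul_cancel_left]
  simp only [PNat.dvd_iff, PNat.mul_coe]
  exact hc.dvd_mul_left.symm

theorem res_t {M r k : ℕ+} (h : Nat.Coprime k r) :
    res (lvl_mul_le e r M) (t e M k) = t e (r * M) k := by
  classical
  refine ext_marks_lvl e fun N hN => ?_
  rw [mark_res_lvl e hN, mark_t e _ _ _ hN, mark_t e _ _ _ ((dvd_mul_left M r).trans hN)]
  simp only [mul_dvd_iff_of_coprime h hN]

theorem tr_t (M k j : ℕ+) : tr (lvl_mul_le e k M) (t e (k * M) j) = t e M (j * k) := by
  classical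
  refine ext_marks_lvl e fun N hN => ?_
  rw [mark_t e _ _ _ hN, mul_assoc]
  by_cases h : k * M ∣ N
  · rw [mark_tr_of_dvd e h, mark_t e _ _ _ h]
    split_ifs
    · rw [PNat.mul_coe, Nat.cast_mul, mul_comm]
    · rw [mul_zero]
  · rw [mark_tr_of_not_dvd e hN h, if_neg fun h' => h ((dvd_mul_left _ _).trans h')]

theorem tr_one (M k : ℕ+) : tr (lvl_mul_le e k M) 1 = t e M k := by
  classical
  refine ext_marks_lvl e fun N hN => ?_
  rw [mark_t e _ _ _ hN]
  by_cases h : k * M ∣ N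
  · rw [mark_tr_of_dvd e h, map_one, mul_one, if_pos h]
  · rw [mark_tr_of_not_dvd e hN h, if_neg h]

theorem t_two_mul_t_two (M : ℕ+) : t e M 2 * t e M 2 = 2 * t e M 2 := by
  classical
  refine ext_marks_lvl e fun N hN => ?_
  rw [map_mul, map_mul, mark_t e _ _ _ hN, map_ofNat]
  split_ifs <;> rfl

theorem t_two_mul_t_four (M : ℕ+) : t e M 2 * t e M 4 = 2 * t e M 4 := by
  classical
  refine ext_marks_lvl e fun N hN => ?_
  rw [map_mul, map_mul, mark_t e _ _ _ hN, mark_t e _ _ _ hN, map_ofNat]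
  by_cases h : 4 * M ∣ N
  · have h2 : 2 * M ∣ N := (mul_dvd_mul_right (show (2 : ℕ+) ∣ 4 from ⟨2, rfl⟩) M).trans h
    rw [if_pos h, if_pos h2]
    rfl
  · rw [if_neg h, mul_zero, mul_zero]

theorem res_oddElt {p M r : ℕ+} (h : Nat.Coprime p r) :
    res (lvl_mul_le e r M) (oddElt e p M) = oddElt e p (r * M) := by
  rw [oddElt, map_sub, res_t e h, map_natCast, oddElt]

theorem res_evenElt {M r : ℕ+} (h : Odd (r : ℕ)) :
    res (lvl_mul_le e r M) (evenElt e M) = evenElt e (r * M) := by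
  have h2 : Nat.Coprime 2 r := (Nat.coprime_two_left).2 h
  have h4 : Nat.Coprime 4 r := Nat.Coprime.pow_left 2 h2
  rw [evenElt, map_sub, map_sub, res_t e (k := 2) h2, res_t e (k := 4) h4, map_ofNat, evenElt]

/-- Fermat's little theorem for -p modulo q. The marks of `oddElt` are 0 and -p, so the integer `a`
serves as the multiplier `z` in `TambaraIdeal.mem_of_marks`. -/
theorem odd_descent_congr {p q : ℕ} (hp : p.Prime) (hq : q.Prime) (hpq : p ≠ q) :
    ∃ a : ℤ, (-p : ℤ) ^ q = -p + q * (a * -p) := by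
  have : Fact q.Prime := ⟨hq⟩
  have h1 : ((-p : ℤ) : ZMod q) ≠ 0 := by
    rw [Ne, ZMod.intCast_zmod_eq_zero_iff_dvd, dvd_neg, Int.natCast_dvd_natCast,
      Nat.prime_dvd_prime_iff_eq hq hp]
    exact fun h => hpq h.symm
  have h2 := ZMod.pow_card_sub_one_eq_one h1
  rw [← Int.cast_pow, ← Int.cast_one, ZMod.intCast_eq_intCast_iff_dvd_sub] at h2
  obtain ⟨a, ha⟩ := h2
  refine ⟨-a, ?_⟩
  have h3 : (-p : ℤ) ^ q = (-p) ^ (q - 1) * (-p) := by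
    rw [← pow_succ, Nat.sub_add_cancel hq.one_lt.le]
  rw [h3, show (-p : ℤ) ^ (q - 1) = 1 - q * a by linarith]
  ring

/-- The marks of `evenElt` are -2, -4 and 0, and a + b t_2 has mark a where the value is -2 and a +
2b where it is -4. Both congruences come from 2^{q-1} = 1 - q a; the integer b exists because (1 - q
a) a inherits the factor 2 of 2^{q-1}. -/
theorem even_descent_congr {q : ℕ} (hq : q.Prime) (hq2 : q ≠ 2) :
    ∃ a b : ℤ, (-2 : ℤ) ^ q = -2 + q * (a * -2) ∧ (-4 : ℤ) ^ q = -4 + q * ((a + b * 2) * -4) := by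
  have : Fact q.Prime := ⟨hq⟩
  have hodd := hq.odd_of_ne_two hq2
  have h1 : ((2 : ℤ) : ZMod q) ≠ 0 := by
    rw [Ne, ZMod.intCast_zmod_eq_zero_iff_dvd]
    intro h
    exact hq2 ((Nat.prime_dvd_prime_iff_eq hq Nat.prime_two).1 (by exact_mod_cast h))
  have h2 := ZMod.pow_card_sub_one_eq_one h1
  rw [← Int.cast_pow, ← Int.cast_one, ZMod.intCast_eq_intCast_iff_dvd_sub] at h2
  obtain ⟨a, ha⟩ := h2
  have h3 : (2 : ℤ) ^ (q - 1) = 1 - q * a := by linarith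
  have hpos : 0 < q - 1 := Nat.sub_pos_of_lt hq.one_lt
  have h4 : (2 : ℤ) ∣ (1 - q * a) * a := by
    rw [← h3]
    exact Dvd.dvd.mul_right (dvd_pow_self _ hpos.ne') a
  obtain ⟨b, hb⟩ := h4
  have hs : ∀ c : ℤ, (-c) ^ q = -(c ^ (q - 1) * c) := by
    intro c
    rw [hodd.neg_pow, ← pow_succ, Nat.sub_add_cancel hq.one_lt.le]
  refine ⟨-a, -b, ?_, ?_⟩
  · rw [hs, h3]; ring
  · rw [hs, show (4 : ℤ) = 2 ^ 2 by norm_num, ← pow_mul, mul_comm 2, pow_mul, h3]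
    linear_combination (4 * (q : ℤ)) * hb

theorem TambaraIdeal.oddElt_mem_of_prime (I : TambaraIdeal G) {p q M : ℕ+} (hp : p.Prime) (hp2 : p ≠ 2)
    (hq : q.Prime) (h : oddElt e p (q * M) ∈ I.level _) : oddElt e p M ∈ I.level _ := by
  classical
  have hp2' : (p : ℕ) ≠ 2 := fun h => hp2 (PNat.coe_injective h)
  have h1 : ∀ N : ℕ+, M ∣ N → ¬ q * M ∣ N → mark (lvl e (q * N) : Subgroup G) (oddElt e p (q * M)) =
      mark (lvl e N : Subgroup G) (oddElt e p M) := by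
    intro N hMN _
    rw [mark_oddElt e hMN, mark_oddElt e (mul_dvd_mul_left q hMN), mul_left_comm p q M]
    simp only [mul_dvd_mul_cancel_left]
  by_cases hpq : p = q
  · subst hpq
    -- At levels divisible by pM the mark of `oddElt e p M` is 0, so z must satisfy (-p)^p = p z
    -- (-p), which gives z = p^{p-2}.
    refine I.mem_of_marks e hp (z := ((-((p : ℕ) : ℤ) ^ ((p : ℕ) - 2) * -1 : ℤ) : BurnsideRing _)) h1 (fun N hN => ?_) h
    have hMN : M ∣ N := (dvd_mul_left M p).trans hN
    rw [mark_oddElt e hMN, mark_oddElt e hN, if_pos hN, map_intCast]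
    split_ifs
    · simp [p.ne_zero]
    · have hodd : Odd (p : ℕ) := Nat.Prime.odd_of_ne_two hp hp2'
      have h2 : 2 ≤ (p : ℕ) := Nat.Prime.two_le hp
      rw [zero_sub, sub_self, hodd.neg_pow]
      nth_rw 2 [← Nat.sub_add_cancel h2]
      rw [pow_add]
      simp
      ring
  · obtain ⟨a, ha⟩ := odd_descent_congr hp hq fun h => hpq (PNat.coe_injective h)
    refine I.mem_of_marks e hq (z := ((a : ℤ) : BurnsideRing _)) h1 (fun N hN => ?_) h
    have hMN : M ∣ N := (dvd_mul_left M q).trans hN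
    have hco : Nat.Coprime p q :=
      (Nat.coprime_primes hp hq).2 fun h => hpq (PNat.coe_injective h)
    rw [mark_oddElt e hMN, mark_oddElt e hN, map_intCast]
    simp only [mul_dvd_iff_of_coprime hco hN]
    split_ifs
    · simp [q.ne_zero]
    · simpa using ha

theorem TambaraIdeal.evenElt_mem_of_prime (I : TambaraIdeal G) {q M : ℕ+}
    (hq : q.Prime) (h : evenElt e (q * M) ∈ I.level _) : evenElt e M ∈ I.level _ := by
  classical
  have h1 : ∀ N : ℕ+, M ∣ N → ¬ q * M ∣ N → mark (lvl e (q * N) : Subgroup G) (evenElt e (q * M)) =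
      mark (lvl e N : Subgroup G) (evenElt e M) := by
    intro N hMN _
    rw [mark_evenElt e hMN, mark_evenElt e (mul_dvd_mul_left q hMN), mul_left_comm _ q M,
      mul_left_comm _ q M]
    simp only [mul_dvd_mul_cancel_left]
  have h24 : ∀ M N : ℕ+, 4 * M ∣ N → 2 * M ∣ N := fun M N h =>
    (mul_dvd_mul_right (show (2 : ℕ+) ∣ 4 from ⟨2, rfl⟩) M).trans h
  by_cases hq2 : q = 2
  · subst hq2
    -- The same z solves both nontrivial cases: 4 = -4 + 2 z (-2) when 4M does not divide N, and 16
    -- = 0 + 2 z (-4) when 4M divides N but 8M does not.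
    refine I.mem_of_marks e hq (z := -2) h1 (fun N hN => ?_) h
    have hMN : M ∣ N := (dvd_mul_left M 2).trans hN
    have e4 : 4 * M = 2 * (2 * M) := by rw [← mul_assoc]; rfl
    rw [mark_evenElt e hMN, mark_evenElt e hN, if_pos hN, map_neg, map_ofNat, e4]
    by_cases h8 : 4 * (2 * M) ∣ N
    · simp [h8, h24 _ _ h8]
    · by_cases h4 : 2 * (2 * M) ∣ N
      · simp [h8, h4]
      · simp [h8, h4]
  · have hq2' : (q : ℕ) ≠ 2 := fun h => hq2 (PNat.coe_injective h)
    obtain ⟨a, b, ha, hb⟩ := even_descent_congr hq hq2'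
    -- The summand b t_2 lets the multiplier take different values at the marks -2 and -4.
    refine I.mem_of_marks e hq (z := (a : BurnsideRing _) + (b : BurnsideRing _) * t e (q * M) 2) h1
      (fun N hN => ?_) h
    have hMN : M ∣ N := (dvd_mul_left M q).trans hN
    have hco2 : Nat.Coprime (2 : ℕ+) q := (Nat.coprime_two_left).2 (Nat.Prime.odd_of_ne_two hq hq2')
    have hco4 : Nat.Coprime (4 : ℕ+) q := Nat.Coprime.pow_left 2 hco2
    rw [mark_evenElt e hMN, mark_evenElt e hN, map_add, map_mul, map_intCast, map_intCast,
      mark_t e _ _ _ hN]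
    simp only [mul_dvd_iff_of_coprime hco2 hN, mul_dvd_iff_of_coprime hco4 hN]
    by_cases h4 : 4 * M ∣ N
    · simp [h4, h24 _ _ h4]
    · by_cases h2 : 2 * M ∣ N
      · simpa [h4, h2] using hb
      · simpa [h4, h2] using ha

theorem pnat_induction_of_prime {P : ℕ+ → Prop} (h1 : P 1) (hm : ∀ q k : ℕ+, q.Prime → P k → P (q * k))
    (k : ℕ+) : P k := by
  have key : ∀ n : ℕ, ∀ hn : 0 < n, P (n.toPNat hn) := by
    intro n
    induction n using induction_on_primes with
    | zero => exact fun hn => (lt_irrefl _ hn).elim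
    | one => exact fun _ => h1
    | prime_mul p a hp ih =>
      intro hn
      have ha : 0 < a := Nat.pos_of_ne_zero fun h => by simp [h] at hn
      exact hm (p.toPNat hp.pos) (a.toPNat ha) hp (ih ha)
  exact key k k.pos

theorem TambaraIdeal.oddElt_mem_of_dvd (I : TambaraIdeal G) {p M N : ℕ+} (hp : p.Prime) (hp2 : p ≠ 2)
    (hMN : M ∣ N) (h : oddElt e p N ∈ I.level _) : oddElt e p M ∈ I.level _ := by
  obtain ⟨k, rfl⟩ := hMN
  rw [mul_comm] at h
  revert h
  induction k using pnat_induction_of_prime with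
  | h1 => rw [one_mul]; exact id
  | hm q k hq ih =>
    intro h
    rw [mul_assoc] at h
    exact ih (I.oddElt_mem_of_prime e hp hp2 hq h)

theorem TambaraIdeal.evenElt_mem_of_dvd (I : TambaraIdeal G) {M N : ℕ+}
    (hMN : M ∣ N) (h : evenElt e N ∈ I.level _) : evenElt e M ∈ I.level _ := by
  obtain ⟨k, rfl⟩ := hMN
  rw [mul_comm] at h
  revert h
  induction k using pnat_induction_of_prime with
  | h1 => rw [one_mul]; exact id
  | hm q k hq ih =>
    intro h
    rw [mul_assoc] at h
    exact ih (I.evenElt_mem_of_prime e hq h)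

end Marks

/-! ### Generated ideals, failure of finite generation, the chain, and normal forms. -/

section Ideals

variable {G : Type u} [CommGroup G] [TopologicalSpace G] [IsTopologicalGroup G] [CompactSpace G]
  (e : G ≃ₜ* ZHat)

open BurnsideRing

namespace TambaraIdeal

theorem span_le {S : Set (Elt G)} {I : TambaraIdeal G} (h : I.Contains S) : span S ≤ I :=
  fun _ _ hx => by
    simp only [span, Submodule.mem_iInf] at hx
    exact hx I h

theorem mem_span {S : Set (Elt G)} {H : OpenSubgroup G} {x : BurnsideRing H}
    (h : (⟨H, x⟩ : Elt G) ∈ S) : x ∈ (span S).level H := by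
  simp only [span, Submodule.mem_iInf]
  exact fun I hI => hI _ h

theorem le_antisymm' {I J : TambaraIdeal G} (h1 : I ≤ J) (h2 : J ≤ I) : I = J :=
  TambaraIdeal.ext (funext fun H => le_antisymm (h1 H) (h2 H))

end TambaraIdeal

theorem BurnsideRing.mark_conj (U : Subgroup G) (H : OpenSubgroup G) (g : G) (x : BurnsideRing H) :
    mark U (conj H g x) = mark U x := by
  refine DFunLike.congr_fun (f := ((mark U).toAddMonoidHom.comp (conj H g).toAddMonoidHom))
    (g := (mark U).toAddMonoidHom) (GrothendieckRing.hom_ext fun a => ?_) x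
  induction a using BurnsideSemiring.ind with | h X
  change mark U (conj H g (GrothendieckRing.of _)) = mark U (cls X)
  rw [conj, GrothendieckRing.map_of]
  change mark U (cls (FinGSet.pullback (conjHom H g) (continuous_conjHom H g) X)) = _
  rw [mark_cls, mark_cls]
  have hco : ∀ b : conjSubgroup H g, ((conjHom H g b : H) : G) = b := by
    intro b
    change g * b * g⁻¹ = b
    rw [mul_comm g, mul_inv_cancel_right]
  refine congrArg Nat.cast (Nat.card_congr (Equiv.subtypeEquivRight fun (x : X.carrier) => ?_))
  constructor
  · intro hx b hb
    have hb' : (b : G) ∈ conjSubgroup H g := by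
      change g * b * g⁻¹ ∈ H
      rw [mul_comm g, mul_inv_cancel_right]
      exact b.2
    have h1 : conjHom H g ⟨b, hb'⟩ = b := Subtype.ext (hco _)
    have h2 : conjHom H g ⟨b, hb'⟩ • x = x := hx ⟨b, hb'⟩ hb
    rwa [h1] at h2
  · intro hx b hb
    exact hx (conjHom H g b) (by rwa [hco])

/-- The elements all of whose marks at subgroups of `D` vanish. -/
def markIdeal (D : Subgroup G) : TambaraIdeal G where
  level H := ⨅ (U : Subgroup G) (_ : U ≤ D), RingHom.ker (mark U : BurnsideRing H →+* ℤ)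
  res_mem h x hx := by
    simp only [Submodule.mem_iInf, RingHom.mem_ker, mark_res] at hx ⊢
    exact fun U hU => hx _ (inf_le_left.trans hU)
  tr_mem h x hx := by
    classical
    simp only [Submodule.mem_iInf, RingHom.mem_ker, mark_tr] at hx ⊢
    intro U hU
    rw [hx U hU, mul_zero, ite_self]
  norm_mem h x hx := by
    refine ⟨norm h x, ?_, by rw [norm_zero, add_zero]⟩
    simp only [Submodule.mem_iInf, RingHom.mem_ker, mark_norm] at hx ⊢
    intro U hU
    rw [hx U hU, zero_pow (dblIndex_pos h U).ne']
  conj_mem H g x hx := by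
    simp only [Submodule.mem_iInf, RingHom.mem_ker, mark_conj] at hx ⊢
    exact hx

theorem mem_markIdeal {D : Subgroup G} {H : OpenSubgroup G} {x : BurnsideRing H} :
    x ∈ (markIdeal D).level H ↔ ∀ U : Subgroup G, U ≤ D → mark U x = 0 := by
  simp [markIdeal, Submodule.mem_iInf, RingHom.mem_ker]

/-- Two finite sets are acted on trivially by a common open subgroup D. At subgroups of D the marks
are cardinalities, so a difference of rank 0 has all these marks equal to 0. -/
theorem exists_mem_markIdeal {H : OpenSubgroup G} {x : BurnsideRing H}
    (hx : x ∈ (markIdeal ⊥).level H) :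
    ∃ D : OpenSubgroup G, x ∈ (markIdeal (D : Subgroup G)).level H := by
  have hst : ∀ X : FinGSet H, ∃ D : OpenSubgroup G, ∀ U : Subgroup G, U ≤ D →
      mark U (cls X) = (Nat.card X.carrier : ℤ) := by
    intro X
    have hop : IsOpen ((⨅ x : X.carrier, (X.openStab x : Subgroup G) : Subgroup G) : Set G) := by
      rw [Subgroup.coe_iInf]
      exact isOpen_iInter_of_finite fun x => (X.openStab x).isOpen
    refine ⟨⟨_, hop⟩, fun U hU => mark_eq_card U X fun b hb x => ?_⟩
    exact (X.mem_openStab x b).1 ((Subgroup.mem_iInf.1 (hU hb)) x)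
  obtain ⟨a, b, rfl⟩ := GrothendieckRing.exists_eq_sub x
  induction a using BurnsideSemiring.ind with | h X
  induction b using BurnsideSemiring.ind with | h Y
  obtain ⟨D, hD⟩ := hst X
  obtain ⟨D', hD'⟩ := hst Y
  refine ⟨D ⊓ D', mem_markIdeal.2 fun U hU => ?_⟩
  have h0 := mem_markIdeal.1 hx ⊥ le_rfl
  change mark U (cls X - cls Y) = 0
  change mark ⊥ (cls X - cls Y) = 0 at h0
  rw [map_sub, hD U (hU.trans inf_le_left), hD' U (hU.trans inf_le_right)]
  rw [map_sub, mark_bot, mark_bot] at h0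
  exact h0

theorem markIdeal_antitone {D D' : Subgroup G} (h : D ≤ D') : markIdeal D' ≤ markIdeal D :=
  fun _ _ hx => mem_markIdeal.2 fun U hU => mem_markIdeal.1 hx U (hU.trans h)

theorem exists_contains_markIdeal {S : Set (TambaraIdeal.Elt G)} (hS : S.Finite)
    (h : (markIdeal (⊥ : Subgroup G)).Contains S) :
    ∃ D : OpenSubgroup G, (markIdeal (D : Subgroup G)).Contains S := by
  induction S, hS using Set.Finite.induction_on with
  | empty => exact ⟨⊤, fun a ha => ha.elim⟩
  | @insert a S _ _ ih =>
    obtain ⟨D, hD⟩ := ih fun b hb => h b (Set.mem_insert_of_mem _ hb)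
    obtain ⟨D', hD'⟩ := exists_mem_markIdeal (h a (Set.mem_insert _ _))
    refine ⟨D ⊓ D', ?_⟩
    rintro b (rfl | hb)
    · exact markIdeal_antitone inf_le_right _ hD'
    · exact markIdeal_antitone inf_le_left _ (hD b hb)

theorem pnat_eq_mul_pow {p : ℕ+} (hp : p.Prime) (M : ℕ+) :
    ∃ (n : ℕ) (r : ℕ+), M = r * p ^ n ∧ Nat.Coprime p r := by
  obtain ⟨n, r, hr, hM⟩ := Nat.exists_eq_pow_mul_and_not_dvd M.ne_zero p (Nat.Prime.ne_one hp)
  have hr0 : 0 < r := Nat.pos_of_ne_zero fun h => hr (h ▸ dvd_zero _)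
  refine ⟨n, r.toPNat hr0, PNat.coe_injective ?_, (Nat.Prime.coprime_iff_not_dvd hp).2 hr⟩
  rw [hM, PNat.mul_coe, PNat.pow_coe, mul_comm]
  rfl

/-- Write M = r p^n with r prime to p. The element at level M is then the restriction of the
generator at level p^n; this is why prime power levels suffice. -/
theorem oddElt_mem_of_generators {I : TambaraIdeal G} (hI : I.Contains (generators e)) {p : ℕ+}
    (hp : p.Prime) (hp2 : p ≠ 2) (M : ℕ+) : oddElt e p M ∈ I.level (lvl e M) := by
  obtain ⟨n, r, rfl, hr⟩ := pnat_eq_mul_pow hp M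
  rw [← res_oddElt e hr]
  exact I.res_mem _ (hI ⟨lvl e (p ^ n), _⟩ (Or.inr ⟨p, n, hp, hp2, rfl⟩))

theorem evenElt_mem_of_generators {I : TambaraIdeal G} (hI : I.Contains (generators e))
    (M : ℕ+) : evenElt e M ∈ I.level (lvl e M) := by
  obtain ⟨n, r, rfl, hr⟩ := pnat_eq_mul_pow (p := 2) Nat.prime_two M
  rw [← res_evenElt e ((Nat.coprime_two_left).1 hr)]
  exact I.res_mem _ (hI ⟨lvl e (2 ^ n), _⟩ (Or.inl ⟨n, rfl⟩))

theorem contains_generators {I : TambaraIdeal G}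
    (h1 : ∀ p M : ℕ+, p.Prime → p ≠ 2 → oddElt e p M ∈ I.level (lvl e M))
    (h2 : ∀ M : ℕ+, evenElt e M ∈ I.level (lvl e M)) : I.Contains (generators e) := by
  rintro a (⟨n, rfl⟩ | ⟨p, n, hp, hp2, rfl⟩)
  · exact h2 _
  · exact h1 p _ hp hp2

theorem contains_generators_markIdeal_bot : (markIdeal (⊥ : Subgroup G)).Contains (generators e) := by
  classical
  have key : ∀ {M k : ℕ+}, mark (⊥ : Subgroup G) (t e M k) = ((k : ℕ) : ℤ) := by
    intro M k
    rw [t, mark_orbit, if_pos (by simp), index_relSub]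
  refine contains_generators e (fun p M hp hp2 => mem_markIdeal.2 fun U hU => ?_)
    fun M => mem_markIdeal.2 fun U hU => ?_
  · rw [le_bot_iff.1 hU, oddElt, map_sub, key, map_natCast, sub_self]
  · rw [le_bot_iff.1 hU, evenElt, map_sub, map_sub, key, key, map_ofNat]
    rfl

/-- Every generator has rank 0, so a finite generating set would lie in `markIdeal D` for a single
open D = N Ẑ. Some generator at the prime 3 has a nonzero mark at N. -/
theorem not_isFinitelyGenerated :
    ¬ (TambaraIdeal.span (generators e)).IsFinitelyGenerated := by
  classical
  rintro ⟨S, hS, hspan⟩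
  have h1 : (markIdeal (⊥ : Subgroup G)).Contains S := by
    intro a ha
    refine TambaraIdeal.span_le (contains_generators_markIdeal_bot e) _ ?_
    rw [hspan]
    exact TambaraIdeal.mem_span ha
  obtain ⟨D, hD⟩ := exists_contains_markIdeal hS h1
  obtain ⟨N, rfl⟩ := exists_eq_lvl e D
  -- Let 3^n be the exact power of 3 in N. Then N is divisible by 3^n but not by 3^{n+1}, so
  -- t_{3^n,3} - 3 has mark -3 at N.
  obtain ⟨n, r, rfl, hr⟩ := pnat_eq_mul_pow (p := 3) Nat.prime_three N
  have h2 : oddElt e 3 (3 ^ n) ∈ (TambaraIdeal.span (generators e)).level _ :=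
    TambaraIdeal.mem_span (Or.inr ⟨3, n, Nat.prime_three, by decide, rfl⟩)
  rw [hspan] at h2
  have h3 := mem_markIdeal.1 (TambaraIdeal.span_le hD _ h2) _ le_rfl
  rw [mark_oddElt e (dvd_mul_left _ _), if_neg] at h3
  · exact absurd h3 (by decide)
  · rw [mul_comm 3, mul_comm r, mul_dvd_mul_cancel_left, PNat.dvd_iff]
    exact (Nat.Prime.coprime_iff_not_dvd Nat.prime_three).1 hr

/-! ### The ascending chain -/

/-- On a subgroup of index divisible by `p` the set M Ẑ / pM Ẑ becomes `p` fixed points. -/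
theorem res_oddElt_of_dvd {p r M : ℕ+} (h : p ∣ r) :
    res (lvl_mul_le e r M) (oddElt e p M) = 0 := by
  classical
  refine ext_marks_lvl e fun N hN => ?_
  rw [mark_res_lvl e hN, mark_oddElt e ((dvd_mul_left M r).trans hN),
    if_pos ((mul_dvd_mul_right h M).trans hN), sub_self, map_zero]

theorem res_evenElt_of_dvd {r M : ℕ+} (h : 4 ∣ r) :
    res (lvl_mul_le e r M) (evenElt e M) = 0 := by
  classical
  refine ext_marks_lvl e fun N hN => ?_
  rw [mark_res_lvl e hN, mark_evenElt e ((dvd_mul_left M r).trans hN),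
    if_pos ((mul_dvd_mul_right h M).trans hN),
    if_pos ((mul_dvd_mul_right ((show (2 : ℕ+) ∣ 4 from ⟨2, rfl⟩).trans h) M).trans hN), map_zero]
  rfl

open Classical in
/-- The odd primes less than `n`. -/
def oddPrimes (n : ℕ+) : Finset ℕ+ := (Finset.Iio n).filter (fun p => p.Prime ∧ p ≠ 2)

theorem mem_oddPrimes {n p : ℕ+} : p ∈ oddPrimes n ↔ p < n ∧ p.Prime ∧ p ≠ 2 := by
  simp [oddPrimes]

theorem chainElt_eq (n : ℕ+) :
    chainElt e n = evenElt e (fact n) + ∑ p ∈ oddPrimes n, oddElt e p (fact n) := rfl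

theorem coprime_prod {p : ℕ} {s : Finset ℕ+} (h : ∀ q ∈ s, Nat.Coprime p q) :
    Nat.Coprime p ((∏ q ∈ s, q : ℕ+) : ℕ) := by
  have h1 : ((∏ q ∈ s, q : ℕ+) : ℕ) = ∏ q ∈ s, (q : ℕ) := map_prod PNat.coeMonoidHom _ _
  rw [h1]
  exact Nat.Coprime.prod_right h

/-- Restriction along the product of the odd primes below `n` kills every odd summand and keeps the
even one, because this product is odd. Descent then returns to level n!. -/
theorem evenElt_mem_of_chainElt {I : TambaraIdeal G} {n : ℕ+} (h : chainElt e n ∈ I.level _) :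
    evenElt e (fact n) ∈ I.level _ := by
  have hodd : Odd ((∏ q ∈ oddPrimes n, q : ℕ+) : ℕ) := by
    rw [← Nat.coprime_two_left]
    refine coprime_prod fun q hq => ?_
    have := mem_oddPrimes.1 hq
    exact (Nat.coprime_primes Nat.prime_two this.2.1).2 fun h => this.2.2 (PNat.coe_injective h.symm)
  refine I.evenElt_mem_of_dvd e (dvd_mul_left (fact n) (∏ q ∈ oddPrimes n, q)) ?_
  have h1 := I.res_mem (lvl_mul_le e (∏ q ∈ oddPrimes n, q) (fact n)) h
  rwa [chainElt_eq, map_add, map_sum, res_evenElt e hodd, Finset.sum_eq_zero, add_zero] at h1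
  exact fun q hq => res_oddElt_of_dvd e (Finset.dvd_prod_of_mem _ hq)

theorem oddElt_mem_of_chainElt {I : TambaraIdeal G} {n p : ℕ+} (hp : p ∈ oddPrimes n)
    (h : chainElt e n ∈ I.level _) : oddElt e p (fact n) ∈ I.level _ := by
  obtain ⟨-, hp1, hp2⟩ := mem_oddPrimes.1 hp
  have hp2' : Nat.Coprime p (2 : ℕ) :=
    (Nat.coprime_primes hp1 Nat.prime_two).2 fun h => hp2 (PNat.coe_injective h)
  -- The factor 4 kills the even summand and each prime other than p kills its own summand, while r
  -- stays prime to p.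
  let r : ℕ+ := 4 * ∏ q ∈ (oddPrimes n).erase p, q
  have hco : Nat.Coprime p r := by
    refine Nat.Coprime.mul_right (Nat.Coprime.pow_right 2 hp2') (coprime_prod fun q hq => ?_)
    obtain ⟨hqp, hq⟩ := Finset.mem_erase.1 hq
    exact (Nat.coprime_primes hp1 (mem_oddPrimes.1 hq).2.1).2 fun h => hqp (PNat.coe_injective h.symm)
  refine I.oddElt_mem_of_dvd e hp1 hp2 (dvd_mul_left (fact n) r) ?_
  have h1 := I.res_mem (lvl_mul_le e r (fact n)) h
  rwa [chainElt_eq, map_add, map_sum, res_evenElt_of_dvd e (dvd_mul_right 4 _), zero_add,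
    Finset.sum_eq_single_of_mem p hp, res_oddElt e hco] at h1
  exact fun q hq hqp => res_oddElt_of_dvd e
    ((Finset.dvd_prod_of_mem (fun q => q) (Finset.mem_erase.2 ⟨hqp, hq⟩)).trans (dvd_mul_left _ 4))

theorem evenElt_mem_chainIdeal {n M : ℕ+} (h : M ∣ fact n) :
    evenElt e M ∈ (chainIdeal e n).level _ :=
  TambaraIdeal.evenElt_mem_of_dvd e _ h
    (evenElt_mem_of_chainElt e (TambaraIdeal.mem_span (Set.mem_singleton _)))

theorem oddElt_mem_chainIdeal {n M p : ℕ+} (hp : p.Prime) (hp2 : p ≠ 2) (hpn : p < n) (h : M ∣ fact n) :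
    oddElt e p M ∈ (chainIdeal e n).level _ :=
  TambaraIdeal.oddElt_mem_of_dvd e _ hp hp2 h
    (oddElt_mem_of_chainElt e (mem_oddPrimes.2 ⟨hpn, hp, hp2⟩)
      (TambaraIdeal.mem_span (Set.mem_singleton _)))

theorem chainIdeal_le {n : ℕ+} {I : TambaraIdeal G}
    (h1 : ∀ p : ℕ+, p < n → p.Prime → p ≠ 2 → oddElt e p (fact n) ∈ I.level _)
    (h2 : evenElt e (fact n) ∈ I.level _) : chainIdeal e n ≤ I := by
  refine TambaraIdeal.span_le ?_
  rintro a rfl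
  change chainElt e n ∈ _
  rw [chainElt_eq]
  refine add_mem h2 (sum_mem fun p hp => ?_)
  obtain ⟨h3, h4, h5⟩ := mem_oddPrimes.1 hp
  exact h1 p h3 h4 h5

theorem fact_dvd_fact {n m : ℕ+} (h : n ≤ m) : fact n ∣ fact m :=
  PNat.dvd_iff.2 (Nat.factorial_dvd_factorial h)

theorem chainIdeal_mono {n m : ℕ+} (h : n ≤ m) : chainIdeal e n ≤ chainIdeal e m :=
  chainIdeal_le e (fun _ hpn hp hp2 => oddElt_mem_chainIdeal e hp hp2 (hpn.trans_le h) (fact_dvd_fact h))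
    (evenElt_mem_chainIdeal e (fact_dvd_fact h))

/-- The union of the ascending chain. -/
def chainUnion : TambaraIdeal G where
  level H :=
    { carrier := {x | ∃ n : ℕ+, 4 ≤ n ∧ x ∈ (chainIdeal e n).level H}
      zero_mem' := ⟨4, le_rfl, zero_mem _⟩
      add_mem' := by
        rintro x y ⟨n, hn, hx⟩ ⟨m, hm, hy⟩
        exact ⟨max n m, le_max_of_le_left hn, add_mem (chainIdeal_mono e (le_max_left n m) H hx)
          (chainIdeal_mono e (le_max_right n m) H hy)⟩
      smul_mem' := by
        rintro c x ⟨n, hn, hx⟩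
        exact ⟨n, hn, Ideal.mul_mem_left _ c hx⟩ }
  res_mem := by
    rintro L H h x ⟨n, hn, hx⟩
    exact ⟨n, hn, (chainIdeal e n).res_mem h hx⟩
  tr_mem := by
    rintro L H h x ⟨n, hn, hx⟩
    exact ⟨n, hn, (chainIdeal e n).tr_mem h hx⟩
  norm_mem := by
    rintro L H h x ⟨n, hn, hx⟩
    obtain ⟨y, hy, hxy⟩ := (chainIdeal e n).norm_mem h hx
    exact ⟨y, ⟨n, hn, hy⟩, hxy⟩
  conj_mem := by
    rintro H g x ⟨n, hn, hx⟩
    exact ⟨n, hn, (chainIdeal e n).conj_mem H g hx⟩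

theorem mem_chainUnion {H : OpenSubgroup G} {x : BurnsideRing H} :
    x ∈ (chainUnion e).level H ↔ ∃ n : ℕ+, 4 ≤ n ∧ x ∈ (chainIdeal e n).level H := Iff.rfl

theorem span_generators_eq_chainUnion : TambaraIdeal.span (generators e) = chainUnion e := by
  refine TambaraIdeal.le_antisymm' (TambaraIdeal.span_le (contains_generators e ?_ ?_)) ?_
  · intro p M hp hp2
    -- At this stage p < n and M ≤ n, so p occurs in the sum and M divides n!; descent from level n!
    -- then reaches level M.
    refine ⟨max 4 (p + M), le_max_left _ _, oddElt_mem_chainIdeal e hp hp2 ?_ ?_⟩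
    · exact lt_max_of_lt_right (PNat.lt_add_right p M)
    · refine PNat.dvd_iff.2 (Nat.dvd_factorial M.pos ?_)
      exact le_max_of_le_right (PNat.lt_add_left M p).le
  · intro M
    refine ⟨max 4 M, le_max_left _ _, evenElt_mem_chainIdeal e ?_⟩
    exact PNat.dvd_iff.2 (Nat.dvd_factorial M.pos (le_max_right (4 : ℕ+) M))
  · rintro H x ⟨n, -, hx⟩
    have hc : (TambaraIdeal.span (generators e)).Contains (generators e) := fun a ha =>
      TambaraIdeal.mem_span ha
    exact chainIdeal_le e (fun p _ hp hp2 => oddElt_mem_of_generators e hc hp hp2 _)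
      (evenElt_mem_of_generators e hc _) H hx

/-! ### A normal form modulo the generators -/

/-- An additive subgroup of `A(M Ẑ)` that contains the transfers of the generators. -/
structure IsLarge {M : ℕ+} (S : AddSubgroup (BurnsideRing (lvl e M))) : Prop where
  odd : ∀ p k : ℕ+, p.Prime → p ≠ 2 → tr (lvl_mul_le e k M) (oddElt e p (k * M)) ∈ S
  even : ∀ k : ℕ+, tr (lvl_mul_le e k M) (evenElt e (k * M)) ∈ S
  two : 2 * t e M 2 - 4 ∈ S

theorem tr_natCast (M k : ℕ+) (n : ℕ) : tr (lvl_mul_le e k M) (n : BurnsideRing (lvl e (k * M))) =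
    n • t e M k := by
  rw [← nsmul_one, map_nsmul, tr_one]

theorem tr_oddElt (p k M : ℕ+) : tr (lvl_mul_le e k M) (oddElt e p (k * M)) =
    t e M (p * k) - (p : ℕ) • t e M k := by
  rw [oddElt, map_sub, tr_t, tr_natCast]

theorem tr_evenElt (k M : ℕ+) : tr (lvl_mul_le e k M) (evenElt e (k * M)) =
    t e M (4 * k) - t e M (2 * k) - 2 • t e M k := by
  rw [evenElt, map_sub, map_sub, tr_t, tr_t, ← tr_natCast, Nat.cast_ofNat]

theorem t_one (M : ℕ+) : t e M 1 = 1 := by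
  classical
  refine ext_marks_lvl e fun N hN => ?_
  rw [mark_t e _ _ _ hN, one_mul, if_pos hN, map_one]
  rfl

/-- The relations t_{pk} = p t_k for odd primes p and t_{4k} = t_{2k} + 2 t_k reduce every t_k to 1
and t_2, by strong induction on k. Only additive closure is required, so the lemma applies to
subgroups not known to be ideals, such as the Dress kernel. -/
theorem IsLarge.normal_form {M : ℕ+} {S : AddSubgroup (BurnsideRing (lvl e M))} (hS : IsLarge e S)
    (x : BurnsideRing (lvl e M)) :
    ∃ n m : ℤ, (m = 0 ∨ m = 1) ∧ x - (n • (1 : BurnsideRing (lvl e M)) + m • t e M 2) ∈ S := by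
  let T : AddSubgroup (BurnsideRing (lvl e M)) :=
    S ⊔ (AddSubgroup.zmultiples 1 ⊔ AddSubgroup.zmultiples (t e M 2))
  have hST : S ≤ T := le_sup_left
  have h1T : (1 : BurnsideRing (lvl e M)) ∈ T :=
    le_sup_right (a := S) (le_sup_left (a := AddSubgroup.zmultiples (1 : BurnsideRing (lvl e M)))
      (AddSubgroup.mem_zmultiples _))
  have h2T : t e M 2 ∈ T :=
    le_sup_right (a := S) (le_sup_right (b := AddSubgroup.zmultiples (t e M 2))
      (AddSubgroup.mem_zmultiples _))
  have hT : ∀ k : ℕ+, t e M k ∈ T := by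
    intro k
    induction k using PNat.strongInductionOn with
    | _ k ih =>
    by_cases hodd : ∃ p : ℕ+, p.Prime ∧ p ≠ 2 ∧ p ∣ k
    · obtain ⟨p, hp, hp2, j, rfl⟩ := hodd
      have h3 := hST (hS.odd p j hp hp2)
      rw [tr_oddElt] at h3
      have hj : (j : ℕ) < p * j := lt_mul_of_one_lt_left j.pos (Nat.Prime.one_lt hp)
      have h4 := add_mem h3 (nsmul_mem (ih j hj) (p : ℕ))
      rwa [sub_add_cancel] at h4
    · by_cases h4 : 4 ∣ k
      · obtain ⟨j, rfl⟩ := h4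
        have h3 := hST (hS.even j)
        rw [tr_evenElt] at h3
        have hj : (j : ℕ) < 4 * j := by have := j.pos; omega
        have h2j : (2 * j : ℕ) < 4 * j := by have := j.pos; omega
        have h5 := add_mem (add_mem h3 (nsmul_mem (ih j hj) 2)) (ih (2 * j) h2j)
        rwa [sub_add_cancel, sub_add_cancel] at h5
      -- Without odd prime factors and without the factor 4, only 1 and 2 remain.
      · have hk : k = 1 ∨ k = 2 := by
          obtain ⟨i, h5⟩ : ∃ i, (k : ℕ) = 2 ^ i := by
            refine ⟨_, Nat.eq_prime_pow_of_unique_prime_dvd k.ne_zero ?_⟩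
            intro d hd hdk
            by_contra h6
            exact hodd ⟨d.toPNat hd.pos, hd, fun h => h6 (congrArg PNat.val h), PNat.dvd_iff.2 hdk⟩
          have h6 : i < 2 := by
            by_contra h7
            refine h4 (PNat.dvd_iff.2 ?_)
            rw [h5]
            exact pow_dvd_pow 2 (not_lt.1 h7)
          interval_cases i
          · exact Or.inl (PNat.coe_injective h5)
          · exact Or.inr (PNat.coe_injective h5)
        rcases hk with rfl | rfl
        · rw [t_one]
          exact h1T
        · exact h2T
  have hx := mem_of_t_mem e T hT x
  obtain ⟨s, hs, y, hy, rfl⟩ := AddSubgroup.mem_sup.1 hx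
  obtain ⟨y1, ⟨n, rfl⟩, y2, ⟨m, rfl⟩, rfl⟩ := AddSubgroup.mem_sup.1 hy
  -- The relation 2 t_2 = 4 makes the coefficient of t_2 matter only modulo 2, with each pair of
  -- copies of t_2 replaced by 4.
  refine ⟨n + 4 * (m / 2), m % 2, Int.emod_two_eq_zero_or_one m, ?_⟩
  have h3 : s + (n • (1 : BurnsideRing (lvl e M)) + m • t e M 2) -
      ((n + 4 * (m / 2)) • (1 : BurnsideRing (lvl e M)) + (m % 2) • t e M 2) =
      s + (m / 2) • (2 * t e M 2 - 4) := by
    have h4 : m • t e M 2 = (2 * (m / 2) + m % 2) • t e M 2 := by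
      rw [Int.mul_ediv_add_emod]
    rw [h4]
    simp only [zsmul_eq_mul, Int.cast_add, Int.cast_mul, Int.cast_ofNat]
    ring
  change s + (n • (1 : BurnsideRing (lvl e M)) + m • t e M 2) - _ ∈ S
  rw [h3]
  exact add_mem hs (zsmul_mem hS.two _)

theorem isLarge_of_contains_generators {I : TambaraIdeal G} (hI : I.Contains (generators e)) (M : ℕ+) :
    IsLarge e (I.level (lvl e M)).toAddSubgroup where
  odd p k hp hp2 := I.tr_mem _ (oddElt_mem_of_generators e hI hp hp2 _)
  even k := I.tr_mem _ (evenElt_mem_of_generators e hI _)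
  two := by
    have h := evenElt_mem_of_generators e hI M
    have h1 := Ideal.mul_mem_left _ (2 - t e M 2) h
    -- The products t_2 t_2 = 2 t_2 and t_2 t_4 = 2 t_4 show that multiplication by 2 - t_2
    -- eliminates t_4.
    have h2 : (2 - t e M 2) * evenElt e M = 2 * t e M 2 - 4 := by
      have h3 := t_two_mul_t_two e M
      have h4 := t_two_mul_t_four e M
      rw [evenElt]
      linear_combination h3 - h4
    rw [h2] at h1
    exact h1

end Ideals

/-! ## Signs -/

open Classical in
/-- The sign of a permutation of a finite type. -/
def psign {α : Type*} [Finite α] : Equiv.Perm α →* ℤˣ :=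
  letI := Fintype.ofFinite α
  Equiv.Perm.sign

theorem psign_eq {α : Type*} [Fintype α] [DecidableEq α] (σ : Equiv.Perm α) :
    psign σ = Equiv.Perm.sign σ := by
  unfold psign
  convert rfl

theorem psign_permCongr {α β : Type*} [Finite α] [Finite β] (e : α ≃ β) (σ : Equiv.Perm α) :
    psign (e.permCongr σ) = psign σ := by
  classical
  let _ := Fintype.ofFinite α
  let _ := Fintype.ofFinite β
  rw [psign_eq, psign_eq, Equiv.Perm.sign_permCongr]

theorem psign_of_equiv {α β : Type*} [Finite α] [Finite β] (e : α ≃ β) {σ : Equiv.Perm α}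
    {τ : Equiv.Perm β} (h : ∀ a, e (σ a) = τ (e a)) : psign σ = psign τ := by
  rw [← psign_permCongr e σ]
  congr 1
  ext b
  rw [Equiv.permCongr_apply, h, e.apply_symm_apply]

/-- The sign is the only surjective homomorphism from a finite symmetric group to {1, -1}, so every
homomorphism to that group depends on the sign alone. -/
theorem hom_eq_one_of_psign {α : Type*} [Finite α] (Ψ : Equiv.Perm α →* ℤˣ) {σ : Equiv.Perm α}
    (h : psign σ = 1) : Ψ σ = 1 := by
  classical
  let _ := Fintype.ofFinite α
  by_contra h1
  have h2 : Ψ σ = -1 := (Int.units_eq_one_or _).resolve_left h1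
  have h3 : Function.Surjective Ψ := by
    intro u
    rcases Int.units_eq_one_or u with rfl | rfl
    · exact ⟨1, map_one Ψ⟩
    · exact ⟨σ, h2⟩
  rw [Equiv.Perm.eq_sign_of_surjective_hom h3, ← psign_eq] at h1
  exact h1 h

theorem hom_eq_of_psign {α : Type*} [Finite α] (Ψ : Equiv.Perm α →* ℤˣ) {σ τ : Equiv.Perm α}
    (h : psign σ = psign τ) : Ψ σ = Ψ τ := by
  have h1 := hom_eq_one_of_psign Ψ (σ := σ * τ⁻¹) (by rw [map_mul, map_inv, h, mul_inv_cancel])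
  rwa [map_mul, map_inv, mul_inv_eq_one] at h1

theorem psign_prodCongr {α β : Type*} [Finite α] [Finite β] (σ : Equiv.Perm α) (τ : Equiv.Perm β) :
    psign (Equiv.prodCongr σ τ) = psign σ ^ Nat.card β * psign τ ^ Nat.card α := by
  classical
  let _ := Fintype.ofFinite α
  let _ := Fintype.ofFinite β
  have h1 : (Equiv.prodCongr σ τ : Equiv.Perm (α × β)) =
      Equiv.prodCongrLeft (fun _ : β => σ) * Equiv.prodCongrRight (fun _ : α => τ) := by
    ext ⟨a, b⟩ <;> rfl
  rw [h1, map_mul, psign_eq, psign_eq, psign_eq, psign_eq, Equiv.Perm.sign_prodCongrLeft,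
    Equiv.Perm.sign_prodCongrRight]
  simp

theorem psign_sumCongr {α β : Type*} [Finite α] [Finite β] (σ : Equiv.Perm α) (τ : Equiv.Perm β) :
    psign (Equiv.sumCongr σ τ) = psign σ * psign τ := by
  classical
  let _ := Fintype.ofFinite α
  let _ := Fintype.ofFinite β
  rw [psign_eq, psign_eq, psign_eq]
  exact Equiv.Perm.sign_sumCongr σ τ

/-- The action of a permutation on the first coordinate of a family. -/
def actZero (n : ℕ) (α : Type*) : Equiv.Perm α →* Equiv.Perm (Fin (n + 1) → α) where
  toFun σ := Equiv.piCongrRight (Pi.mulSingle 0 σ)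
  map_one' := by
    ext f i
    simp
  map_mul' σ τ := by
    ext f i
    rw [Pi.mulSingle_mul]
    rfl

/-- Cyclic rotation of the coordinates of a family. -/
def rot (n : ℕ) (α : Type*) : Equiv.Perm (Fin (n + 1) → α) :=
  Equiv.arrowCongr (finRotate (n + 1)).symm (Equiv.refl α)

theorem rot_actZero_apply {n : ℕ} {α : Type*} (σ : Equiv.Perm α) (f : Fin (n + 1) → α) (i : Fin (n + 1)) :
    rot n α (actZero n α σ f) i = (Pi.mulSingle 0 σ : Fin (n + 1) → Equiv.Perm α)
      (finRotate (n + 1) i) (f (finRotate (n + 1) i)) := rfl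

/-- The sign of the action on one coordinate is a homomorphism in the permutation, hence a function
of its sign (`hom_eq_of_psign`). The rotation depends only on the underlying set, so a bijection
transports the whole permutation from α to β. -/
theorem psign_rot_actZero_congr {n : ℕ} {α β : Type*} [Finite α] [Finite β] (e : α ≃ β)
    {σ : Equiv.Perm α} {τ : Equiv.Perm β} (h : psign σ = psign τ) :
    psign (rot n α * actZero n α σ) = psign (rot n β * actZero n β τ) := by
  have h1 : psign σ = psign (e.symm.permCongr τ) := by rw [psign_permCongr, h]
  have h2 := hom_eq_of_psign (psign.comp (actZero n α)) h1
  have h3 : psign (rot n α * actZero n α σ) = psign (rot n α * actZero n α (e.symm.permCongr τ)) := by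
    rw [map_mul, map_mul]
    exact congrArg _ h2
  rw [h3]
  refine psign_of_equiv (Equiv.arrowCongr (Equiv.refl _) e) fun f => ?_
  funext i
  simp only [Equiv.Perm.mul_apply, Equiv.arrowCongr_apply, Equiv.coe_refl, Function.comp_apply,
    Equiv.refl_symm, id_eq, rot_actZero_apply]
  generalize finRotate (n + 1) i = j
  rcases eq_or_ne j 0 with rfl | h0
  · simp
  · simp [Pi.mulSingle_eq_of_ne h0]

/-! ### The sign of the topological generator and the ideal it defines. -/

section SignIdeal

variable {G : Type u} [CommGroup G] [TopologicalSpace G] [IsTopologicalGroup G] [CompactSpace G]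
  (e : G ≃ₜ* ZHat)

open BurnsideRing

/-- The positive integer `M` with `H = M Ẑ`. -/
def idx (H : OpenSubgroup G) : ℕ+ := (exists_eq_lvl e H).choose

theorem lvl_idx (H : OpenSubgroup G) : lvl e (idx e H) = H := (exists_eq_lvl e H).choose_spec.symm

theorem idx_lvl (M : ℕ+) : idx e (lvl e M) = M := lvl_injective e (lvl_idx e _)

/-- The topological generator of an open subgroup. -/
def genOf (H : OpenSubgroup G) : H :=
  ⟨gen e ^ (idx e H : ℤ), by
    have h := (gen_zpow_mem_lvl e (idx e H) (idx e H)).2 dvd_rfl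
    rwa [lvl_idx] at h⟩

theorem genOf_lvl (M : ℕ+) : genOf e (lvl e M) = genAt e M :=
  Subtype.ext (by simp only [genOf, genAt, idx_lvl])

theorem incl_genAt (k M : ℕ+) : incl (lvl_mul_le e k M) (genAt e (k * M)) = genAt e M ^ (k : ℕ) := by
  refine Subtype.ext ?_
  change gen e ^ ((k * M : ℕ+) : ℤ) = (gen e ^ (M : ℤ)) ^ (k : ℕ)
  rw [← zpow_natCast, ← zpow_mul, PNat.mul_coe, Nat.cast_mul, mul_comm]

/-- The sign of the topological generator on a finite `H`-set. -/
def FinGSet.sgn {H : OpenSubgroup G} (X : FinGSet H) : ℤˣ :=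
  psign (MulAction.toPerm (genOf e H) : Equiv.Perm X.carrier)

/-- The sign of the topological generator, as a homomorphism. -/
def BurnsideSemiring.sgn (H : OpenSubgroup G) : BurnsideSemiring H →+ Additive ℤˣ where
  toFun := Quotient.lift (fun X => Additive.ofMul (X.sgn e)) (by
    rintro X Y ⟨f, hf⟩
    exact congrArg Additive.ofMul (psign_of_equiv f fun x => hf _ x))
  map_zero' := by
    change Additive.ofMul ((FinGSet.empty H).sgn e) = 0
    have : Subsingleton (Equiv.Perm (FinGSet.empty H).carrier) :=
      ⟨fun a b => Equiv.ext fun x => x.elim⟩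
    rw [FinGSet.sgn, Subsingleton.elim (MulAction.toPerm (genOf e H)) 1, map_one, ofMul_one]
  map_add' x y := by
    induction x using BurnsideSemiring.ind with | h X
    induction y using BurnsideSemiring.ind with | h Y
    change Additive.ofMul ((X.sum Y).sgn e) = Additive.ofMul (X.sgn e * Y.sgn e)
    rw [FinGSet.sgn, FinGSet.sgn, FinGSet.sgn, ← psign_sumCongr]
    congr 2

/-- The sign of the topological generator on virtual `H`-sets. -/
def BurnsideRing.sgn (H : OpenSubgroup G) : BurnsideRing H →+ Additive ℤˣ :=
  GrothendieckRing.lift (BurnsideSemiring.sgn e H)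

theorem sgn_cls {H : OpenSubgroup G} (X : FinGSet H) :
    BurnsideRing.sgn e H (cls X) = Additive.ofMul (X.sgn e) := GrothendieckRing.lift_of _ _

/-- The sign of a product permutation is the product of the two signs, each raised to the
cardinality of the other factor. In this sense the sign is a derivation over the rank, so rank 0 and
trivial sign together are stable under multiplication. -/
theorem sgn_mul {H : OpenSubgroup G} (x y : BurnsideRing H) : BurnsideRing.sgn e H (x * y) =
    mark ⊥ y • BurnsideRing.sgn e H x + mark ⊥ x • BurnsideRing.sgn e H y := by
  have key : ∀ X Y : FinGSet H, BurnsideRing.sgn e H (cls X * cls Y) =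
      mark ⊥ (cls Y) • BurnsideRing.sgn e H (cls X) + mark ⊥ (cls X) • BurnsideRing.sgn e H (cls Y) := by
    intro X Y
    have h1 : cls X * cls Y = cls (X.prod Y) := (GrothendieckRing.of_mul _ _ _).symm
    rw [h1, sgn_cls, sgn_cls, sgn_cls, mark_bot, mark_bot, natCast_zsmul, natCast_zsmul,
      ← ofMul_pow, ← ofMul_pow, ← ofMul_mul]
    exact congrArg Additive.ofMul (psign_prodCongr
      (MulAction.toPerm (genOf e H) : Equiv.Perm X.carrier)
      (MulAction.toPerm (genOf e H) : Equiv.Perm Y.carrier))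
  obtain ⟨a, b, rfl⟩ := GrothendieckRing.exists_eq_sub x
  obtain ⟨c, d, rfl⟩ := GrothendieckRing.exists_eq_sub y
  induction a using BurnsideSemiring.ind with | h X
  induction b using BurnsideSemiring.ind with | h Y
  induction c using BurnsideSemiring.ind with | h Z
  induction d using BurnsideSemiring.ind with | h W
  change BurnsideRing.sgn e H ((cls X - cls Y) * (cls Z - cls W)) =
    mark ⊥ (cls Z - cls W) • BurnsideRing.sgn e H (cls X - cls Y) +
      mark ⊥ (cls X - cls Y) • BurnsideRing.sgn e H (cls Z - cls W)
  simp only [sub_mul, mul_sub, map_sub, key, sub_smul, smul_sub]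
  abel

/-- The generator permutes the k cosets in a single cycle, because its k-th power generates the
stabilizer. -/
theorem sgn_t (M k : ℕ+) : BurnsideRing.sgn e _ (t e M k) =
    ((k : ℕ) - 1 : ℤ) • Additive.ofMul (-1 : ℤˣ) := by
  obtain ⟨n, hn⟩ : ∃ n, (k : ℕ) = n + 1 := ⟨k - 1, (Nat.succ_pred_eq_of_pos k.pos).symm⟩
  rw [t, orbit_eq, sgn_cls, FinGSet.sgn, genOf_lvl]
  have h1 := psign_of_equiv (((finCongr hn).symm.trans (quotientEquivFin e M k) :
      Fin (n + 1) ≃ (orbitSet (lvl e M) (lvl e (k * M))).carrier))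
    (σ := finRotate (n + 1)) (τ := MulAction.toPerm (genAt e M)) (by
      intro i
      refine Fin.lastCases ?_ (fun j => ?_) i
      · rw [finRotate_last]
        change (QuotientGroup.mk (genAt e M ^ 0) : lvl e M ⧸ relSub (lvl e M) (lvl e (k * M))) =
          QuotientGroup.mk (genAt e M * genAt e M ^ n)
        refine QuotientGroup.eq.2 ?_
        rw [pow_zero, inv_one, one_mul, ← pow_succ', ← hn, ← incl_genAt e k M]
        exact (genAt e (k * M)).2
      · have h2 : finRotate (n + 1) j.castSucc = j.succ := finRotate_of_lt j.2
        rw [h2]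
        change (QuotientGroup.mk (genAt e M ^ ((j : ℕ) + 1)) : lvl e M ⧸ relSub (lvl e M) (lvl e (k * M))) =
          QuotientGroup.mk (genAt e M * genAt e M ^ (j : ℕ))
        rw [pow_succ'])
  rw [← h1, psign_eq, sign_finRotate, hn, ofMul_pow, ← natCast_zsmul]
  simp

theorem mark_bot_t (M k : ℕ+) : mark ⊥ (t e M k) = ((k : ℕ) : ℤ) := by
  classical
  rw [t, mark_orbit, if_pos (by simp), index_relSub]

/-- Both sides are additive, so the transitive sets suffice: t_{kM,j} transfers to t_{M,jk}, and jk
- 1 = (j - 1) + j (k - 1). -/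
theorem sgn_tr (M k : ℕ+) (x : BurnsideRing (lvl e (k * M))) :
    BurnsideRing.sgn e _ (tr (lvl_mul_le e k M) x) = BurnsideRing.sgn e _ x +
      (mark ⊥ x * ((k : ℕ) - 1 : ℤ)) • Additive.ofMul (-1 : ℤˣ) := by
  let f : BurnsideRing (lvl e (k * M)) →+ Additive ℤˣ :=
    (BurnsideRing.sgn e _).comp (tr (lvl_mul_le e k M))
  let g : BurnsideRing (lvl e (k * M)) →+ Additive ℤˣ := BurnsideRing.sgn e _ +
    ((zmultiplesHom _ (Additive.ofMul (-1 : ℤˣ))).comp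
      (AddMonoidHom.mulRight ((k : ℕ) - 1 : ℤ))).comp (mark ⊥).toAddMonoidHom
  refine sub_eq_zero.1 (mem_of_t_mem e (AddMonoidHom.ker (f - g)) (fun j => ?_) x)
  change BurnsideRing.sgn e _ (tr (lvl_mul_le e k M) (t e (k * M) j)) - (BurnsideRing.sgn e _ (t e (k * M) j) +
      (mark ⊥ (t e (k * M) j) * ((k : ℕ) - 1 : ℤ)) • Additive.ofMul (-1 : ℤˣ)) = 0
  rw [tr_t, sgn_t, sgn_t, mark_bot_t, ← add_smul, ← sub_smul, PNat.mul_coe, Nat.cast_mul]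
  convert zero_smul ℤ _ using 2
  ring

/-- The generator of kM Ẑ is the `k`-th power of the generator of M Ẑ. -/
theorem sgn_res (M k : ℕ+) (x : BurnsideRing (lvl e M)) :
    BurnsideRing.sgn e _ (res (lvl_mul_le e k M) x) = (k : ℕ) • BurnsideRing.sgn e _ x := by
  refine DFunLike.congr_fun (f := (BurnsideRing.sgn e _).comp (res (lvl_mul_le e k M)).toAddMonoidHom)
    (g := (k : ℕ) • BurnsideRing.sgn e _) (GrothendieckRing.hom_ext fun a => ?_) x
  induction a using BurnsideSemiring.ind with | h X
  change BurnsideRing.sgn e _ (res (lvl_mul_le e k M) (GrothendieckRing.of _)) =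
    (k : ℕ) • BurnsideRing.sgn e _ (cls X)
  rw [res, GrothendieckRing.map_of]
  refine (sgn_cls e (FinGSet.pullback _ (continuous_incl (lvl_mul_le e k M)) X)).trans ?_
  rw [sgn_cls, ← ofMul_pow]
  refine congrArg Additive.ofMul ?_
  rw [FinGSet.sgn, FinGSet.sgn, ← map_pow]
  congr 1
  refine Equiv.ext fun (x : X.carrier) => ?_
  rw [genOf_lvl, genOf_lvl]
  change incl (lvl_mul_le e k M) (genAt e (k * M)) • x = _
  rw [incl_genAt]
  exact (congrFun (congrArg DFunLike.coe
    (map_pow (MulAction.toPermHom (lvl e M) X.carrier) (genAt e M) (k : ℕ))) x)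

theorem sgn_conj (H : OpenSubgroup G) (g : G) (x : BurnsideRing H) :
    BurnsideRing.sgn e _ (conj H g x) = BurnsideRing.sgn e _ x := by
  refine DFunLike.congr_fun (f := (BurnsideRing.sgn e _).comp (conj H g).toAddMonoidHom)
    (g := BurnsideRing.sgn e _) (GrothendieckRing.hom_ext fun a => ?_) x
  induction a using BurnsideSemiring.ind with | h X
  change BurnsideRing.sgn e _ (conj H g (GrothendieckRing.of _)) = BurnsideRing.sgn e _ (cls X)
  rw [conj, GrothendieckRing.map_of]
  refine (sgn_cls e (FinGSet.pullback _ (continuous_conjHom H g) X)).trans ?_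
  rw [sgn_cls]
  refine congrArg Additive.ofMul ?_
  rw [FinGSet.sgn, FinGSet.sgn]
  congr 1
  refine Equiv.ext fun (x : X.carrier) => ?_
  have hH : conjSubgroup H g = H := by
    refine SetLike.ext fun b => ?_
    change g * b * g⁻¹ ∈ H ↔ b ∈ H
    rw [mul_comm g, mul_inv_cancel_right]
  have h1 : conjHom H g (genOf e (conjSubgroup H g)) = genOf e H := by
    refine Subtype.ext ?_
    change g * gen e ^ (idx e (conjSubgroup H g) : ℤ) * g⁻¹ = gen e ^ (idx e H : ℤ)
    rw [mul_comm g, mul_inv_cancel_right, hH]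
  change conjHom H g (genOf e (conjSubgroup H g)) • x = _
  rw [h1]
  rfl

/-- A function in `Map_L(H, X)` is determined by its values at powers of the generator. -/
def coindEquivFin (M k : ℕ+) (X : FinGSet (lvl e (k * M))) :
    FinGSet.Coind (incl (lvl_mul_le e k M)) X ≃ (Fin (k : ℕ) → X.carrier) :=
  Equiv.ofBijective (fun s i => s.fn (genAt e M ^ (i : ℕ))) (by
    have hdec : ∀ h : lvl e M, ∃ l : lvl e (k * M), h = incl (lvl_mul_le e k M) l *
        genAt e M ^ ((quotientEquivFin e M k).symm (QuotientGroup.mk h) : ℕ) := by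
      intro h
      have h1 := (quotientEquivFin e M k).apply_symm_apply (QuotientGroup.mk h)
      rw [quotientEquivFin_apply] at h1
      refine ⟨⟨_, (QuotientGroup.eq (s := relSub (lvl e M) (lvl e (k * M)))).1 h1⟩, Subtype.ext ?_⟩
      exact congrArg Subtype.val (inv_mul_cancel_comm
        (genAt e M ^ ((quotientEquivFin e M k).symm (QuotientGroup.mk h) : ℕ)) h).symm
    refine ⟨?_, ?_⟩
    · intro s s' hs
      refine FinGSet.Coind.ext (funext fun h => ?_)
      obtain ⟨l, hl⟩ := hdec h
      rw [hl, s.map_mul, s'.map_mul]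
      exact congrArg (l • ·) (congrFun hs _)
    · intro f
      choose l hl using hdec
      have hq : ∀ (m : lvl e (k * M)) (h : lvl e M),
          (QuotientGroup.mk (incl (lvl_mul_le e k M) m * h) : lvl e M ⧸ relSub (lvl e M) (lvl e (k * M))) =
            QuotientGroup.mk h := by
        intro m h
        refine (QuotientGroup.eq.2 ?_).symm
        rw [mul_left_comm, inv_mul_cancel, mul_one]
        exact m.2
      refine ⟨⟨fun h => l h • f ((quotientEquivFin e M k).symm (QuotientGroup.mk h)), fun m h => ?_⟩, ?_⟩
      · have h1 := hl (incl (lvl_mul_le e k M) m * h)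
        rw [hq] at h1
        nth_rw 1 [hl h] at h1
        rw [← mul_assoc, ← map_mul] at h1
        have h2 := incl_injective (lvl_mul_le e k M) (mul_right_cancel h1)
        change l _ • f _ = m • (l h • f _)
        rw [hq, ← h2, mul_smul]
      · funext i
        have h1 := hl (genAt e M ^ (i : ℕ))
        rw [← quotientEquivFin_apply, Equiv.symm_apply_apply, right_eq_mul,
          ← map_one (incl (lvl_mul_le e k M))] at h1
        have h2 := incl_injective (lvl_mul_le e k M) h1
        simp only
        rw [h2, ← quotientEquivFin_apply, Equiv.symm_apply_apply, one_smul])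

/-- Evaluation at the powers g^0, …, g^n identifies Map_L(H, X) with the families of n + 1 points of
X. Translation by g shifts the coordinates; the last one wraps around to g^{n+1}, the generator of
L, which acts on the value at coordinate 0. -/
theorem sgn_coinduction (M k : ℕ+) {n : ℕ} (hn : (k : ℕ) = n + 1) (X : FinGSet (lvl e (k * M))) :
    (X.coinduction (incl (lvl_mul_le e k M)) (isOpenMap_incl (lvl_mul_le e k M))).sgn e =
      psign (rot n X.carrier * actZero n X.carrier (MulAction.toPerm (genOf e (lvl e (k * M))))) := by
  let E : (X.coinduction (incl (lvl_mul_le e k M)) (isOpenMap_incl (lvl_mul_le e k M))).carrier ≃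
      (Fin (n + 1) → X.carrier) :=
    (coindEquivFin e M k X).trans (Equiv.arrowCongr (finCongr hn) (Equiv.refl _))
  have hE : ∀ s i, E s i = s.fn (genAt e M ^ (i : ℕ)) := fun _ _ => rfl
  refine psign_of_equiv E fun s => ?_
  funext i
  rw [Equiv.Perm.mul_apply, rot_actZero_apply, hE, hE, genOf_lvl, genOf_lvl]
  change s.fn (genAt e M ^ (i : ℕ) * genAt e M) = _
  rw [← pow_succ]
  refine Fin.lastCases ?_ (fun j => ?_) i
  · rw [finRotate_last, Pi.mulSingle_eq_same]
    change s.fn (genAt e M ^ (n + 1)) = genAt e (k * M) • s.fn (genAt e M ^ 0)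
    rw [← hn, ← incl_genAt, pow_zero, ← s.map_mul, mul_one]
  · have h2 : finRotate (n + 1) j.castSucc = j.succ := finRotate_of_lt j.2
    rw [h2, Pi.mulSingle_eq_of_ne]
    · rfl
    · intro h
      exact absurd (congrArg Fin.val h) (Nat.succ_ne_zero _)

theorem sgn_coinduction_congr (M k : ℕ+) {X Y : FinGSet (lvl e (k * M))}
    (h1 : Nat.card X.carrier = Nat.card Y.carrier) (h2 : X.sgn e = Y.sgn e) :
    (X.coinduction (incl (lvl_mul_le e k M)) (isOpenMap_incl (lvl_mul_le e k M))).sgn e =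
    (Y.coinduction (incl (lvl_mul_le e k M)) (isOpenMap_incl (lvl_mul_le e k M))).sgn e := by
  obtain ⟨n, hn⟩ : ∃ n, (k : ℕ) = n + 1 := ⟨k - 1, (Nat.succ_pred_eq_of_pos k.pos).symm⟩
  rw [sgn_coinduction e M k hn, sgn_coinduction e M k hn]
  exact psign_rot_actZero_congr (Finite.card_eq.1 h1).some h2

/-- The virtual sets of rank `0` on which the generator has trivial sign. -/
def signLevel (H : OpenSubgroup G) : Ideal (BurnsideRing H) where
  carrier := {x | mark ⊥ x = 0 ∧ BurnsideRing.sgn e H x = 0}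
  zero_mem' := ⟨map_zero _, map_zero _⟩
  add_mem' := by
    rintro x y ⟨h1, h2⟩ ⟨h3, h4⟩
    exact ⟨by rw [map_add, h1, h3, add_zero], by rw [map_add, h2, h4, add_zero]⟩
  smul_mem' := by
    rintro c x ⟨h1, h2⟩
    refine ⟨by rw [smul_eq_mul, map_mul, h1, mul_zero], ?_⟩
    rw [smul_eq_mul, sgn_mul, h1, h2, zero_smul, smul_zero, add_zero]

theorem mem_signLevel {H : OpenSubgroup G} {x : BurnsideRing H} :
    x ∈ signLevel e H ↔ mark ⊥ x = 0 ∧ BurnsideRing.sgn e H x = 0 := Iff.rfl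

theorem sub_mem_signLevel {H : OpenSubgroup G} {X Y : FinGSet H} :
    cls X - cls Y ∈ signLevel e H ↔ Nat.card X.carrier = Nat.card Y.carrier ∧ X.sgn e = Y.sgn e := by
  rw [mem_signLevel, map_sub, map_sub, mark_bot, mark_bot, sgn_cls, sgn_cls, sub_eq_zero, sub_eq_zero,
    Nat.cast_inj, Additive.ofMul.injective.eq_iff]

theorem norm_sub_norm_mem_signLevel (M k : ℕ+) {a b : BurnsideSemiring (lvl e (k * M))}
    (h : (GrothendieckRing.of a - GrothendieckRing.of b : BurnsideRing _) ∈ signLevel e _) :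
    (GrothendieckRing.of (BurnsideSemiring.coinduction (incl (lvl_mul_le e k M))
        (isOpenMap_incl (lvl_mul_le e k M)) a) -
      GrothendieckRing.of (BurnsideSemiring.coinduction (incl (lvl_mul_le e k M))
        (isOpenMap_incl (lvl_mul_le e k M)) b) : BurnsideRing _) ∈ signLevel e _ := by
  induction a using BurnsideSemiring.ind with | h X
  induction b using BurnsideSemiring.ind with | h Y
  have h1 := (sub_mem_signLevel e).1 h
  refine (sub_mem_signLevel e (X := X.coinduction _ _) (Y := Y.coinduction _ _)).2
    ⟨?_, sgn_coinduction_congr e M k h1.1 h1.2⟩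
  have hX := Nat.card_congr (coindEquivFin e M k X)
  have hY := Nat.card_congr (coindEquivFin e M k Y)
  rw [Nat.card_fun, h1.1, ← Nat.card_fun] at hX
  exact hX.trans hY.symm

theorem exists_lvl_of_le {L H : OpenSubgroup G} (h : L ≤ H) :
    ∃ M k : ℕ+, H = lvl e M ∧ L = lvl e (k * M) := by
  obtain ⟨M, rfl⟩ := exists_eq_lvl e H
  obtain ⟨N, rfl⟩ := exists_eq_lvl e L
  obtain ⟨k, rfl⟩ := (lvl_le_lvl e).1 h
  exact ⟨M, k, rfl, by rw [mul_comm]⟩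

/-- The virtual sets of rank `0` on which the generator has trivial sign form a Tambara ideal. -/
def signIdeal : TambaraIdeal G where
  level := signLevel e
  res_mem {L H} h x hx := by
    obtain ⟨M, k, rfl, rfl⟩ := exists_lvl_of_le e h
    refine ⟨by rw [mark_res, bot_inf_eq]; exact hx.1, ?_⟩
    rw [sgn_res, hx.2, nsmul_zero]
  tr_mem {L H} h x hx := by
    classical
    obtain ⟨M, k, rfl, rfl⟩ := exists_lvl_of_le e h
    refine ⟨by rw [mark_tr, hx.1, mul_zero, ite_self], ?_⟩
    rw [sgn_tr, hx.1, hx.2, zero_mul, zero_smul, add_zero]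
  norm_mem {L H} h x hx := by
    obtain ⟨M, k, rfl, rfl⟩ := exists_lvl_of_le e h
    refine ⟨norm h x - norm h 0, ?_, by rw [sub_add_cancel]⟩
    obtain ⟨a, b, rfl⟩ := GrothendieckRing.exists_eq_sub x
    -- Writing 0 as b - b makes the two alternating sums comparable term by term: the sets a + j b
    -- and b + j b differ by x, so their coinductions have the same cardinality and the same sign.
    have h0 : (0 : BurnsideRing (lvl e (k * M))) = GrothendieckRing.of b - GrothendieckRing.of b :=
      (sub_self _).symm
    rw [h0, norm_of_sub_of, norm_of_sub_of, GrothendieckRing.polySum, GrothendieckRing.polySum,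
      ← Finset.sum_sub_distrib]
    refine sum_mem fun i _ => ?_
    rw [← Finset.sum_sub_distrib]
    refine sum_mem fun j _ => ?_
    rw [← smul_sub]
    refine zsmul_mem (norm_sub_norm_mem_signLevel e M k ?_) _
    rw [map_add, map_add, add_sub_add_right_eq_sub]
    exact hx
  conj_mem H g x hx := ⟨by rw [mark_conj]; exact hx.1, by rw [sgn_conj]; exact hx.2⟩

/-- A cycle of odd length is an even permutation, and in t_4 - t_2 - 2 the odd signs of the 4-cycle
and the 2-cycle cancel. -/
theorem contains_generators_signIdeal : (signIdeal e).Contains (generators e) := by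
  have h2 : (2 : ℤ) • Additive.ofMul (-1 : ℤˣ) = 0 := rfl
  have hone : ∀ M : ℕ+, BurnsideRing.sgn e (lvl e M) 1 = 0 := by
    intro M
    rw [← t_one, sgn_t]
    exact zero_smul _ _
  have hnat : ∀ (M : ℕ+) (n : ℕ), BurnsideRing.sgn e (lvl e M) (n : BurnsideRing _) = 0 := by
    intro M n
    rw [← nsmul_one, map_nsmul, hone, nsmul_zero]
  have hmark := contains_generators_markIdeal_bot e
  refine contains_generators e (fun p M hp hp2 => ⟨?_, ?_⟩) (fun M => ⟨?_, ?_⟩)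
  · exact mem_markIdeal.1 (oddElt_mem_of_generators e hmark hp hp2 M) _ le_rfl
  · obtain ⟨j, hj⟩ := Nat.Prime.odd_of_ne_two hp fun h => hp2 (PNat.coe_injective h)
    rw [oddElt, map_sub, sgn_t, hnat, sub_zero, hj]
    push_cast
    rw [add_sub_cancel_right, mul_comm, mul_smul, h2, smul_zero]
  · exact mem_markIdeal.1 (evenElt_mem_of_generators e hmark M) _ le_rfl
  · rw [evenElt, map_sub, map_sub, sgn_t, sgn_t, ← Nat.cast_ofNat (R := BurnsideRing _), hnat, sub_zero,
      ← sub_smul]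
    exact h2

/-- An additive subgroup of `A(M Ẑ)` that lies between the subgroup generated by transfers of the
generators and the sign ideal is the sign ideal. -/
theorem IsLarge.signLevel_le {M : ℕ+} {S : AddSubgroup (BurnsideRing (lvl e M))} (hS : IsLarge e S)
    (h : S ≤ (signLevel e (lvl e M)).toAddSubgroup) : (signLevel e (lvl e M)).toAddSubgroup ≤ S := by
  intro x hx
  obtain ⟨n, m, hm, hnm⟩ := hS.normal_form e x
  have h1 : n • (1 : BurnsideRing (lvl e M)) + m • t e M 2 ∈ signLevel e (lvl e M) := by
    have := sub_mem hx (h hnm)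
    rwa [sub_sub_cancel] at this
  obtain ⟨h2, h3⟩ := h1
  rw [← t_one, map_add, map_zsmul, map_zsmul, sgn_t, sgn_t] at h3
  rw [map_add, map_zsmul, map_zsmul, map_one, mark_bot_t] at h2
  -- For m = 1 the sign would be that of a transposition. Once m = 0, the rank forces n = 0.
  have hm0 : m = 0 := by
    refine hm.resolve_right fun hm1 => ?_
    rw [hm1] at h3
    revert h3
    simp only [PNat.one_coe, Nat.cast_one, sub_self, zero_smul, smul_zero, zero_add, one_smul]
    decide
  rw [hm0, zero_smul, add_zero, smul_eq_mul, mul_one] at h2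
  rwa [h2, hm0, zero_smul, zero_smul, add_zero, sub_zero] at hnm

/-- The ideal generated lies in the sign ideal and contains all the relations of the normal form, so
`IsLarge.signLevel_le` gives equality. -/
theorem span_generators_level (H : OpenSubgroup G) :
    (TambaraIdeal.span (generators e)).level H = signLevel e H := by
  obtain ⟨M, rfl⟩ := exists_eq_lvl e H
  have h1 := TambaraIdeal.span_le (contains_generators_signIdeal e) (lvl e M)
  refine le_antisymm h1 ?_
  exact (isLarge_of_contains_generators e (fun a ha => TambaraIdeal.mem_span ha) M).signLevel_le e h1

end SignIdeal

/-! ## Cyclic automorphisms of fields -/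

section NormalBasis

variable {L : Type*} [Field L] (τ : L ≃+* L) {n : ℕ} [NeZero n]

theorem ringAut_pow_apply_eq (hτ : orderOf τ = n) {a b : ℕ} (h : (a : ZMod n) = b) (x : L) :
    (τ ^ a) x = (τ ^ b) x := by
  have : τ ^ a = τ ^ b := by
    rw [pow_eq_pow_iff_modEq, hτ]
    exact (ZMod.natCast_eq_natCast_iff _ _ _).1 h
  rw [this]

/-- A normal basis theorem for a cyclic group of automorphisms: an element none of whose
translates satisfy a nontrivial linear relation that is invariant under rotation. -/
theorem exists_normal_element (hτ : orderOf τ = n) :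
    ∃ θ : L, ∀ c : ZMod n → L, (∀ j : ZMod n, ∑ i, (τ ^ (j - i).val) θ * c i = 0) → c = 0 := by
  have hn : n ≠ 0 := NeZero.ne n
  have hfo : IsOfFinOrder τ := orderOf_pos_iff.1 (by rw [hτ]; exact Nat.pos_of_ne_zero hn)
  have hfin : Finite (Subgroup.zpowers τ) := finite_zpowers.2 hfo
  let Γ := Subgroup.zpowers τ
  let K₀ := FixedPoints.subfield Γ L
  let b := IsGalois.normalBasis K₀ L
  refine ⟨b 1, fun c hc => ?_⟩
  -- The relations say that the operator Σ c_i τ^{-i} vanishes on a normal basis over the fixed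
  -- field, hence everywhere; Dedekind's independence of automorphisms then gives c = 0.
  let Φ : L →ₗ[K₀] L := ∑ i : ZMod n, (LinearMap.mulRight K₀ (c i)).comp
    (DistribSMul.toLinearMap K₀ L (⟨τ ^ (-i).val, Subgroup.npow_mem_zpowers τ _⟩ : Γ))
  have hΦ : ∀ x, Φ x = ∑ i, (τ ^ (-i).val) x * c i := by
    intro x
    simp only [Φ, LinearMap.sum_apply]
    rfl
  have hΦ0 : Φ = 0 := by
    refine b.ext fun σ => ?_
    obtain ⟨⟨g, hg⟩, rfl⟩ := (FixedPoints.toAlgAutMulEquiv Γ L).surjective σ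
    obtain ⟨j, rfl⟩ := hfo.mem_powers_iff_mem_zpowers.2 hg
    rw [hΦ, LinearMap.zero_apply, IsGalois.normalBasis_apply, ← hc j]
    refine Finset.sum_congr rfl fun i _ => ?_
    congr 1
    change (τ ^ (-i).val * τ ^ j) (b 1) = _
    rw [← pow_add]
    refine ringAut_pow_apply_eq τ hτ ?_ _
    simp
    ring
  have hind := (linearIndependent_monoidHom L L).comp
    (fun i : ZMod n => (((τ ^ (-i).val : L ≃+* L) : L →+* L) : L →* L)) (by
      intro i j hij
      have h1 : τ ^ (-i).val = τ ^ (-j).val := RingEquiv.ext fun x => DFunLike.congr_fun hij x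
      rw [pow_eq_pow_iff_modEq, hτ, ← ZMod.natCast_eq_natCast_iff] at h1
      simpa using h1)
  rw [Fintype.linearIndependent_iff] at hind
  refine funext (hind c (funext fun x => ?_))
  have h2 := LinearMap.congr_fun hΦ0 x
  rw [hΦ] at h2
  simpa [mul_comm] using h2

open Matrix in
/-- A self-dual normal element for a cyclic group of automorphisms of odd order. -/
theorem exists_self_dual_element (hτ : orderOf τ = n) (hodd : Odd n) :
    ∃ θ : L, ∀ k : ZMod n, ∑ i : ZMod n, (τ ^ i.val) θ * (τ ^ (i + k).val) θ = if k = 0 then 1 else 0 := by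
  obtain ⟨θ, hθ⟩ := exists_normal_element τ hτ
  obtain ⟨m, hm⟩ := hodd
  let f : ZMod n → L := fun k => (τ ^ k.val) θ
  have hf : ∀ k, τ (f k) = f (k + 1) := by
    intro k
    change (τ * τ ^ k.val) θ = _
    rw [← pow_succ']
    exact ringAut_pow_apply_eq τ hτ (by simp) θ
  let V : Matrix (ZMod n) (ZMod n) L := circulant f
  let Z : Matrix (ZMod n) (ZMod n) L := circulant (Pi.single (-1) 1)
  have hZmul : ∀ (A : Matrix (ZMod n) (ZMod n) L) i j, (Z * A) i j = A (i + 1) j := by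
    intro A i j
    rw [mul_apply, Finset.sum_eq_single (i + 1)]
    · simp [Z, circulant_apply]
    · intro k _ hk
      simp only [Z, circulant_apply]
      rw [Pi.single_eq_of_ne, zero_mul]
      intro h
      exact hk (by linear_combination -h)
    · simp
  have hmulZ : ∀ (A : Matrix (ZMod n) (ZMod n) L) i j, (A * Z) i j = A i (j - 1) := by
    intro A i j
    rw [mul_apply, Finset.sum_eq_single (j - 1)]
    · simp [Z, circulant_apply]
    · intro k _ hk
      simp only [Z, circulant_apply]
      rw [Pi.single_eq_of_ne, mul_zero]
      intro h
      exact hk (by linear_combination h)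
    · simp
  have hZT : Zᵀ = circulant (Pi.single 1 1) := by
    ext i j
    simp only [Z, transpose_apply, circulant_apply, Pi.single_apply]
    congr 1
    rw [eq_iff_iff]
    constructor <;> intro h <;> linear_combination -h
  have hZZT : Z * Zᵀ = 1 := by
    ext i j
    rw [hZmul, hZT, circulant_apply, Pi.single_apply, one_apply]
    congr 1
    rw [eq_iff_iff]
    constructor <;> intro h <;> linear_combination h
  have hZTZ : Zᵀ * Z = 1 := mul_eq_one_comm.1 hZZT
  have hZpow : ∀ k : ℕ, ∀ i j, (Z ^ k) i j = (1 : Matrix (ZMod n) (ZMod n) L) (i + k) j := by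
    intro k
    induction k with
    | zero => intro i j; rw [pow_zero, Nat.cast_zero, add_zero]
    | succ k ih =>
      intro i j
      have h1 : i + 1 + (k : ZMod n) = i + ((k + 1 : ℕ) : ZMod n) := by push_cast; ring
      rw [pow_succ', hZmul, ih, h1]
  have hZn : Z ^ n = 1 := by
    ext i j
    rw [hZpow, ZMod.natCast_self, add_zero]
  have cZV : Commute Z V := circulant_mul_comm _ _
  have cVV : Commute V Vᵀ := by
    change V * Vᵀ = Vᵀ * V
    rw [transpose_circulant]
    exact circulant_mul_comm _ _
  -- The defining property of θ is that V has trivial kernel.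
  have hunit : IsUnit V := by
    rw [← mulVec_injective_iff_isUnit]
    intro c d hcd
    refine sub_eq_zero.1 (hθ (c - d) fun j => ?_)
    have h1 : (V *ᵥ (c - d)) j = 0 := by rw [mulVec_sub, hcd, sub_self, Pi.zero_apply]
    exact h1
  obtain ⟨W, hVW, hWV⟩ := isUnit_iff_exists.1 hunit
  have cZVT : Commute Z Vᵀ := by
    have h1 := congrArg transpose cZV.eq
    rw [transpose_mul, transpose_mul] at h1
    change Z * Vᵀ = Vᵀ * Z
    calc Z * Vᵀ = Z * (Vᵀ * Zᵀ) * Z := by rw [mul_assoc, mul_assoc, hZTZ, mul_one]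
      _ = Z * (Zᵀ * Vᵀ) * Z := by rw [h1]
      _ = Vᵀ * Z := by rw [← mul_assoc, hZZT, one_mul]
  have inv_comm : ∀ A B C : Matrix (ZMod n) (ZMod n) L, A * B = 1 → B * A = 1 → Commute C A →
      Commute C B := by
    intro A B C h1 h2 h3
    change C * B = B * C
    calc C * B = B * A * (C * B) := by rw [h2, one_mul]
      _ = B * (C * A) * B := by rw [h3.eq]; simp only [mul_assoc]
      _ = B * C := by rw [mul_assoc, mul_assoc, h1, mul_one]
  have hVTWT : Vᵀ * Wᵀ = 1 := by rw [← transpose_mul, hWV, transpose_one]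
  have hWTVT : Wᵀ * Vᵀ = 1 := by rw [← transpose_mul, hVW, transpose_one]
  have cZW : Commute Z W := inv_comm V W Z hVW hWV cZV
  have cWWT : Commute W Wᵀ :=
    inv_comm Vᵀ Wᵀ W hVTWT hWTVT (inv_comm V W Vᵀ hVW hWV cVV.symm).symm
  have cZTW : Commute Zᵀ W := (inv_comm Z Zᵀ W hZZT hZTZ cZW.symm).symm
  have cZTVT : Commute Zᵀ Vᵀ := (inv_comm Z Zᵀ Vᵀ hZZT hZTZ cZVT.symm).symm
  let T : Matrix (ZMod n) (ZMod n) L →+* Matrix (ZMod n) (ZMod n) L := (τ : L →+* L).mapMatrix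
  have hTV : T V = Z * V := by
    ext i j
    rw [hZmul]
    change τ (f (i - j)) = f (i + 1 - j)
    rw [hf]
    congr 1
    ring
  have hTVT : T Vᵀ = Vᵀ * Zᵀ := by
    rw [← transpose_mul, ← hTV]
    rfl
  have hTW : T W = W * Zᵀ := by
    have h1 : T W * (Z * V) = 1 := by rw [← hTV, ← map_mul, hWV, map_one]
    calc T W = T W * (Z * (V * W) * Zᵀ) := by rw [hVW, mul_one, hZZT, mul_one]
      _ = T W * (Z * V) * (W * Zᵀ) := by simp only [mul_assoc]
      _ = W * Zᵀ := by rw [h1, one_mul]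
  -- With n = 2m + 1 and W inverse to V, this product is orthogonal because V commutes with its
  -- transpose. Under τ it is multiplied by the 2m-th power of the inverse shift.
  let P := Vᵀ ^ m * W ^ m
  have cZP : Commute Z P := (cZVT.pow_right m).mul_right (cZW.pow_right m)
  -- Oddness enters here: 2m + 1 shifts are the identity, so 2m inverse shifts amount to one shift.
  have hZTpow : Zᵀ ^ m * Zᵀ ^ m = Z := by
    have h1 : Zᵀ ^ (2 * m + 1) = 1 :=
      (congrArg (Zᵀ ^ ·) hm.symm).trans (by
        rw [← transpose_pow, hZn, transpose_one])
    calc Zᵀ ^ m * Zᵀ ^ m = Z * Zᵀ * (Zᵀ ^ m * Zᵀ ^ m) := by rw [hZZT, one_mul]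
      _ = Z * Zᵀ ^ (2 * m + 1) := by rw [mul_assoc, ← pow_add, ← pow_succ', two_mul]
      _ = Z := by rw [h1, mul_one]
  have hTP : T P = P * Z := by
    change T (Vᵀ ^ m * W ^ m) = _
    rw [map_mul, map_pow, map_pow, hTVT, hTW, cZTVT.symm.mul_pow, cZTW.symm.mul_pow]
    have h1 := (cZTW.pow_pow m m).eq
    calc Vᵀ ^ m * Zᵀ ^ m * (W ^ m * Zᵀ ^ m) = Vᵀ ^ m * (Zᵀ ^ m * W ^ m) * Zᵀ ^ m := by
          simp only [mul_assoc]
      _ = P * (Zᵀ ^ m * Zᵀ ^ m) := by rw [h1]; simp only [P, mul_assoc]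
      _ = P * Z := by rw [hZTpow]
  have hPP : P * Pᵀ = 1 := by
    change Vᵀ ^ m * W ^ m * (Vᵀ ^ m * W ^ m)ᵀ = 1
    rw [transpose_mul, transpose_pow, transpose_pow, transpose_transpose]
    have h1 := (cWWT.pow_pow m m).eq
    have cVTWT : Commute Vᵀ Wᵀ := hVTWT.trans hWTVT.symm
    have cWV : Commute W V := hWV.trans hVW.symm
    calc Vᵀ ^ m * W ^ m * (Wᵀ ^ m * V ^ m) = Vᵀ ^ m * (W ^ m * Wᵀ ^ m) * V ^ m := by
          simp only [mul_assoc]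
      _ = (Vᵀ ^ m * Wᵀ ^ m) * (W ^ m * V ^ m) := by rw [h1]; simp only [mul_assoc]
      _ = 1 := by rw [← cVTWT.mul_pow, ← cWV.mul_pow, hVTWT, hWV, one_pow, one_mul]
  -- Commuting with Z makes P circulant, and the rule for τ makes the entries of row 0 the
  -- conjugates of the corner entry. Orthogonality of row 0 to the other rows is then self-duality.
  have hcirc : ∀ k : ℕ, ∀ j, P k j = P 0 (j - k) := by
    intro k
    induction k with
    | zero => intro j; simp
    | succ k ih =>
      intro j
      have h1 := congrFun (congrFun cZP.eq k) j
      rw [hZmul, hmulZ, ih] at h1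
      push_cast
      rw [h1]
      congr 1
      ring
  have hpow : ∀ k : ℕ, (τ ^ k) (P 0 0) = P 0 (-k) := by
    intro k
    induction k with
    | zero => simp
    | succ k ih =>
      rw [pow_succ']
      change τ ((τ ^ k) (P 0 0)) = _
      rw [ih]
      have h1 := congrFun (congrFun hTP 0) (-k)
      rw [hmulZ] at h1
      refine h1.trans ?_
      congr 1
      push_cast
      ring
  refine ⟨P 0 0, fun k => ?_⟩
  have h1 := congrFun (congrFun hPP 0) k
  rw [mul_apply, one_apply] at h1
  simp only [eq_comm (a := (0 : ZMod n))] at h1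
  rw [← h1, ← Equiv.sum_comp (Equiv.neg (ZMod n))]
  refine Finset.sum_congr rfl fun i _ => ?_
  rw [hpow, hpow, transpose_apply]
  have h2 := hcirc k.val
  simp only [ZMod.natCast_val, ZMod.cast_id', id_eq] at h2 ⊢
  rw [h2]
  have h3 : Equiv.neg (ZMod n) i = -i := rfl
  rw [h3]
  congr 2 <;> ring

end NormalBasis


/-! ## Elements of fields with prescribed behaviour under an automorphism -/

section Elements

variable {K : Type*} [Field K] (σ : K ≃+* K)

/-- The automorphism `σ` acts on the fixed field of `σ ^ n` with exact order `n`. -/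
def SeparatesPowers (n : ℕ) : Prop := ∀ i, 0 < i → i < n → ∃ a, (σ ^ n) a = a ∧ (σ ^ i) a ≠ a

/-- The fixed field of `σ ^ n`. -/
def powFixed (n : ℕ) : Subfield K := ((σ ^ n : K ≃+* K) : K →+* K).eqLocusField (RingHom.id K)

theorem mem_powFixed {n : ℕ} {a : K} : a ∈ powFixed σ n ↔ (σ ^ n) a = a := Iff.rfl

variable {σ} {n : ℕ}

theorem pow_comm_apply (i j : ℕ) (a : K) : (σ ^ i) ((σ ^ j) a) = (σ ^ j) ((σ ^ i) a) := by
  change (σ ^ i * σ ^ j) a = (σ ^ j * σ ^ i) a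
  rw [← pow_add, ← pow_add, add_comm]

/-- The first n powers of σ restrict to distinct embeddings of the fixed field of `σ ^ n`, so
Dedekind independence applies. -/
theorem SeparatesPowers.eq_zero (h : SeparatesPowers σ n) (c : Fin n → K)
    (hc : ∀ a, (σ ^ n) a = a → ∑ i : Fin n, c i * (σ ^ (i : ℕ)) a = 0) : c = 0 := by
  have hind := (linearIndependent_monoidHom (powFixed σ n) K).comp
    (fun i : Fin n => ((((σ ^ (i : ℕ) : K ≃+* K) : K →+* K).comp (powFixed σ n).subtype :
      powFixed σ n →+* K) : powFixed σ n →* K)) (by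
      have key : ∀ i j : Fin n, (i : ℕ) < j → ∃ a, (σ ^ n) a = a ∧ (σ ^ (i : ℕ)) a ≠ (σ ^ (j : ℕ)) a := by
        intro i j hij
        obtain ⟨a, ha, hne⟩ := h (j - i) (by omega) (by omega)
        refine ⟨a, ha, fun e => hne ?_⟩
        have h1 : (σ ^ (j : ℕ)) a = (σ ^ (i : ℕ)) ((σ ^ ((j : ℕ) - i)) a) := by
          change _ = (σ ^ (i : ℕ) * σ ^ ((j : ℕ) - i)) a
          rw [← pow_add, Nat.add_sub_cancel' hij.le]
        rw [h1] at e
        exact ((σ ^ (i : ℕ)).injective e).symm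
      intro i j hij
      by_contra hne
      rcases lt_or_gt_of_ne (fun e => hne (Fin.ext e)) with hlt | hlt
      · obtain ⟨a, ha, h1⟩ := key i j hlt
        exact h1 (DFunLike.congr_fun hij ⟨a, ha⟩)
      · obtain ⟨a, ha, h1⟩ := key j i hlt
        exact h1 (DFunLike.congr_fun hij ⟨a, ha⟩).symm)
  rw [Fintype.linearIndependent_iff] at hind
  refine funext (hind c (funext fun a => ?_))
  simpa using hc a a.2

/-- An element with `σ ^ n β = -β`. -/
theorem SeparatesPowers.exists_neg (h : SeparatesPowers σ (2 * n)) (hn : 0 < n) :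
    ∃ β, β ≠ 0 ∧ (σ ^ n) β = -β := by
  obtain ⟨a, ha, hne⟩ := h n hn (by omega)
  refine ⟨a - (σ ^ n) a, sub_ne_zero.2 (Ne.symm hne), ?_⟩
  have h1 : (σ ^ n) ((σ ^ n) a) = a := by
    change (σ ^ n * σ ^ n) a = a
    rw [← pow_add, ← two_mul, ha]
  rw [map_sub, h1, neg_sub]

/-- An element with `σ ^ n β = -β` for which the sum of the squares of the conjugates
`σ ^ i β`, `i < n`, does not vanish. -/
theorem SeparatesPowers.exists_neg_anisotropic (h2K : (2 : K) ≠ 0) (h : SeparatesPowers σ n)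
    (h2 : SeparatesPowers σ (2 * n)) (hn : 0 < n) :
    ∃ β, (σ ^ n) β = -β ∧ ∑ i : Fin n, (σ ^ (i : ℕ)) β ^ 2 ≠ 0 := by
  obtain ⟨β, hβ, hσ⟩ := h2.exists_neg hn
  by_contra! hall
  -- If the sum vanished for all admissible β, it would vanish for every β a with a fixed by σ^n.
  -- Polarizing the resulting quadratic relation in a at the pair (a, 1) gives a linear one, which
  -- contradicts Dedekind independence.
  have h3 : ∀ a, (σ ^ n) a = a → ∑ i : Fin n, (σ ^ (i : ℕ)) β ^ 2 * (σ ^ (i : ℕ)) a ^ 2 = 0 := by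
    intro a ha
    have h4 := hall (β * a) (by rw [map_mul, hσ, ha, neg_mul])
    simpa only [map_mul, mul_pow] using h4
  have h4 := h.eq_zero (fun i => (σ ^ (i : ℕ)) β ^ 2) (by
    intro a ha
    have h5 := h3 (a + 1) (by rw [map_add, map_one, ha])
    have h6 := h3 a ha
    have h7 := h3 1 (map_one _)
    have h8 : ∀ i : Fin n, (σ ^ (i : ℕ)) β ^ 2 * (σ ^ (i : ℕ)) (a + 1) ^ 2 =
        (σ ^ (i : ℕ)) β ^ 2 * (σ ^ (i : ℕ)) a ^ 2 + (σ ^ (i : ℕ)) β ^ 2 * (σ ^ (i : ℕ)) 1 ^ 2 +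
          2 * ((σ ^ (i : ℕ)) β ^ 2 * (σ ^ (i : ℕ)) a) := by
      intro i
      rw [map_add, map_one]
      ring
    simp only [h8, Finset.sum_add_distrib, ← Finset.mul_sum] at h5
    rw [h6, h7, add_zero, zero_add] at h5
    exact (mul_eq_zero.1 h5).resolve_left h2K)
  have h5 := congrFun h4 ⟨0, hn⟩
  simp only [pow_zero, Pi.zero_apply] at h5
  exact hβ (pow_eq_zero_iff two_ne_zero |>.1 h5)

/-- A self-dual normal element of the fixed field of `σ ^ n`, for odd `n`. -/
theorem SeparatesPowers.exists_self_dual [NeZero n] (h : SeparatesPowers σ n) (hodd : Odd n) :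
    ∃ θ, (σ ^ n) θ = θ ∧ ∀ r s : Fin n,
      ∑ i : Fin n, (σ ^ (i : ℕ)) ((σ ^ (r : ℕ)) θ * (σ ^ (s : ℕ)) θ) = if r = s then 1 else 0 := by
  have hmem : ∀ k : ℕ, ∀ a, a ∈ powFixed σ n → (σ ^ k) a ∈ powFixed σ n := by
    intro k a ha
    rw [mem_powFixed] at ha ⊢
    rw [pow_comm_apply, ha]
  have hinv : ∀ a, a ∈ powFixed σ n → σ.symm a ∈ powFixed σ n := by
    intro a ha
    rw [mem_powFixed] at ha ⊢
    refine σ.injective ?_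
    have h1 := pow_comm_apply (σ := σ) 1 n (σ.symm a)
    rw [pow_one] at h1
    rw [h1, RingEquiv.apply_symm_apply, ha]
  have hmem1 : ∀ a, a ∈ powFixed σ n → σ a ∈ powFixed σ n := fun a ha => by
    simpa using hmem 1 a ha
  let τ : powFixed σ n ≃+* powFixed σ n :=
    { toFun := fun a => ⟨σ a, hmem1 a a.2⟩
      invFun := fun a => ⟨σ.symm a, hinv a a.2⟩
      left_inv := fun a => Subtype.ext (σ.symm_apply_apply a)
      right_inv := fun a => Subtype.ext (σ.apply_symm_apply a)
      map_mul' := fun a b => Subtype.ext (map_mul σ _ _)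
      map_add' := fun a b => Subtype.ext (map_add σ _ _) }
  have hτ : ∀ (k : ℕ) (a : powFixed σ n), ((τ ^ k) a : K) = (σ ^ k) (a : K) := by
    intro k
    induction k with
    | zero => intro a; rfl
    | succ k ih =>
      intro a
      rw [pow_succ', pow_succ']
      change σ ((τ ^ k) a : K) = σ ((σ ^ k) (a : K))
      rw [ih]
  have hord : orderOf τ = n := by
    refine (orderOf_eq_iff (Nat.pos_of_ne_zero (NeZero.ne n))).2 ⟨?_, fun i hi h0 e => ?_⟩
    · refine RingEquiv.ext fun a => Subtype.ext ?_
      rw [hτ]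
      exact a.2
    · obtain ⟨a, ha, hne⟩ := h i h0 hi
      refine hne ?_
      have h1 := hτ i ⟨a, ha⟩
      rw [e] at h1
      exact h1.symm
  obtain ⟨θ, hθ⟩ := exists_self_dual_element τ hord hodd
  refine ⟨θ, θ.2, fun r s => ?_⟩
  have h1 : ∑ i : Fin n, (τ ^ (i : ℕ)) ((τ ^ (r : ℕ)) θ * (τ ^ (s : ℕ)) θ) =
      if r = s then 1 else 0 := by
    let ε : ZMod n ≃ Fin n := ⟨fun i => ⟨i.val, ZMod.val_lt i⟩, fun i => (i : ℕ),
      fun i => by simp, fun i => Fin.ext (by simp [ZMod.val_natCast, Nat.mod_eq_of_lt i.2])⟩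
    have h2 := hθ ((s : ℕ) - (r : ℕ))
    have h3 : ((s : ℕ) - (r : ℕ) : ZMod n) = 0 ↔ r = s := by
      rw [sub_eq_zero, eq_comm]
      refine ⟨fun e => ε.symm.injective e, fun e => by rw [e]⟩
    simp only [h3] at h2
    rw [← h2]
    refine Fintype.sum_equiv (ε.symm.trans (Equiv.addRight ((r : ℕ) : ZMod n))) _ _ fun i => ?_
    have h4 : ε.symm i = ((i : ℕ) : ZMod n) := rfl
    rw [map_mul, Equiv.trans_apply, Equiv.coe_addRight, h4]
    congr 1
    · change (τ ^ (i : ℕ) * τ ^ (r : ℕ)) θ = _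
      rw [← pow_add]
      exact ringAut_pow_apply_eq τ hord (by simp) θ
    · change (τ ^ (i : ℕ) * τ ^ (s : ℕ)) θ = _
      rw [← pow_add]
      exact ringAut_pow_apply_eq τ hord (by simp) θ
  have h2 := congrArg (Subtype.val : powFixed σ n → K) h1
  rw [← Subfield.coe_subtype, map_sum] at h2
  have h3 : (powFixed σ n).subtype (if r = s then 1 else 0) = if r = s then 1 else 0 := by
    split_ifs <;> simp
  rw [h3] at h2
  rw [← h2]
  refine Finset.sum_congr rfl fun i _ => ?_
  rw [Subfield.coe_subtype, hτ, Subfield.coe_mul, hτ, hτ]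

end Elements

/-! ## Diagonal forms -/

section Diagonal

variable {E : Type v} [Field E]

theorem QuadClass.mk_eq_mk_of_equiv {V W : QuadSpace E} (f : V.carrier ≃ₗ[E] W.carrier)
    (h : ∀ x, W.form (f x) = V.form x) : QuadClass.mk V = QuadClass.mk W :=
  Quotient.sound ⟨⟨f, h⟩⟩

namespace QuadClass

/-- The rank of a quadratic form. -/
def rank : QuadClass E →+ ℤ where
  toFun := Quotient.lift (fun V => (Module.finrank E V.carrier : ℤ)) (by
    rintro V W ⟨f⟩
    exact congrArg Nat.cast f.toLinearEquiv.finrank_eq)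
  map_zero' :=
    congrArg Nat.cast (Module.finrank_zero_of_subsingleton (R := E) (M := PUnit.{v + 1}))
  map_add' x y := by
    induction x using ind with | h V
    induction y using ind with | h W
    exact (congrArg Nat.cast (Module.finrank_prod (R := E) (M := V.carrier)
      (M' := W.carrier))).trans (Nat.cast_add _ _)

theorem rank_mk (V : QuadSpace E) : rank (mk V) = Module.finrank E V.carrier := rfl

end QuadClass

variable [NeZero (2 : E)]

/-- The quadratic form `∑ w i * x i ^ 2`. -/
def QuadSpace.diag {n : ℕ} (w : Fin n → Eˣ) : QuadSpace E where
  carrier := Fin n → E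
  form := QuadraticMap.weightedSumSquares E w
  nondegenerate := by
    refine QuadSpace.nondegenerate_of fun x hx => funext fun i => ?_
    have h := hx (Pi.single i 1)
    have h1 : ∀ j, w j • ((x + Pi.single i 1 : Fin n → E) j * (x + Pi.single i 1 : Fin n → E) j) -
        w j • (x j * x j) -
        w j • ((Pi.single i 1 : Fin n → E) j * (Pi.single i 1 : Fin n → E) j) =
        if i = j then 2 * (w i : E) * x i else 0 := by
      intro j
      split_ifs with hj
      · subst hj
        simp only [Pi.add_apply, Pi.single_eq_same, Units.smul_def, smul_eq_mul]
        ring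
      · simp [Pi.single_eq_of_ne (Ne.symm hj)]
    rw [QuadraticMap.polar, QuadraticMap.weightedSumSquares_apply,
      QuadraticMap.weightedSumSquares_apply, QuadraticMap.weightedSumSquares_apply,
      ← Finset.sum_sub_distrib, ← Finset.sum_sub_distrib, Finset.sum_congr rfl fun j _ => h1 j,
      Finset.sum_ite_eq, if_pos (Finset.mem_univ i)] at h
    exact (mul_eq_zero.1 h).resolve_left (mul_ne_zero (NeZero.ne 2) (w i).ne_zero)

theorem QuadSpace.diag_form {n : ℕ} (w : Fin n → Eˣ) (x : Fin n → E) :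
    (QuadSpace.diag w).form x = ∑ i, (w i : E) * (x i * x i) :=
  QuadraticMap.weightedSumSquares_apply w x

namespace QuadClass

theorem mk_diag_eq_mk {n : ℕ} {w : Fin n → Eˣ} {V : QuadSpace E} (f : (Fin n → E) ≃ₗ[E] V.carrier)
    (h : ∀ x, V.form (f x) = ∑ i, (w i : E) * (x i * x i)) : mk (QuadSpace.diag w) = mk V :=
  mk_eq_mk_of_equiv (V := QuadSpace.diag w) f fun x => (h x).trans (QuadSpace.diag_form w x).symm

/-- The class of the form `a * x ^ 2`. -/
def unary (a : Eˣ) : QuadClass E := mk (QuadSpace.diag fun _ : Fin 1 => a)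

theorem mk_diag {n : ℕ} (w : Fin n → Eˣ) : mk (QuadSpace.diag w) = ∑ i, unary (w i) := by
  induction n with
  | zero =>
    rw [Fin.sum_univ_zero]
    let f : (Fin 0 → E) ≃ₗ[E] PUnit.{v + 1} :=
      { toFun := fun _ => PUnit.unit
        invFun := fun _ => 0
        map_add' := fun _ _ => rfl
        map_smul' := fun _ _ => rfl
        left_inv := fun f => Subsingleton.elim _ _
        right_inv := fun _ => rfl }
    exact mk_diag_eq_mk (V := QuadSpace.zero E) f fun x => by
      rw [Fin.sum_univ_zero]
      rfl
  | succ n ih =>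
    rw [Fin.sum_univ_succ, ← ih]
    let f : (Fin (n + 1) → E) ≃ₗ[E] (Fin 1 → E) × (Fin n → E) :=
      { toFun := fun x => (fun _ => x 0, fun i => x i.succ)
        invFun := fun y => (Fin.cons (y.1 0) y.2 : Fin (n + 1) → E)
        map_add' := fun _ _ => rfl
        map_smul' := fun _ _ => rfl
        left_inv := fun x => by
          refine funext fun i => ?_
          refine Fin.cases ?_ (fun j => ?_) i <;> rfl
        right_inv := fun y => by
          refine Prod.ext (funext fun i => ?_) rfl
          rw [Subsingleton.elim i 0]
          rfl }
    refine mk_diag_eq_mk (V := (QuadSpace.diag fun _ : Fin 1 => w 0).sum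
      (QuadSpace.diag fun i => w i.succ)) f fun x => ?_
    rw [Fin.sum_univ_succ]
    refine congrArg₂ (· + ·) ?_ (QuadSpace.diag_form (fun i => w i.succ) fun i => x i.succ)
    exact (QuadSpace.diag_form (fun _ : Fin 1 => w 0) fun _ => x 0).trans (Fin.sum_univ_one _)

theorem rank_unary (a : Eˣ) : rank (unary a) = 1 := by
  refine (rank_mk (QuadSpace.diag fun _ : Fin 1 => a)).trans ?_
  exact congrArg Nat.cast (Module.finrank_fin_fun E (n := 1))

/-- If `b = a (p² + q²)` then `⟨a, a⟩ ≅ ⟨b, b⟩`. -/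
theorem unary_add_unary {a b : Eˣ} (p q : E) (h : (b : E) = a * (p ^ 2 + q ^ 2)) :
    unary b + unary b = unary a + unary a := by
  have hs : p ^ 2 + q ^ 2 ≠ 0 := fun h0 => b.ne_zero (by rw [h, h0, mul_zero])
  have h2 : ∀ c : Eˣ, unary c + unary c = mk (QuadSpace.diag fun _ : Fin 2 => c) := fun c => by
    rw [mk_diag, Fin.sum_univ_two]
  rw [h2, h2]
  -- This is multiplication by p + q i on pairs, which scales the sum of two squares by p² + q².
  let f : (Fin 2 → E) ≃ₗ[E] (Fin 2 → E) :=
      { toFun := fun x => ![p * x 0 - q * x 1, q * x 0 + p * x 1]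
        invFun := fun y => ![(p * y 0 + q * y 1) / (p ^ 2 + q ^ 2),
          (p * y 1 - q * y 0) / (p ^ 2 + q ^ 2)]
        map_add' := fun x y => by
          refine funext fun i => ?_
          fin_cases i <;> simp <;> ring
        map_smul' := fun c x => by
          refine funext fun i => ?_
          fin_cases i <;> simp <;> ring
        left_inv := fun x => by
          refine funext fun i => ?_
          fin_cases i <;> simp <;> field_simp <;> ring
        right_inv := fun y => by
          refine funext fun i => ?_
          fin_cases i <;> simp <;> field_simp <;> ring }
  refine mk_diag_eq_mk (V := QuadSpace.diag _) f fun x => ?_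
  refine (QuadSpace.diag_form _ _).trans ?_
  rw [Fin.sum_univ_two, Fin.sum_univ_two, h]
  change (a : E) * ((p * x 0 - q * x 1) * (p * x 0 - q * x 1)) +
    a * ((q * x 0 + p * x 1) * (q * x 0 + p * x 1)) = _
  ring

theorem exists_eq_sum_unary (x : QuadClass E) :
    ∃ (n : ℕ) (w : Fin n → Eˣ), x = ∑ i, unary (w i) := by
  induction x using ind with | h V
  have : Invertible (2 : E) := invertibleOfNonzero (NeZero.ne 2)
  obtain ⟨w, ⟨f⟩⟩ := QuadraticForm.equivalent_weightedSumSquares_units_of_nondegenerate' V.form (by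
    intro x hx
    refine V.nondegenerate.1 x fun y => ?_
    rw [← QuadraticMap.two_nsmul_associated E, LinearMap.smul_apply, LinearMap.smul_apply]
    exact (congrArg (2 • ·) (hx y)).trans (smul_zero _))
  refine ⟨_, w, ?_⟩
  rw [← mk_diag]
  exact Quotient.sound ⟨f⟩

/-- If A is the matrix of the isometry, then Aᵀ D' A = D for the two diagonal matrices; taking
determinants gives the square of det A. -/
theorem exists_sq_of_mk_diag_eq {n : ℕ} {w w' : Fin n → Eˣ}
    (h : mk (QuadSpace.diag w) = mk (QuadSpace.diag w')) :
    ∃ u : E, ∏ i, (w i : E) = u ^ 2 * ∏ i, (w' i : E) := by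
  obtain ⟨f⟩ := Quotient.exact h
  let f' : (Fin n → E) ≃ₗ[E] (Fin n → E) := f.toLinearEquiv
  have hf : ∀ x, ∑ i, (w' i : E) * (f' x i * f' x i) = ∑ i, (w i : E) * (x i * x i) := fun x =>
    ((QuadSpace.diag_form w' (f' x)).symm.trans (f.map_app x)).trans (QuadSpace.diag_form w x)
  let A : Matrix (Fin n) (Fin n) E := LinearMap.toMatrix' (f' : (Fin n → E) →ₗ[E] (Fin n → E))
  have hpol : ∀ x y, ∑ i, (w' i : E) * (f' x i * f' y i) = ∑ i, (w i : E) * (x i * y i) := by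
    intro x y
    have h1 := hf (x + y)
    have h2 : ∀ (v : Fin n → Eˣ) (a b : Fin n → E), ∑ i, (v i : E) * ((a + b) i * (a + b) i) =
        ∑ i, (v i : E) * (a i * a i) + ∑ i, (v i : E) * (b i * b i) +
          2 * ∑ i, (v i : E) * (a i * b i) := by
      intro v a b
      rw [Finset.mul_sum, ← Finset.sum_add_distrib, ← Finset.sum_add_distrib]
      refine Finset.sum_congr rfl fun i _ => ?_
      rw [Pi.add_apply]
      ring
    rw [map_add, h2, h2, hf, hf, add_right_inj] at h1
    exact mul_left_cancel₀ (NeZero.ne 2) h1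
  have hA : A.transpose * Matrix.diagonal (fun i => (w' i : E)) * A =
      Matrix.diagonal (fun i => (w i : E)) := by
    ext i j
    have h1 := hpol (Pi.single i 1) (Pi.single j 1)
    rw [Matrix.mul_apply]
    simp only [Matrix.mul_diagonal, Matrix.transpose_apply, A, LinearMap.toMatrix'_apply]
    refine Eq.trans (Finset.sum_congr rfl fun k _ => ?_) (h1.trans ?_)
    · simp only [LinearEquiv.coe_coe]
      ring
    · rw [Matrix.diagonal_apply, Finset.sum_eq_single i]
      · simp [Pi.single_apply]
      · intro k _ hk
        rw [Pi.single_eq_of_ne hk, zero_mul, mul_zero]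
      · simp
  refine ⟨A.det, ?_⟩
  have h1 := congrArg Matrix.det hA
  rw [Matrix.det_mul, Matrix.det_mul, Matrix.det_transpose, Matrix.det_diagonal,
    Matrix.det_diagonal] at h1
  rw [← h1]
  ring

/-- If two binary diagonal forms are stably isometric, then their discriminants differ by a square. -/
theorem exists_sq_of_unary_add_eq {a b c d : Eˣ} {x : QuadClass E}
    (h : unary a + unary b + x = unary c + unary d + x) :
    ∃ u : E, (a * b : E) = u ^ 2 * (c * d) := by
  obtain ⟨n, w, rfl⟩ := exists_eq_sum_unary x
  have h1 : ∀ a b : Eˣ, unary a + unary b + ∑ i, unary (w i) =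
      mk (QuadSpace.diag (Fin.cons a (Fin.cons b w : Fin (n + 1) → Eˣ) : Fin (n + 2) → Eˣ)) := by
    intro a b
    rw [mk_diag, Fin.sum_univ_succ, Fin.sum_univ_succ, ← add_assoc]
    rfl
  rw [h1, h1] at h
  obtain ⟨u, hu⟩ := exists_sq_of_mk_diag_eq h
  simp only [Fin.prod_univ_succ, Fin.cons_zero, Fin.cons_succ] at hu
  refine ⟨u, ?_⟩
  have h3 : ∏ i, (w i : E) ≠ 0 := Finset.prod_ne_zero_iff.2 fun i _ => (w i).ne_zero
  refine mul_right_cancel₀ h3 ?_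
  linear_combination hu

end QuadClass

end Diagonal

theorem exists_add_eq_of_grothendieck {A : Type v} [AddCommMonoid A] {a b : A}
    (h : (Algebra.GrothendieckAddGroup.of a : Algebra.GrothendieckAddGroup A) =
      Algebra.GrothendieckAddGroup.of b) : ∃ c, a + c = b + c := by
  obtain ⟨c, hc⟩ := (AddLocalization.addMonoidOf (⊤ : AddSubmonoid A)).eq_iff_exists.1 h
  exact ⟨c, by rw [add_comm a, add_comm b]; exact hc⟩

/-! ## Computing the Dress map -/

section DressComputation

variable {F : Type u} {K : Type v} [Field F] [Field K] [Algebra F K] {L H : OpenSubgroup Gal(K/F)}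

open QuadClass

/-- On a transitive set an equivariant function may take at the base point any value fixed by the
stabilizer. -/
theorem exists_equivariantMap {X : FinGSet H} {x₀ : X.carrier} (hx : ∀ x, ∃ h : H, h • x₀ = x) {a : K}
    (ha : ∀ h : H, h • x₀ = x₀ → (h : Gal(K/F)) a = a) :
    ∃ f : equivariantMaps X, ∀ h : H, f.1 (h • x₀) = (h : Gal(K/F)) a := by
  choose s hs using hx
  have key : ∀ h h' : H, h • x₀ = h' • x₀ → (h : Gal(K/F)) a = (h' : Gal(K/F)) a := by
    intro h h' e
    have h1 := ha (h'⁻¹ * h) (by rw [mul_smul, e, inv_smul_smul])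
    have h2 : (h : Gal(K/F)) = (h' : Gal(K/F)) * ((h'⁻¹ * h : H) : Gal(K/F)) := by
      rw [← Subgroup.coe_mul, mul_inv_cancel_left]
    rw [h2, AlgEquiv.mul_apply, h1]
  refine ⟨⟨fun x => (s x : Gal(K/F)) a, fun h x => ?_⟩, fun h => key _ _ (hs _)⟩
  have h1 := key (s (h • x)) (h * s x) (by rw [mul_smul, hs, hs])
  exact h1

theorem fixed_mono (h : L ≤ H) : (fixed H : IntermediateField F K) ≤ fixed L := by
  intro c hc
  rw [IntermediateField.mem_fixedField_iff] at hc ⊢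
  exact fun g hg => hc g (h hg)

variable [IsGalois F K]

section Transfer

variable (h : L ≤ H)

/-- The induced set `H ×_L X`. -/
abbrev inducedSet (X : FinGSet L) : FinGSet H :=
  X.induction (BurnsideRing.incl h) (BurnsideRing.isOpenMap_incl h)

/-- Equivariant functions on an induced set are equivariant functions on the original set. -/
def equivariantMapsInduction (X : FinGSet L) :
    equivariantMaps (inducedSet h X) ≃+
      equivariantMaps X where
  toFun f := ⟨fun x => f.1 (Quotient.mk (FinGSet.inductionSetoid (BurnsideRing.incl h) X) (1, x)), fun l x => by
    refine Eq.trans (congrArg f.1 ?_) (f.2 (BurnsideRing.incl h l) _)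
    refine Quotient.sound ⟨l⁻¹, ?_, ?_⟩
    · simp
    · simp⟩
  invFun g := ⟨Quotient.lift (fun a : H × X.carrier => (a.1 : Gal(K/F)) (g.1 a.2)) (by
      rintro ⟨a, x⟩ ⟨b, y⟩ ⟨l, h1, h2⟩
      simp only at h1 h2 ⊢
      subst h1 h2
      rw [g.2]
      change (a : Gal(K/F)) (g.1 x) = ((a : Gal(K/F)) * (l : Gal(K/F))⁻¹) ((l : Gal(K/F)) (g.1 x))
      rw [← AlgEquiv.mul_apply, inv_mul_cancel_right]), by
    intro b x
    induction x using Quotient.inductionOn with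
    | h a => rfl⟩
  map_add' _ _ := rfl
  left_inv f := by
    refine Subtype.ext (funext fun z => ?_)
    induction z using Quotient.inductionOn with
    | h a =>
      refine (f.2 a.1 _).symm.trans (congrArg f.1 ?_)
      exact congrArg (Quotient.mk _) (Prod.ext (mul_one a.1) rfl)
  right_inv g := by
    refine Subtype.ext (funext fun x => ?_)
    rfl

theorem equivariantMapsInduction_smul (X : FinGSet L) (c : fixed H)
    (f : equivariantMaps (inducedSet h X)) :
    equivariantMapsInduction h X (c • f) =
      (⟨c, fixed_mono h c.2⟩ : fixed L) • equivariantMapsInduction h X f := rfl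

instance fintypeQuotientRange : Fintype (H ⧸ (BurnsideRing.incl h).range) := Fintype.ofFinite _

/-- The form of the induced set is the trace from K^L to K^H of the form of `X`, so it depends only
on the values of the latter. -/
theorem dressForm_induction (X : FinGSet L)
    (f : equivariantMaps (inducedSet h X)) :
    (dressForm (inducedSet h X) f : K) = ∑ q : H ⧸ (BurnsideRing.incl h).range,
      (q.out : Gal(K/F)) (dressForm X (equivariantMapsInduction h X f) : K) := by
  rw [dressForm_apply, dressForm_apply]
  simp only [map_sum]
  rw [← Fintype.sum_prod_type' (f := fun (q : H ⧸ (BurnsideRing.incl h).range) (x : X.carrier) =>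
    (q.out : Gal(K/F)) ((equivariantMapsInduction h X f).1 x * (equivariantMapsInduction h X f).1 x))]
  let ε : (H ⧸ (BurnsideRing.incl h).range) × X.carrier ≃ (inducedSet h X).carrier :=
    FinGSet.inductionEquiv (BurnsideRing.incl h) (BurnsideRing.incl_injective h) X
  refine (Fintype.sum_equiv ε _ _ fun q => ?_).symm
  have h1 : f.1 (ε q) =
      (q.1.out : Gal(K/F)) ((equivariantMapsInduction h X f).1 q.2) := by
    refine Eq.trans (congrArg f.1 ?_) (f.2 q.1.out _)
    exact congrArg (Quotient.mk _) (Prod.ext (mul_one _).symm rfl)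
  rw [h1, map_mul]

end Transfer

variable [NeZero (2 : F)]

instance neZero_two_fixed (H : OpenSubgroup Gal(K/F)) : NeZero (2 : fixed H) := ⟨by
  rw [← map_ofNat (algebraMap F (fixed H)) 2]
  exact (map_ne_zero _).2 (NeZero.ne (2 : F))⟩

/-- As many orthogonal functions of nonzero norm as there are points form a basis of the equivariant
functions, and the form is diagonal in it. -/
theorem dressClass_eq_sum_of_frame (X : FinGSet H) {n : ℕ} (hn : Nat.card X.carrier = n)
    (f : Fin n → equivariantMaps X) (w : Fin n → (fixed H)ˣ)
    (hf : ∀ i j, ∑ x : X.carrier, (f i).1 x * (f j).1 x = if i = j then ((w i : fixed H) : K) else 0) :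
    dressClass H (BurnsideSemiring.mk X) = ∑ i, unary (w i) := by
  have hf' : ∀ i j, dressBilin X (f i) (f j) = if i = j then (w i : fixed H) else 0 := by
    intro i j
    refine Subtype.ext ((hf i j).trans ?_)
    split_ifs <;> rfl
  have hw : ∀ i, ((w i : fixed H) : K) ≠ 0 := fun i e => (w i).ne_zero (Subtype.ext e)
  let φ := Fintype.linearCombination (fixed H) f
  have hφ : ∀ c i, dressBilin X (φ c) (f i) = c i * w i := by
    intro c i
    rw [Fintype.linearCombination_apply, map_sum, LinearMap.sum_apply, Finset.sum_eq_single i]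
    · rw [map_smul, LinearMap.smul_apply, hf', if_pos rfl, smul_eq_mul]
    · intro j _ hj
      rw [map_smul, LinearMap.smul_apply, hf', if_neg hj, smul_zero]
    · simp
  have hinj : Function.Injective φ := fun c d e => funext fun i => by
    have h1 := hφ c i
    rw [e, hφ] at h1
    exact (mul_right_cancel₀ (w i).ne_zero h1).symm
  let ε : X.carrier ≃ Fin n := Finite.equivFinOfCardEq hn
  let P : Matrix (Fin n) (Fin n) K := fun i j => (f i).1 (ε.symm j)
  let Q : Matrix (Fin n) (Fin n) K := fun j i => (f i).1 (ε.symm j) * ((w i : fixed H) : K)⁻¹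
  have hPQ : P * Q = 1 := by
    ext i j
    rw [Matrix.mul_apply, Matrix.one_apply]
    have h1 : ∑ k, P i k * Q k j = (∑ x : X.carrier, (f i).1 x * (f j).1 x) * ((w j : fixed H) : K)⁻¹ := by
      rw [Finset.sum_mul]
      refine Fintype.sum_equiv ε.symm _ _ fun k => ?_
      simp only [P, Q]
      ring
    rw [h1, hf]
    split_ifs with hij
    · rw [hij, mul_inv_cancel₀ (hw j)]
    · rw [zero_mul]
  -- A one-sided inverse of a square matrix is two-sided. The reversed product says that every g is
  -- recovered from its pairings with the family, so the dimension of the space of equivariant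
  -- functions need not be computed.
  have hQP : Q * P = 1 := mul_eq_one_comm.1 hPQ
  have hsurj : Function.Surjective φ := by
    intro g
    refine ⟨fun i => dressBilin X g (f i) * (w i : fixed H)⁻¹, Subtype.ext (funext fun x => ?_)⟩
    have h1 : (φ fun i => dressBilin X g (f i) * (w i : fixed H)⁻¹).1 x =
        ∑ i, (∑ y : X.carrier, g.1 y * (f i).1 y) * ((w i : fixed H) : K)⁻¹ * (f i).1 x := by
      rw [Fintype.linearCombination_apply]
      simp only [AddSubmonoidClass.coe_finsetSum, Finset.sum_apply]
      rfl
    rw [h1]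
    have h2 : ∀ y, ∑ i, (f i).1 y * ((w i : fixed H) : K)⁻¹ * (f i).1 x = if ε y = ε x then 1 else 0 := by
      intro y
      have h3 := congrFun (congrFun hQP (ε y)) (ε x)
      rw [Matrix.mul_apply, Matrix.one_apply] at h3
      simpa only [P, Q, Equiv.symm_apply_apply] using h3
    calc ∑ i, (∑ y : X.carrier, g.1 y * (f i).1 y) * ((w i : fixed H) : K)⁻¹ * (f i).1 x
        = ∑ y : X.carrier, g.1 y * ∑ i, (f i).1 y * ((w i : fixed H) : K)⁻¹ * (f i).1 x := by
          simp only [Finset.sum_mul, Finset.mul_sum, mul_assoc]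
          exact Finset.sum_comm
      _ = g.1 x := by
          rw [Finset.sum_eq_single x]
          · rw [h2, if_pos rfl, mul_one]
          · intro y _ hy
            rw [h2, if_neg fun e => hy (ε.injective e), mul_zero]
          · simp
  rw [← mk_diag]
  refine (mk_diag_eq_mk (V := dressSpace X) (LinearEquiv.ofBijective φ ⟨hinj, hsurj⟩) fun c => ?_).symm
  change dressBilin X (φ c) (φ c) = _
  have h1 : dressBilin X (φ c) (φ c) = ∑ i, c i * dressBilin X (φ c) (f i) := by
    conv_lhs => enter [2]; rw [Fintype.linearCombination_apply]
    rw [map_sum]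
    simp only [map_smul, smul_eq_mul]
  rw [h1]
  refine Finset.sum_congr rfl fun i _ => ?_
  rw [hφ]
  ring

/-- The Dress class of a transitive set, from an orthogonal family of elements of the fixed field
of a point stabilizer. -/
theorem dressClass_of_cyclic {X : FinGSet H} (γ : H) (x₀ : X.carrier) {n : ℕ}
    (hγ : Function.Bijective fun i : Fin n => γ ^ (i : ℕ) • x₀) (a : Fin n → K)
    (ha : ∀ (r : Fin n) (h : H), h • x₀ = x₀ → (h : Gal(K/F)) (a r) = a r) (w : Fin n → (fixed H)ˣ)
    (hw : ∀ r s, ∑ i : Fin n, ((γ : Gal(K/F)) ^ (i : ℕ)) (a r * a s) =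
      if r = s then ((w r : fixed H) : K) else 0) :
    dressClass H (BurnsideSemiring.mk X) = ∑ i, unary (w i) := by
  have hx : ∀ x, ∃ h : H, h • x₀ = x := fun x => by
    obtain ⟨i, hi⟩ := hγ.2 x
    exact ⟨_, hi⟩
  choose f hf using fun r => exists_equivariantMap hx (ha r)
  refine dressClass_eq_sum_of_frame X ?_ f w fun i j => ?_
  · rw [← Nat.card_congr (Equiv.ofBijective _ hγ), Nat.card_fin]
  · rw [← hw]
    refine (Fintype.sum_equiv (Equiv.ofBijective _ hγ) _ _ fun k => ?_).symm
    rw [Equiv.ofBijective_apply, hf, hf, map_mul]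
    rfl

/-- An isometry over K^L, carried through `equivariantMapsInduction`, becomes K^H-linear and
preserves the traced forms by `dressForm_induction`. -/
theorem dressClass_induction_congr (h : L ≤ H) {x y : BurnsideSemiring L}
    (hxy : dressClass L x = dressClass L y) :
    dressClass H (BurnsideSemiring.induction (BurnsideRing.incl h) (BurnsideRing.isOpenMap_incl h) x) =
      dressClass H (BurnsideSemiring.induction (BurnsideRing.incl h) (BurnsideRing.isOpenMap_incl h) y) := by
  induction x using BurnsideSemiring.ind with | h X
  induction y using BurnsideSemiring.ind with | h Y
  obtain ⟨φ⟩ := Quotient.exact hxy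
  let φ' : equivariantMaps X ≃ₗ[fixed L] equivariantMaps Y := φ.toLinearEquiv
  have hφ : ∀ f, dressForm Y (φ' f) = dressForm X f := φ.map_app
  let ψ : equivariantMaps (inducedSet h X) ≃ₗ[fixed H]
      equivariantMaps (inducedSet h Y) :=
    { ((equivariantMapsInduction h X).trans φ'.toAddEquiv).trans (equivariantMapsInduction h Y).symm with
      map_smul' := fun c f => by
        refine (equivariantMapsInduction h Y).injective ?_
        change equivariantMapsInduction h Y ((equivariantMapsInduction h Y).symm
          (φ' (equivariantMapsInduction h X (c • f)))) = equivariantMapsInduction h Y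
          (c • (equivariantMapsInduction h Y).symm (φ' (equivariantMapsInduction h X f)))
        rw [equivariantMapsInduction_smul, equivariantMapsInduction_smul, AddEquiv.apply_symm_apply,
          AddEquiv.apply_symm_apply, map_smul] }
  refine mk_eq_mk_of_equiv (V := dressSpace (inducedSet h X)) (W := dressSpace (inducedSet h Y)) ψ
    fun (f : equivariantMaps (inducedSet h X)) => Subtype.ext ?_
  change (dressForm (inducedSet h Y) (ψ f) : K) = (dressForm (inducedSet h X) f : K)
  have h1 : equivariantMapsInduction h Y (ψ f) = φ' (equivariantMapsInduction h X f) :=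
    (equivariantMapsInduction h Y).apply_symm_apply _
  rw [dressForm_induction, dressForm_induction, h1, hφ]

theorem dress_of (x : BurnsideSemiring H) : dress H (GrothendieckRing.of x) =
    Algebra.GrothendieckAddGroup.of (dressClass H x) := GrothendieckRing.lift_of _ _

theorem dress_tr_of_sub_of (h : L ≤ H) {x y : BurnsideSemiring L}
    (hxy : dressClass L x = dressClass L y) :
    dress H (BurnsideRing.tr h (GrothendieckRing.of x - GrothendieckRing.of y)) = 0 := by
  have h1 : ∀ x : BurnsideSemiring L, BurnsideRing.tr h (GrothendieckRing.of x) = GrothendieckRing.of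
      (BurnsideSemiring.induction (BurnsideRing.incl h) (BurnsideRing.isOpenMap_incl h) x) :=
    fun x => by simp [BurnsideRing.tr]
  rw [map_sub, map_sub, h1, h1, dress_of, dress_of, dressClass_induction_congr h hxy, sub_self]

end DressComputation

/-! ## The Dress classes of cyclic sets of small order -/

section QuaternionIdentity

variable {K : Type*} [Field K] {σ : K ≃+* K}

/-- From an element `β` with `σ ^ 4 β = -β` and an element `δ` with `σ δ = -δ`, an orthogonal family
for the trace form of the fixed field of `σ ^ 4`. It is read off from the rotation of pure quaternions
given by conjugation with `β + σ β i + σ³ β j + σ² β k`. -/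
theorem exists_frame_four (h2 : (2 : K) ≠ 0) {β δ : K} (hβ : (σ ^ 4) β = -β)
    (hN : ∑ i : Fin 4, (σ ^ (i : ℕ)) β ^ 2 ≠ 0) (hδ : σ δ = -δ) :
    ∃ a : Fin 4 → K, (∀ r, (σ ^ 4) (a r) = a r) ∧ ∀ r s,
      ∑ i : Fin 4, (σ ^ (i : ℕ)) (a r * a s) = if r = s then ![1, 1, 2, 2 * δ ^ 2] r else 0 := by
  obtain ⟨b, hb⟩ : ∃ b, b = σ β := ⟨_, rfl⟩
  obtain ⟨c, hc⟩ : ∃ c, c = σ b := ⟨_, rfl⟩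
  obtain ⟨d, hd⟩ : ∃ d, d = σ c := ⟨_, rfl⟩
  have hσ : ∀ (k : ℕ) (x : K), (σ ^ (k + 1)) x = (σ ^ k) (σ x) := fun k x => by
    rw [pow_succ]
    rfl
  have he : σ d = -β := by
    rw [← hβ, hd, hc, hb]
    rfl
  have hN' : β ^ 2 + b ^ 2 + c ^ 2 + d ^ 2 ≠ 0 := by
    rw [Fin.sum_univ_four] at hN
    rwa [hd, hc, hb]
  have hσ2 : σ 2 = 2 := map_ofNat σ 2
  obtain ⟨v, hv⟩ : ∃ v : K, v = 2⁻¹ := ⟨_, rfl⟩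
  have hσv : σ v = v := by rw [hv, map_inv₀, hσ2]
  -- The automorphism σ sends (β, b, c, d) to (b, c, d, -β), so the sum of their squares is
  -- invariant, and so is the normalizing factor u.
  obtain ⟨u, hu⟩ : ∃ u : K, u = (2 * (β ^ 2 + b ^ 2 + c ^ 2 + d ^ 2))⁻¹ := ⟨_, rfl⟩
  have hσu : σ u = u := by
    rw [hu, map_inv₀]
    simp only [map_mul, map_add, map_pow, ← hb, ← hc, ← hd, he, hσ2]
    ring
  have hu1 : u * (2 * (β ^ 2 + b ^ 2 + c ^ 2 + d ^ 2)) = 1 := by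
    rw [hu, inv_mul_cancel₀ (mul_ne_zero h2 hN')]
  have hv1 : v * 2 = 1 := by rw [hv, inv_mul_cancel₀ h2]
  obtain ⟨p, hp⟩ : ∃ p : K → K → K → K → K, ∀ w x z y, p w x z y =
    w ^ 2 - x ^ 2 - y ^ 2 + z ^ 2 + 2 * (x * z + w * y + y * z - w * x) :=
    ⟨_, fun _ _ _ _ => rfl⟩
  obtain ⟨q, hq⟩ : ∃ q : K → K → K → K → K, ∀ w x z y, q w x z y =
    2 * (x ^ 2 - y ^ 2 + 2 * (w * z) + x * z - w * y - y * z - w * x) :=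
    ⟨_, fun _ _ _ _ => rfl⟩
  obtain ⟨r, hr⟩ : ∃ r : K → K → K → K → K, ∀ w x z y, r w x z y =
    2 * (w ^ 2 - z ^ 2 + 2 * (x * y) + x * z - w * y + y * z + w * x) :=
    ⟨_, fun _ _ _ _ => rfl⟩
  have hσp : ∀ w x z y, σ (p w x z y) = p (σ w) (σ x) (σ z) (σ y) := fun w x z y => by
    simp only [hp, map_add, map_sub, map_mul, map_pow, hσ2]
  have hσq : ∀ w x z y, σ (q w x z y) = q (σ w) (σ x) (σ z) (σ y) := fun w x z y => by
    simp only [hq, map_add, map_sub, map_mul, map_pow, hσ2]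
  have hσr : ∀ w x z y, σ (r w x z y) = r (σ w) (σ x) (σ z) (σ y) := fun w x z y => by
    simp only [hr, map_add, map_sub, map_mul, map_pow, hσ2]
  let a : Fin 4 → K := ![v, u * p β b c d, u * q β b c d, u * δ * r β b c d]
  let V : Fin 4 → Fin 4 → K := ![![v, v, v, v],
    ![u * p β b c d, u * p b c d (-β), u * p c d (-β) (-b), u * p d (-β) (-b) (-c)],
    ![u * q β b c d, u * q b c d (-β), u * q c d (-β) (-b), u * q d (-β) (-b) (-c)],
    ![u * δ * r β b c d, u * -δ * r b c d (-β), u * δ * r c d (-β) (-b), u * -δ * r d (-β) (-b) (-c)]]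
  have hV : ∀ r (i : Fin 4), (σ ^ (i : ℕ)) (a r) = V r i := by
    intro r i
    fin_cases r <;> fin_cases i <;>
      simp [a, V, hσp, hσq, hσr, ← hb, ← hc, ← hd, he, hσu, hσv, hδ, pow_succ, -Equiv.Perm.coe_mul]
  -- Under σ^4 all four of β, b, c, d change sign. The forms p, q, r are homogeneous of degree 2 and
  -- do not notice this, while δ returns to itself after an even number of sign changes.
  refine ⟨a, fun s => ?_, fun s t => ?_⟩
  · fin_cases s
    · simp [a, hσ, hσv]
    · simp [a, hσ, hσp, ← hb, ← hc, ← hd, he, hσu]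
      exact Or.inl (by simp [hp])
    · simp [a, hσ, hσq, ← hb, ← hc, ← hd, he, hσu]
      exact Or.inl (by simp [hq])
    · simp [a, hσ, hσr, ← hb, ← hc, ← hd, he, hδ, hσu]
      exact Or.inl (by simp [hr])
  · simp only [map_mul, hV]
    rw [Fin.sum_univ_four]
    by_cases hst : s = t
    · subst hst
      rw [if_pos rfl]
      fin_cases s
      · change v * v + v * v + v * v + v * v = 1
        linear_combination (v * 2 + 1) * hv1
      · change u * p β b c d * (u * p β b c d) + u * p b c d (-β) * (u * p b c d (-β)) +
          u * p c d (-β) (-b) * (u * p c d (-β) (-b)) +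
          u * p d (-β) (-b) (-c) * (u * p d (-β) (-b) (-c)) = 1
        simp only [hp]
        -- The squares of the four conjugate values of p add up to the square of twice the sum of
        -- squares, which u normalizes to 1; the values of q and r give twice as much.
        linear_combination (u * (2 * (β ^ 2 + b ^ 2 + c ^ 2 + d ^ 2)) + 1) * hu1
      · change u * q β b c d * (u * q β b c d) + u * q b c d (-β) * (u * q b c d (-β)) +
          u * q c d (-β) (-b) * (u * q c d (-β) (-b)) +
          u * q d (-β) (-b) (-c) * (u * q d (-β) (-b) (-c)) = 2
        simp only [hq]
        linear_combination 2 * (u * (2 * (β ^ 2 + b ^ 2 + c ^ 2 + d ^ 2)) + 1) * hu1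
      · change u * δ * r β b c d * (u * δ * r β b c d) +
          u * -δ * r b c d (-β) * (u * -δ * r b c d (-β)) +
          u * δ * r c d (-β) (-b) * (u * δ * r c d (-β) (-b)) +
          u * -δ * r d (-β) (-b) (-c) * (u * -δ * r d (-β) (-b) (-c)) = 2 * δ ^ 2
        simp only [hr]
        linear_combination 2 * δ ^ 2 * (u * (2 * (β ^ 2 + b ^ 2 + c ^ 2 + d ^ 2)) + 1) * hu1
    · rw [if_neg hst]
      fin_cases s <;> fin_cases t <;> first | exact absurd rfl hst | skip
      all_goals
        simp only [V, hp, hq, hr, Fin.zero_eta, Fin.mk_one, Fin.reduceFinMk, Matrix.cons_val]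
        ring

end QuaternionIdentity

theorem two_ne_zero_of_algebra (F : Type*) {K : Type*} [Field F] [Field K] [Algebra F K]
    [NeZero (2 : F)] : (2 : K) ≠ 0 := by
  rw [← map_ofNat (algebraMap F K) 2]
  exact (map_ne_zero _).2 (NeZero.ne (2 : F))

/-! ### Trace forms of cyclic sets of odd order and of orders 2 and 4. -/

section CyclicSets

variable {F : Type u} {K : Type v} [Field F] [Field K] [Algebra F K] {H : OpenSubgroup Gal(K/F)}

open QuadClass

/-- `γ` generates a dense subgroup of `H`. -/
def IsTopGenerator (γ : H) : Prop :=
  ∀ (V : OpenSubgroup Gal(K/F)) (x : H), ∃ k : ℤ, ((x⁻¹ * γ ^ k : H) : Gal(K/F)) ∈ V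

/-- The underlying field automorphism of an element of the Galois group. -/
abbrev toAut (γ : H) : K ≃+* K := (γ : Gal(K/F)).toRingEquiv

theorem toAut_pow (γ : H) (n : ℕ) (a : K) : (toAut γ ^ n) a = ((γ : Gal(K/F)) ^ n) a := by
  induction n generalizing a with
  | zero => rfl
  | succ n ih =>
    rw [pow_succ, pow_succ, RingAut.mul_apply, AlgEquiv.mul_apply, ih]
    rfl

variable [IsGalois F K]

theorem isOpen_fixingSubgroup_adjoin (a : K) :
    IsOpen ((IntermediateField.adjoin F {a}).fixingSubgroup : Set Gal(K/F)) := by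
  have : FiniteDimensional F (IntermediateField.adjoin F {a}) :=
    IntermediateField.adjoin.finiteDimensional (Algebra.IsIntegral.isIntegral a)
  exact IntermediateField.fixingSubgroup_isOpen _

theorem zpow_apply_eq_self {g : Gal(K/F)} {a : K} (h : g a = a) (k : ℤ) : (g ^ k) a = a := by
  have h1 : g ∈ MulAction.stabilizer Gal(K/F) a := h
  exact zpow_mem h1 k

/-- An element of `H` is approximated by powers of a topological generator. -/
theorem IsTopGenerator.exists_zpow {γ : H} (hγ : IsTopGenerator γ) (V : OpenSubgroup Gal(K/F)) (a : K)
    (h : H) : ∃ k : ℤ, (h : Gal(K/F)) a = ((γ : Gal(K/F)) ^ k) a ∧ ((h⁻¹ * γ ^ k : H) : Gal(K/F)) ∈ V := by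
  let W : OpenSubgroup Gal(K/F) :=
    ⟨(IntermediateField.adjoin F {a}).fixingSubgroup, isOpen_fixingSubgroup_adjoin a⟩
  obtain ⟨k, hk⟩ := hγ (V ⊓ W) h
  refine ⟨k, ?_, hk.1⟩
  have h1 : ((h : Gal(K/F))⁻¹ * (γ : Gal(K/F)) ^ k) a = a :=
    (IntermediateField.mem_fixingSubgroup_iff _ _).1 hk.2 a (IntermediateField.mem_adjoin_simple_self F a)
  have h2 := congrArg (h : Gal(K/F)) h1
  rw [← AlgEquiv.mul_apply, mul_inv_cancel_left] at h2
  exact h2.symm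

theorem IsTopGenerator.mem_fixed {γ : H} (hγ : IsTopGenerator γ) {a : K} (ha : (γ : Gal(K/F)) a = a) :
    a ∈ fixed H := by
  rw [IntermediateField.mem_fixedField_iff]
  intro h hh
  obtain ⟨k, hk, -⟩ := hγ.exists_zpow ⊤ a ⟨h, hh⟩
  exact hk.trans (zpow_apply_eq_self ha k)

/-- If `γ ^ i` fixed all elements fixed by `γ ^ n`, it would fix K^L pointwise, hence lie in `L` by
the Galois correspondence; this is impossible for 0 < i < n. -/
theorem separatesPowers_toAut {γ : H} {n : ℕ} (L : OpenSubgroup Gal(K/F))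
    (hL : ∀ i : ℕ, ((γ : Gal(K/F)) ^ i) ∈ L ↔ n ∣ i) : SeparatesPowers (toAut γ) n := by
  intro i hi0 hin
  by_contra! hall
  have h1 : (γ : Gal(K/F)) ^ i ∈ (fixed L).fixingSubgroup := by
    rw [IntermediateField.mem_fixingSubgroup_iff]
    intro a ha
    rw [← toAut_pow]
    refine hall a ?_
    rw [toAut_pow]
    exact (IntermediateField.mem_fixedField_iff _ _).1 ha _ ((hL n).2 dvd_rfl)
  have h2 : (fixed L).fixingSubgroup = (L : Subgroup Gal(K/F)) :=
    InfiniteGalois.fixingSubgroup_fixedField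
      (⟨(L : Subgroup Gal(K/F)), L.isClosed⟩ : ClosedSubgroup Gal(K/F))
  rw [h2] at h1
  exact absurd (Nat.le_of_dvd hi0 ((hL i).1 h1)) (not_le.2 hin)

/-- The set `X` is cyclic of order `n`, generated by `x₀` under the powers of `γ`. -/
structure IsCyclicSet (X : FinGSet H) (γ : H) (x₀ : X.carrier) (n : ℕ) : Prop where
  bijective : Function.Bijective fun i : Fin n => γ ^ (i : ℕ) • x₀
  apply_eq : ∀ a : K, (toAut γ ^ n) a = a → ∀ h : H, h • x₀ = x₀ → (h : Gal(K/F)) a = a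

variable [NeZero (2 : F)] {X : FinGSet H} {γ : H} {x₀ : X.carrier}

theorem IsCyclicSet.dressClass_eq {n : ℕ} (hX : IsCyclicSet X γ x₀ n) (a : Fin n → K)
    (ha : ∀ r, (toAut γ ^ n) (a r) = a r) (w : Fin n → (fixed H)ˣ)
    (hw : ∀ r s, ∑ i : Fin n, (toAut γ ^ (i : ℕ)) (a r * a s) =
      if r = s then ((w r : fixed H) : K) else 0) :
    dressClass H (BurnsideSemiring.mk X) = ∑ i, unary (w i) :=
  dressClass_of_cyclic γ x₀ hX.bijective a (fun r => hX.apply_eq _ (ha r)) w fun r s => by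
    rw [← hw]
    exact Finset.sum_congr rfl fun i _ => (toAut_pow _ _ _).symm

theorem dressClass_one : dressClass H 1 = unary 1 := by
  refine (dressClass_eq_sum_of_frame (FinGSet.point H) (n := 1)
    (Nat.card_unique (α := PUnit)) (fun _ => ⟨fun _ => 1, fun h _ => (map_one _).symm⟩) (fun _ => 1)
    fun i j => ?_).trans (Fin.sum_univ_one _)
  rw [if_pos (Subsingleton.elim i j)]
  have h1 : ∀ inst : Fintype PUnit.{v + 1}, ∑ x ∈ @Finset.univ _ inst, (1 * 1 : K) = 1 := by
    intro inst
    simp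
  exact h1 _

theorem IsCyclicSet.dressClass_odd {n : ℕ} [NeZero n] (hX : IsCyclicSet X γ x₀ n)
    (hs : SeparatesPowers (toAut γ) n) (hn : Odd n) :
    dressClass H (BurnsideSemiring.mk X) = n • unary 1 := by
  obtain ⟨θ, hθ, h⟩ := hs.exists_self_dual hn
  rw [hX.dressClass_eq (fun r => (toAut γ ^ (r : ℕ)) θ) (fun r => by rw [pow_comm_apply, hθ])
    (fun _ => 1) fun r s => (h r s).trans rfl]
  simp

/-- The weights `2` and `2 δ ^ 2` of the trace form of a quadratic extension. -/
structure QuadraticData (γ : H) where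
  δ : K
  ne_zero : δ ≠ 0
  apply_eq : toAut γ δ = -δ
  two : (fixed H)ˣ
  coe_two : ((two : fixed H) : K) = 2
  disc : (fixed H)ˣ
  coe_disc : ((disc : fixed H) : K) = 2 * δ ^ 2

theorem IsTopGenerator.exists_quadraticData (hγ : IsTopGenerator γ)
    (h2 : SeparatesPowers (toAut γ) 2) : Nonempty (QuadraticData γ) := by
  obtain ⟨δ, hδ, hneg⟩ := SeparatesPowers.exists_neg (n := 1) h2 one_pos
  rw [pow_one] at hneg
  have h2K : (2 : K) ≠ 0 := two_ne_zero_of_algebra F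
  refine ⟨⟨δ, hδ, hneg, Units.mk0 2 (NeZero.ne 2), rfl,
    Units.mk0 ⟨2 * δ ^ 2, hγ.mem_fixed ?_⟩ ?_, rfl⟩⟩
  · change toAut γ (2 * δ ^ 2) = _
    rw [map_mul, map_pow, hneg, map_ofNat, neg_sq]
  · exact fun e => mul_ne_zero h2K (pow_ne_zero 2 hδ) (congrArg Subtype.val e)

namespace QuadraticData

variable (D : QuadraticData γ)

theorem dressClass_two (hX : IsCyclicSet X γ x₀ 2) :
    dressClass H (BurnsideSemiring.mk X) = unary D.two + unary D.disc := by
  have h1 : ∀ a, (toAut γ ^ ((1 : Fin 2) : ℕ)) a = toAut γ a := fun _ => rfl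
  rw [hX.dressClass_eq ![1, D.δ] ?_ ![D.two, D.disc] ?_, Fin.sum_univ_two]
  · rfl
  · intro r
    fin_cases r
    · exact map_one _
    · change toAut γ (toAut γ D.δ) = D.δ
      rw [D.apply_eq, map_neg, D.apply_eq, neg_neg]
  · intro r s
    rw [Fin.sum_univ_two, map_mul, map_mul, h1, h1]
    fin_cases r <;> fin_cases s <;> simp [D.coe_two, D.coe_disc, D.apply_eq] <;> ring

/-- The cyclic extension of degree 8 above the quartic one supplies an element β with `σ ^ 4 β =
-β`, the input of `exists_frame_four`. -/
theorem dressClass_four (hX : IsCyclicSet X γ x₀ 4) (h4 : SeparatesPowers (toAut γ) 4)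
    (h8 : SeparatesPowers (toAut γ) 8) :
    dressClass H (BurnsideSemiring.mk X) = unary 1 + unary 1 + (unary D.two + unary D.disc) := by
  have h2K : (2 : K) ≠ 0 := two_ne_zero_of_algebra F
  obtain ⟨β, hβ, hN⟩ := SeparatesPowers.exists_neg_anisotropic (n := 4) h2K h4 h8 (by norm_num)
  obtain ⟨a, ha, h⟩ := exists_frame_four h2K hβ hN D.apply_eq
  rw [hX.dressClass_eq a ha ![1, 1, D.two, D.disc] fun r s => ?_, Fin.sum_univ_four]
  · simp [add_assoc]
  · rw [h]
    fin_cases r <;> simp [D.coe_two, D.coe_disc]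

/-- Both equalities come from `unary_add_unary`: 2 is a sum of two squares, and 2 equals 2 δ² times
a sum of two squares in K^H. The second fact uses an element with σ² n = -n from the cyclic quartic
extension. -/
theorem two_nsmul_eq (hγ : IsTopGenerator γ) (h2 : SeparatesPowers (toAut γ) 2)
    (h4 : SeparatesPowers (toAut γ) 4) :
    2 • (unary D.two + unary D.disc) = 4 • (unary 1 : QuadClass (fixed H)) := by
  have h2K : (2 : K) ≠ 0 := two_ne_zero_of_algebra F
  obtain ⟨n, hn, hs⟩ := SeparatesPowers.exists_neg_anisotropic (n := 2) h2K h2 h4 (by norm_num)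
  have h5 : unary D.two + unary D.two = unary 1 + unary 1 :=
    unary_add_unary 1 1 (Subtype.ext (by
      rw [D.coe_two]
      change (2 : K) = 1 * (1 ^ 2 + 1 ^ 2)
      norm_num))
  obtain ⟨m, hm⟩ : ∃ m, m = toAut γ n := ⟨_, rfl⟩
  have hm' : toAut γ m = -n := by
    rw [hm, ← hn]
    rfl
  have hs' : n ^ 2 + m ^ 2 ≠ 0 := by
    rw [Fin.sum_univ_two] at hs
    rw [hm]
    exact hs
  have hσ2 : toAut γ 2 = 2 := map_ofNat _ 2
  -- With m = σ n and σ m = -n, both n² - m² and n m change sign under σ, as δ does, so the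
  -- quotients are fixed. The sum of their squares is δ⁻² by (n² - m²)² + (2 n m)² = (n² + m²)².
  have hA : toAut γ ((n ^ 2 - m ^ 2) / ((n ^ 2 + m ^ 2) * D.δ)) =
      (n ^ 2 - m ^ 2) / ((n ^ 2 + m ^ 2) * D.δ) := by
    simp only [map_div₀, map_mul, map_add, map_sub, map_pow, ← hm, hm', D.apply_eq]
    have := D.ne_zero
    have h6 : m ^ 2 + (-n) ^ 2 = n ^ 2 + m ^ 2 := by ring
    rw [h6]
    field_simp
    ring
  have hB : toAut γ (2 * n * m / ((n ^ 2 + m ^ 2) * D.δ)) =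
      2 * n * m / ((n ^ 2 + m ^ 2) * D.δ) := by
    simp only [map_div₀, map_mul, map_add, map_pow, ← hm, hm', D.apply_eq, hσ2]
    have := D.ne_zero
    have h6 : m ^ 2 + (-n) ^ 2 = n ^ 2 + m ^ 2 := by ring
    rw [h6]
    field_simp
  have h6 : unary D.two + unary D.two = unary D.disc + unary D.disc :=
    unary_add_unary ⟨_, hγ.mem_fixed hA⟩ ⟨_, hγ.mem_fixed hB⟩ (Subtype.ext (by
      rw [D.coe_two]
      change (2 : K) = (D.disc : fixed H) * (((n ^ 2 - m ^ 2) / ((n ^ 2 + m ^ 2) * D.δ)) ^ 2 +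
        (2 * n * m / ((n ^ 2 + m ^ 2) * D.δ)) ^ 2)
      rw [D.coe_disc]
      have := D.ne_zero
      field_simp
      ring))
  rw [nsmul_add, two_nsmul, two_nsmul, ← h6, h5]
  abel

/-- The quadratic form of a cyclic set of order two is not stably `⟨1, 1⟩`. -/
theorem add_ne (x : QuadClass (fixed H)) :
    unary D.two + unary D.disc + x ≠ unary 1 + unary 1 + x := by
  intro e
  obtain ⟨u, hu⟩ := exists_sq_of_unary_add_eq e
  have h1 := congrArg (Subtype.val : fixed H → K) hu
  change (D.two : fixed H) * (D.disc : fixed H) = (u : K) ^ 2 * (1 * 1) at h1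
  rw [D.coe_two, D.coe_disc] at h1
  have h2K : (2 : K) ≠ 0 := two_ne_zero_of_algebra F
  have hu' : toAut γ u = u := (IntermediateField.mem_fixedField_iff _ _).1 u.2 _ γ.2
  -- Equal discriminants would make 4 δ² a square u² with u in K^H, so 2 δ = ± u would be fixed by
  -- the generator, which negates it.
  have h3 : (2 * D.δ - u) * (2 * D.δ + u) = 0 := by linear_combination h1
  have h4 : toAut γ (2 * D.δ) = -(2 * D.δ) := by rw [map_mul, D.apply_eq, map_ofNat, mul_neg]
  have h5 : toAut γ (2 * D.δ) = 2 * D.δ := by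
    rcases mul_eq_zero.1 h3 with h | h
    · rw [sub_eq_zero.1 h, hu']
    · rw [eq_neg_of_add_eq_zero_left h, map_neg, hu']
  rw [h4] at h5
  have h6 : 2 * (2 * D.δ) = 0 := by linear_combination -h5
  exact D.ne_zero ((mul_eq_zero.1 ((mul_eq_zero.1 h6).resolve_left h2K)).resolve_left h2K)

end QuadraticData

end CyclicSets

/-! ## The trace ideal -/

/-- A group isomorphic to the profinite integers is commutative. -/
@[reducible] def commGroupOfEquiv {G : Type u} [Group G] [TopologicalSpace G] (e : G ≃ₜ* ZHat) :
    CommGroup G where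
  mul_comm x y := e.injective (by rw [map_mul, map_mul, ZHat.mul_comm'])

section GaloisGroup

variable {F : Type u} {K : Type v} [Field F] [Field K] [Algebra F K] [IsGalois F K]
  (e : Gal(K/F) ≃ₜ* ZHat)

open BurnsideRing QuadClass

theorem exists_topGenerator (M : ℕ+) : ∃ γ : lvl e M, IsTopGenerator γ ∧
    (∀ (k : ℕ+) (i : ℤ), ((γ ^ i : lvl e M) : Gal(K/F)) ∈ lvl e (k * M) ↔ (k : ℤ) ∣ i) ∧
    ∀ k : ℕ+, Function.Bijective fun i : Fin (k : ℕ) =>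
      (QuotientGroup.mk (γ ^ (i : ℕ)) : lvl e M ⧸ relSub (lvl e M) (lvl e (k * M))) :=
  letI := commGroupOfEquiv e
  ⟨genAt e M, exists_genAt_zpow e M, genAt_zpow_mem_lvl e M, fun k => (quotientEquivFin e M k).bijective⟩

/-- A chosen topological generator of `M Ẑ`. -/
def topGen (M : ℕ+) : lvl e M := (exists_topGenerator e M).choose

theorem isTopGenerator_topGen (M : ℕ+) : IsTopGenerator (topGen e M) :=
  (exists_topGenerator e M).choose_spec.1

theorem topGen_zpow_mem (M k : ℕ+) (i : ℤ) :
    ((topGen e M ^ i : lvl e M) : Gal(K/F)) ∈ lvl e (k * M) ↔ (k : ℤ) ∣ i :=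
  (exists_topGenerator e M).choose_spec.2.1 k i

theorem separatesPowers_topGen (M k : ℕ+) : SeparatesPowers (toAut (topGen e M)) k :=
  separatesPowers_toAut (lvl e (k * M)) fun i => by
    have h := topGen_zpow_mem e M k i
    rw [zpow_natCast, Int.natCast_dvd_natCast] at h
    exact h

theorem isCyclicSet_orbitSet (M k : ℕ+) : IsCyclicSet (orbitSet (lvl e M) (lvl e (k * M))) (topGen e M)
    (QuotientGroup.mk 1 : lvl e M ⧸ relSub (lvl e M) (lvl e (k * M))) k where
  bijective := by
    have h := (exists_topGenerator e M).choose_spec.2.2 k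
    have h1 : (fun i : Fin (k : ℕ) => topGen e M ^ (i : ℕ) •
        (QuotientGroup.mk 1 : lvl e M ⧸ relSub (lvl e M) (lvl e (k * M)))) =
        fun i : Fin (k : ℕ) => QuotientGroup.mk (topGen e M ^ (i : ℕ)) :=
      funext fun i => congrArg QuotientGroup.mk (mul_one (topGen e M ^ (i : ℕ)))
    exact (congrArg Function.Bijective h1).mpr h
  apply_eq a ha h hx := by
    have hL : (h : Gal(K/F)) ∈ lvl e (k * M) := by
      have h1 := QuotientGroup.eq.1 hx
      rw [mul_one, inv_mem_iff] at h1
      exact h1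
    -- An element of the stabilizer agrees on a with a power of the generator that can also be kept
    -- in the stabilizer; its exponent is then a multiple of k.
    obtain ⟨j, hj, hV⟩ := (isTopGenerator_topGen e M).exists_zpow (lvl e (k * M)) a h
    have h2 : ((topGen e M ^ j : lvl e M) : Gal(K/F)) ∈ lvl e (k * M) :=
      (mul_mem_cancel_left (inv_mem hL)).1 hV
    rw [topGen_zpow_mem] at h2
    obtain ⟨i, rfl⟩ := h2
    rw [hj, zpow_mul]
    refine zpow_apply_eq_self ?_ i
    rw [toAut_pow] at ha
    exact_mod_cast ha

variable [NeZero (2 : F)]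

/-- The isomorphism class of `M Ẑ / k M Ẑ`. -/
def levelClass (M k : ℕ+) : BurnsideSemiring (lvl e M) :=
  BurnsideSemiring.mk (orbitSet (lvl e M) (lvl e (k * M)))

theorem t_eq_of (M k : ℕ+) : t e M k = GrothendieckRing.of (levelClass e M k) := rfl

theorem natCast_eq_of (M : ℕ+) (n : ℕ) :
    (n : BurnsideRing (lvl e M)) = GrothendieckRing.of (n • (1 : BurnsideSemiring (lvl e M))) := by
  rw [map_nsmul, nsmul_eq_mul]
  exact (mul_one _).symm

theorem dressClass_levelClass_odd (M p : ℕ+) (hp : Odd (p : ℕ)) :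
    dressClass _ (levelClass e M p) = dressClass _ ((p : ℕ) • (1 : BurnsideSemiring (lvl e M))) := by
  have : NeZero (p : ℕ) := ⟨p.ne_zero⟩
  rw [map_nsmul, dressClass_one]
  exact (isCyclicSet_orbitSet e M p).dressClass_odd (separatesPowers_topGen e M p) hp

theorem exists_quadraticData (M : ℕ+) : Nonempty (QuadraticData (topGen e M)) :=
  (isTopGenerator_topGen e M).exists_quadraticData (separatesPowers_topGen e M 2)

theorem dressClass_levelClass_four (M : ℕ+) : dressClass _ (levelClass e M 4) =
    dressClass _ (levelClass e M 2 + 2 • (1 : BurnsideSemiring (lvl e M))) := by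
  obtain ⟨D⟩ := exists_quadraticData e M
  rw [map_add, map_nsmul, dressClass_one]
  refine (D.dressClass_four (isCyclicSet_orbitSet e M 4) (separatesPowers_topGen e M 4)
    (separatesPowers_topGen e M 8)).trans ?_
  rw [add_comm, two_nsmul]
  exact congrArg (· + (unary 1 + unary 1)) (D.dressClass_two (isCyclicSet_orbitSet e M 2)).symm

theorem dressClass_levelClass_two (M : ℕ+) : dressClass _ (2 • levelClass e M 2) =
    dressClass _ (4 • (1 : BurnsideSemiring (lvl e M))) := by
  obtain ⟨D⟩ := exists_quadraticData e M
  rw [map_nsmul, map_nsmul, dressClass_one]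
  refine Eq.trans ?_ (D.two_nsmul_eq (isTopGenerator_topGen e M) (separatesPowers_topGen e M 2)
    (separatesPowers_topGen e M 4))
  exact congrArg (2 • ·) (D.dressClass_two (isCyclicSet_orbitSet e M 2))

theorem dress_tr_odd (M k p : ℕ+) (hp : Odd (p : ℕ)) (h : lvl e (k * M) ≤ lvl e M) :
    dress _ (tr h (t e (k * M) p - ((p : ℕ) : BurnsideRing (lvl e (k * M))))) = 0 := by
  rw [t_eq_of, natCast_eq_of]
  exact dress_tr_of_sub_of h (dressClass_levelClass_odd e _ p hp)

theorem dress_tr_even (M k : ℕ+) (h : lvl e (k * M) ≤ lvl e M) :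
    dress _ (tr h (t e (k * M) 4 - t e (k * M) 2 - 2)) = 0 := by
  have h2 : (2 : BurnsideRing (lvl e (k * M))) =
      GrothendieckRing.of (2 • (1 : BurnsideSemiring (lvl e (k * M)))) := natCast_eq_of e _ 2
  rw [t_eq_of, t_eq_of, h2, sub_sub, ← map_add]
  exact dress_tr_of_sub_of h (dressClass_levelClass_four e _)

theorem dress_two (M : ℕ+) : dress _ (2 * t e M 2 - 4) = 0 := by
  have h4 : (4 : BurnsideRing (lvl e M)) =
      GrothendieckRing.of (4 • (1 : BurnsideSemiring (lvl e M))) := natCast_eq_of e _ 4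
  have h2 : 2 * t e M 2 = GrothendieckRing.of (2 • levelClass e M 2) := by
    rw [map_nsmul, ← t_eq_of, two_nsmul, two_mul]
  rw [map_sub, h2, h4, dress_of, dress_of, dressClass_levelClass_two, sub_self]

/-- The Dress map is injective on the combinations `n + m t_2` with `m = 0` or `m = 1`. -/
theorem eq_zero_of_dress_eq_zero (M : ℕ+) {n m : ℤ} (hm : m = 0 ∨ m = 1)
    (h : dress _ (n • (1 : BurnsideRing (lvl e M)) + m • t e M 2) = 0) : n = 0 ∧ m = 0 := by
  obtain ⟨D⟩ := exists_quadraticData e M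
  have h1 : dress _ (1 : BurnsideRing (lvl e M)) = Algebra.GrothendieckAddGroup.of (unary 1) :=
    (dress_of 1).trans (congrArg _ dressClass_one)
  have h2 : dress _ (t e M 2) = Algebra.GrothendieckAddGroup.of (unary D.two + unary D.disc) :=
    (dress_of _).trans (congrArg _ (D.dressClass_two (isCyclicSet_orbitSet e M 2)))
  rw [map_add, map_zsmul, map_zsmul, h1, h2] at h
  have hl : ∀ x : QuadClass (fixed (lvl e M)), Algebra.GrothendieckAddGroup.lift rank
      (Algebra.GrothendieckAddGroup.of x) = rank x := fun x =>
    DFunLike.congr_fun (Algebra.GrothendieckAddGroup.lift.symm_apply_apply rank) x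
  have hr := congrArg (Algebra.GrothendieckAddGroup.lift rank) h
  rw [map_add, map_zsmul, map_zsmul, hl, hl, map_add, rank_unary, rank_unary, rank_unary, map_zero] at hr
  rcases hm with rfl | rfl
  · exact ⟨by simpa using hr, rfl⟩
  · exfalso
    -- The rank is n + 2m, so m = 1 forces n = -2. The quadratic trace form would then be stably ⟨1,
    -- 1⟩, against `QuadraticData.add_ne`.
    obtain rfl : n = -2 := by
      simp only [smul_eq_mul] at hr
      omega
    have h3 : (Algebra.GrothendieckAddGroup.of (unary D.two + unary D.disc) :
        GrothendieckWitt (fixed (lvl e M))) = Algebra.GrothendieckAddGroup.of (unary 1 + unary 1) := by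
      rw [one_smul, neg_smul, neg_add_eq_zero] at h
      rw [← h, map_add, two_zsmul]
    obtain ⟨c, hc⟩ := exists_add_eq_of_grothendieck h3
    exact D.add_ne c hc

/-- Let S be the part of the generated ideal killed by the Dress map; it contains all the relations
of the normal form. As it lies in the sign ideal, it exhausts that ideal, so the Dress map kills the
whole generated ideal. Conversely, an element of the kernel has a normal form modulo S that is again
in the kernel, hence zero. -/
theorem isTraceIdeal_span_generators :
    IsTraceIdeal (TambaraIdeal.span (generators e)) := by
  let _ := commGroupOfEquiv e
  intro H
  obtain ⟨M, rfl⟩ := exists_eq_lvl e H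
  have h1 := span_generators_level e (lvl e M)
  have hI := isLarge_of_contains_generators e (I := TambaraIdeal.span (generators e))
    (fun a ha => TambaraIdeal.mem_span ha) M
  let D : AddSubgroup (BurnsideRing (lvl e M)) := (dress (lvl e M)).ker
  let S : AddSubgroup (BurnsideRing (lvl e M)) :=
    D ⊓ ((TambaraIdeal.span (generators e)).level (lvl e M)).toAddSubgroup
  have hS : IsLarge e S :=
    { odd := fun p k hp hp2 => ⟨dress_tr_odd e M k p
        (hp.odd_of_ne_two fun h => hp2 (PNat.coe_injective h)) _, hI.odd p k hp hp2⟩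
      even := fun k => ⟨dress_tr_even e M k _, hI.even k⟩
      two := ⟨dress_two e M, hI.two⟩ }
  intro x
  constructor
  · intro hx
    have h2 : S ≤ (signLevel e (lvl e M)).toAddSubgroup := by
      rw [← h1]
      exact inf_le_right
    rw [h1] at hx
    exact (hS.signLevel_le e h2 hx).1
  · intro hx
    obtain ⟨n, m, hm, hnm⟩ := hS.normal_form e x
    have h2 : dress (lvl e M) (n • (1 : BurnsideRing (lvl e M)) + m • t e M 2) = 0 := by
      have h3 : dress (lvl e M) (x - _) = 0 := hnm.1
      rw [map_sub, hx, zero_sub, neg_eq_zero] at h3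
      exact h3
    obtain ⟨rfl, rfl⟩ := eq_zero_of_dress_eq_zero e M hm h2
    rw [zero_smul, zero_smul, add_zero, sub_zero] at hnm
    exact hnm.2

end GaloisGroup

end TraceIdeal

end

theorem mainTheorem8 {F : Type*} {K : Type*} [Field F] [Field K] [Algebra F K] [IsGalois F K]
    [NeZero (2 : F)] (e : Gal(K/F) ≃ₜ* TraceIdeal.ZHat) :
    ∃ I : TraceIdeal.TambaraIdeal Gal(K/F),
      TraceIdeal.IsTraceIdeal I ∧
      I = TraceIdeal.TambaraIdeal.span (TraceIdeal.generators e) ∧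
      (∀ n : ℕ+, 4 ≤ n → (TraceIdeal.chainIdeal e n).IsStronglyPrincipal) ∧
      (∀ n : ℕ+, 4 ≤ n → TraceIdeal.chainIdeal e n ≤ TraceIdeal.chainIdeal e (n + 1)) ∧
      (∀ (H : OpenSubgroup Gal(K/F)) (x : TraceIdeal.BurnsideRing H),
        x ∈ I.level H ↔ ∃ n : ℕ+, 4 ≤ n ∧ x ∈ (TraceIdeal.chainIdeal e n).level H) ∧
      ¬ I.IsFinitelyGenerated := by
  let _ := TraceIdeal.commGroupOfEquiv e
  refine ⟨TraceIdeal.TambaraIdeal.span (TraceIdeal.generators e),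
    TraceIdeal.isTraceIdeal_span_generators e, rfl, fun n _ => ⟨_, _, rfl⟩,
    fun n _ => TraceIdeal.chainIdeal_mono e (PNat.lt_add_right n 1).le, fun H x => ?_,
    TraceIdeal.not_isFinitelyGenerated e⟩
  rw [← TraceIdeal.mem_chainUnion e, ← TraceIdeal.span_generators_eq_chainUnion e]
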